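/- Let $O\subset\mathbb R^2$ be the regular octagon centred at the origin with sides of length one, two of them horizontal, and let $S_O$ be the surface obtained from $O$ by identifying opposite sides by translations. Label the pairs of opposite sides, clockwise from the horizontal top side, by $A,B,C,D$. A (bi-infinite) linear trajectory in direction $\theta\in[0,\pi]$ is a path $\tau:\mathbb R\to S_O$ which moves inside the octagon with a constant non-zero velocity parallel to $(\cos\theta,\sin\theta)$, continues, each time it hits the boundary, from the corresponding point of the opposite side into the interior with the same velocity, and never hits a vertex. Its cutting sequence $c(\tau)\in\{A,B,C,D\}^{\mathbb Z}$ is the bi-infinite word of the labels of the pairs of sides crossed by $\tau$ as time increases (well defined up to a shift of the index). For $i=0,\dots,7$ let $\overline\Sigma_i=[i\pi/8,(i+1)\pi/8]$, let $\nu_i$ be the linear isometry of $O$ which maps the directions in $\overline\Sigma_i$ to those in $\overline\Sigma_0$, namely the rotation by $-i\pi/8$ if $i$ is even and the reflection $\theta\mapsto (i+1)\pi/8-\theta$ if $i$ is odd, and let $\gamma=\begin{pmatrix}-1&2(1+\sqrt2)\\0&1\end{pmatrix}$. Let $F_i:\overline\Sigma_i\to[\pi/8,\pi]$ be the map induced by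 $\gamma\nu_i$ on directions of lines, where a direction is recorded by its angle in $(0,\pi]$. A sequence $(s_k)_{k\ge0}$ in $\{0,\dots,7\}$ with $s_k\ne0$ for all $k\ge1$ is an octagon additive continued fraction expansion of $\theta\in[0,\pi]$, with entries $s_k$, if $$\bigcap_{k\ge 0}F_{s_0}^{-1}F_{s_1}^{-1}\cdots F_{s_k}^{-1}[0,\pi]=\{\theta\}.$$ The direction $\theta$ is called terminating if it has such an expansion whose entries are eventually all $1$ or eventually all $7$. Proposition 2.8. Every linear trajectory $\tau$ in direction $\theta\in[0,\pi]$ has a cutting sequence $c(\tau)$, and the following properties are equivalent: (i) the trajectory $\tau$ is periodic, i.e. there is $T>0$ with $\tau(t+T)=\tau(t)$ for all $t\in\mathbb R$; (ii) the cutting sequence $c(\tau)$ is a periodic word, i.e. there is an integer $n>0$ with $c(\tau)_{k+n}=c(\tau)_k$ for all $k\in\mathbb Z$; (iii) the direction $\theta$ is terminating. -/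

import Mathlib

namespace OctagonFlow

noncomputable section

/-! ### The regular octagon and the surface obtained from it -/

/-- The vertices of the regular octagon centred at the origin of the plane `ℂ = ℝ²`, with sides of
length one and two horizontal sides. They are listed clockwise, and the first two are the endpoints
of the horizontal top side: `vertex 0, …, vertex 7` are `O₁, …, O₈`. -/
def vertex : Fin 8 → ℂ :=
  ![⟨-1 / 2, (1 + √2) / 2⟩, ⟨1 / 2, (1 + √2) / 2⟩,
    ⟨(1 + √2) / 2, 1 / 2⟩, ⟨(1 + √2) / 2, -1 / 2⟩,
    ⟨1 / 2, -((1 + √2) / 2)⟩, ⟨-1 / 2, -((1 + √2) / 2)⟩,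
    ⟨-((1 + √2) / 2), -1 / 2⟩, ⟨-((1 + √2) / 2), 1 / 2⟩]

/-- The closed octagon. -/
def octagon : Set ℂ := convexHull ℝ (Set.range vertex)

/-- The eight (closed) sides; indices are modulo 8, so `side 7` joins `vertex 7` to `vertex 0`. -/
def side (k : Fin 8) : Set ℂ := segment ℝ (vertex k) (vertex (k + 1))

/-- The gluing: a point of the side `k` is glued to its image on the opposite side `k + 4` under
the translation which carries one side onto the other (it carries `vertex k` to
`vertex (k + 5)` and `vertex (k + 1)` to `vertex (k + 4)`). -/
def Glue (p q : octagon) : Prop :=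
  ∃ k : Fin 8, (p : ℂ) ∈ side k ∧ (q : ℂ) = p + (vertex (k + 5) - vertex k)

/-- The surface `S_O`: the quotient of the octagon by the equivalence relation generated by the
gluing of opposite sides. -/
def Surface : Type := Quot Glue

/-- The point `x` of the surface is represented by the point `z` of the octagon. -/
def Represents (z : ℂ) (x : Surface) : Prop :=
  ∃ h : z ∈ octagon, Quot.mk Glue ⟨z, h⟩ = x

/-! ### Linear trajectories and their cutting sequences -/

/-- `τ` is a bi-infinite linear trajectory in direction `θ`. It has a constant nonzero velocity `v`
parallel to `(cos θ, sin θ)` (directions are points of the projective line, so the sense of travel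
is free), and it never meets a vertex. At each time `t` it arrives at a point `p` of the octagon,
coming from the interior along a segment with velocity `v`, and it leaves into the interior along a
segment with velocity `v` from a point `q` that is identified with `p`. So `q = p` when `p` is
interior, and `p`, `q` are corresponding points of opposite sides when `p` is on the boundary. -/
def IsLinearTrajectory (θ : ℝ) (τ : ℝ → Surface) : Prop :=
  ∃ c : ℝ, c ≠ 0 ∧ ∃ v : ℂ, v = c * (⟨Real.cos θ, Real.sin θ⟩ : ℂ) ∧
    ∀ t : ℝ, ∃ p q : ℂ,
      Represents p (τ t) ∧ Represents q (τ t) ∧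
      p ∉ Set.range vertex ∧ q ∉ Set.range vertex ∧
      ∃ ε : ℝ, 0 < ε ∧ ∀ s : ℝ, 0 < s → s < ε →
        (p - s * v ∈ interior octagon ∧ Represents (p - s * v) (τ (t - s))) ∧
        (q + s * v ∈ interior octagon ∧ Represents (q + s * v) (τ (t + s)))

/-- A trajectory is periodic if it closes up: it repeats after some positive time. -/
def IsPeriodicTrajectory (τ : ℝ → Surface) : Prop :=
  ∃ T : ℝ, 0 < T ∧ ∀ t : ℝ, τ (t + T) = τ t

/-- The alphabet of labels of the pairs of opposite sides. -/
inductive Letter where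
  | A
  | B
  | C
  | D

/-- The label of a side; opposite sides have the same label. -/
def label : Fin 8 → Letter :=
  ![Letter.A, Letter.B, Letter.C, Letter.D, Letter.A, Letter.B, Letter.C, Letter.D]

/-- At time `t` the trajectory crosses a (pair of identified) side(s) labelled `L`. -/
def CrossesAt (τ : ℝ → Surface) (t : ℝ) (L : Letter) : Prop :=
  ∃ k : Fin 8, label k = L ∧ ∃ z ∈ side k, Represents z (τ t)

/-- `w` is the cutting sequence `c(τ)`: the crossing times form a bi-infinite increasing sequence
`t`, and `w n` is the label of the side crossed at time `t n`. (As a bi-infinite word, `c(τ)` has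
no distinguished origin: `t` and `w` are determined by `τ` up to a shift of the index.) -/
def IsCuttingSequence (τ : ℝ → Surface) (w : ℤ → Letter) : Prop :=
  ∃ t : ℤ → ℝ, StrictMono t ∧ Set.range t = {u : ℝ | ∃ L, CrossesAt τ u L} ∧
    ∀ n : ℤ, CrossesAt τ (t n) (w n)

/-- A bi-infinite word is periodic if its letters repeat periodically. -/
def IsPeriodicWord (w : ℤ → Letter) : Prop :=
  ∃ n : ℕ, 0 < n ∧ ∀ k : ℤ, w (k + n) = w k

/-! ### The octagon Farey map and the octagon additive continued fraction -/

/-- The closed sectors of directions `[iπ/8, (i+1)π/8]`. -/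
def closedSector (i : Fin 8) : Set ℝ :=
  Set.Icc ((i : ℕ) * Real.pi / 8) (((i : ℕ) + 1) * Real.pi / 8)

/-- The isometries `ν i` of the octagon which carry the closed sector `i` to the sector `0`. -/
def ν : Fin 8 → Matrix (Fin 2) (Fin 2) ℝ :=
  ![!![1, 0; 0, 1],
    !![1 / √2, 1 / √2; 1 / √2, -(1 / √2)],
    !![1 / √2, 1 / √2; -(1 / √2), 1 / √2],
    !![0, 1; 1, 0],
    !![0, 1; -1, 0],
    !![-(1 / √2), 1 / √2; 1 / √2, 1 / √2],
    !![-(1 / √2), 1 / √2; -(1 / √2), -(1 / √2)],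
    !![-1, 0; 0, 1]]

/-- The linear part of the affine reflection. -/
def γ : Matrix (Fin 2) (Fin 2) ℝ := !![-1, 2 * (1 + √2); 0, 1]

/-- The angle coordinate, in `(0, π]`, of the direction of the line spanned by `v ≠ 0`: this is
the inverse cotangent of `v 0 / v 1`, with the value `π` for horizontal lines. -/
def lineAngle (v : Fin 2 → ℝ) : ℝ :=
  if 0 < Complex.arg ⟨v 0, v 1⟩ then Complex.arg ⟨v 0, v 1⟩
  else Complex.arg ⟨v 0, v 1⟩ + Real.pi

/-- The branch `F_i` of the octagon Farey map, in the angle coordinate: the projective map induced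
by `γ ν_i`. It is used on the closed sector `i`, which it carries onto `[π/8, π]`. -/
def branch (i : Fin 8) (θ : ℝ) : ℝ :=
  lineAngle ((γ * ν i).mulVec ![Real.cos θ, Real.sin θ])

/-- `sectorCF n s` is the set `F_{s 0}⁻¹ F_{s 1}⁻¹ ⋯ F_{s (n-1)}⁻¹ [0, π]`, where `F_i` has the
closed sector `i` as its domain. -/
def sectorCF : ℕ → (ℕ → Fin 8) → Set ℝ
  | 0, _ => Set.Icc 0 Real.pi
  | n + 1, s => {θ | θ ∈ closedSector (s 0) ∧ branch (s 0) θ ∈ sectorCF n (fun k => s (k + 1))}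

/-- `θ = [s 0; s 1, s 2, …]` is an octagon additive continued fraction expansion of `θ`; the entry
`0` is only allowed in the first place. -/
def IsExpansion (s : ℕ → Fin 8) (θ : ℝ) : Prop :=
  (∀ k, s k = 0 → k = 0) ∧ ⋂ n : ℕ, sectorCF n s = {θ}

/-- A direction is terminating if it has an octagon additive continued fraction expansion whose
entries are eventually all `1` or eventually all `7`. -/
def IsTerminating (θ : ℝ) : Prop :=
  ∃ s : ℕ → Fin 8, IsExpansion s θ ∧
    ((∃ N, ∀ k ≥ N, s k = 1) ∨ (∃ N, ∀ k ≥ N, s k = 7))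

end

end OctagonFlow

namespace OctagonFlow

open Filter Topology

/-! The crossing times of a trajectory are discrete and unbounded in both directions, so they are
indexed by the integers and a cutting sequence exists.

Trajectory and word: a period of the trajectory shifts the crossing times, and an order automorphism
of the integers is a translation, so the word is periodic (`periodicWord_of_periodic`). Conversely,
a letter together with the velocity determines the side through which the trajectory leaves. A
period of the word therefore fixes the total gluing translation over one block, and the exit points
after successive blocks form an arithmetic progression. The octagon is bounded, so the progression
is constant and the trajectory closes up (`periodic_of_periodicWord`).

Terminating implies periodic: each `ν i` and `γ` is the linear part of an injective affine map of
the surface. For the `ν i` this is the symmetry of the octagon; `γ` is a reflection combined with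
Dehn twists in the two horizontal cylinders (`isAffine_γ`). Complete periodicity of a direction
therefore pulls back along every branch of the Farey map. A constant tail `7` or `1` forces the
direction `π` or `π / 8`, and for these explicit cylinder decompositions close up every trajectory
(`completelyPeriodic_horizontal`, `completelyPeriodic_diagonal`).

Periodic implies terminating: take the holonomy vector of the closed trajectory, moved into the cone
over the sector `0`. Its coordinates in the basis of eighth roots of unity are integers up to a
common factor, and the signs of the crossings give each a definite sign. The same holds after any
number of applications of the two parabolic maps that preserve the cone. Linear growth then turns
the signs into further inequalities (`IsHolonomy.constraints`), under which `γ` does not increase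
the sum of the absolute values of the coordinates (`Bounded.map_γ`). The Farey orbit of the vector
thus stays in a finite set, while `γ` strictly shortens every vector inside the cone
(`normSq_γ_lt`). The descent stops at the boundary of the cone, where the next direction is `π` or
`π / 8`, and the expansion continues with a constant tail (`hasExpansion_of_holonomy`). -/

/-- The silver ratio `1 + √2`, which is the distance between opposite sides of the octagon. -/
noncomputable def sil : ℝ := 1 + √2

theorem sqrt_two_eq : √2 = sil - 1 := by unfold sil; ring

theorem sil_sq : sil * sil = 2 * sil + 1 := by
  have h : √2 * √2 = 2 := Real.mul_self_sqrt (by norm_num)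
  unfold sil; nlinarith

theorem sil_gt : 2.4 < sil := by
  have h : (1.4 : ℝ) < √2 := Real.lt_sqrt_of_sq_lt (by norm_num)
  unfold sil; linarith

theorem one_div_sqrt_two : 1 / √2 = (sil - 1) / 2 := by
  rw [← sqrt_two_eq]; exact Real.sqrt_div_self'.symm

/-! ### The octagon in coordinates normal and tangential to its sides. -/

/-- The outer unit normals of the sides of the octagon. -/
noncomputable def normal : Fin 8 → ℂ :=
  ![⟨0, 1⟩, ⟨(sil - 1) / 2, (sil - 1) / 2⟩, ⟨1, 0⟩, ⟨(sil - 1) / 2, -((sil - 1) / 2)⟩,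
    ⟨0, -1⟩, ⟨-((sil - 1) / 2), -((sil - 1) / 2)⟩, ⟨-1, 0⟩, ⟨-((sil - 1) / 2), (sil - 1) / 2⟩]

/-- The component of a vector along an outer normal. -/
noncomputable def dot (k : Fin 8) (z : ℂ) : ℝ := (normal k).re * z.re + (normal k).im * z.im

/-- The component of a vector along a side. -/
noncomputable def tang (k : Fin 8) (z : ℂ) : ℝ := (normal k).re * z.im - (normal k).im * z.re

/-- The translation that glues a side to the opposite one. -/
noncomputable def shift (k : Fin 8) : ℂ := vertex (k + 5) - vertex k

@[simp] theorem dot_add (k z w) : dot k (z + w) = dot k z + dot k w := by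
  simp only [dot, Complex.add_re, Complex.add_im]; ring
@[simp] theorem dot_sub (k z w) : dot k (z - w) = dot k z - dot k w := by
  simp only [dot, Complex.sub_re, Complex.sub_im]; ring
@[simp] theorem dot_neg (k z) : dot k (-z) = -dot k z := by
  simp only [dot, Complex.neg_re, Complex.neg_im]; ring
@[simp] theorem dot_real_mul (k) (s : ℝ) (z) : dot k (s * z) = s * dot k z := by
  simp only [dot, Complex.mul_re, Complex.mul_im, Complex.ofReal_re, Complex.ofReal_im]; ring

theorem normal_norm (k) : (normal k).re * (normal k).re + (normal k).im * (normal k).im = 1 := by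
  have := sil_sq
  fin_cases k <;> simp [normal] <;> nlinarith

theorem normal_opp (k) : normal (k + 4) = - normal k := by
  fin_cases k <;> simp [normal, Complex.ext_iff]

theorem dot_opp (k z) : dot (k + 4) z = - dot k z := by
  simp only [dot, normal_opp, Complex.neg_re, Complex.neg_im]; ring

theorem vertex_re (k) : (vertex k).re = sil / 2 * (normal k).re - 1 / 2 * (normal k).im := by
  have := sil_sq
  fin_cases k <;> simp [normal, vertex, sqrt_two_eq] <;> nlinarith

theorem vertex_im (k) : (vertex k).im = sil / 2 * (normal k).im + 1 / 2 * (normal k).re := by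
  have := sil_sq
  fin_cases k <;> simp [normal, vertex, sqrt_two_eq] <;> nlinarith

theorem vertex_succ_re (k) :
    (vertex (k + 1)).re = sil / 2 * (normal k).re + 1 / 2 * (normal k).im := by
  have := sil_sq
  fin_cases k <;> simp [normal, vertex, sqrt_two_eq] <;> nlinarith

theorem vertex_succ_im (k) :
    (vertex (k + 1)).im = sil / 2 * (normal k).im - 1 / 2 * (normal k).re := by
  have := sil_sq
  fin_cases k <;> simp [normal, vertex, sqrt_two_eq] <;> nlinarith

theorem shift_eq (k) : shift k = -(sil : ℂ) * normal k := by
  have h : k + 5 = (k + 4) + 1 := by omega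
  have h1 := vertex_succ_re (k + 4)
  have h2 := vertex_succ_im (k + 4)
  rw [normal_opp, Complex.neg_re, Complex.neg_im] at h1 h2
  apply Complex.ext
  · rw [shift, h, Complex.sub_re, h1, vertex_re]; simp; ring
  · rw [shift, h, Complex.sub_im, h2, vertex_im]; simp; ring

theorem shift_opp (k) : shift (k + 4) = - shift k := by
  simp [shift_eq, normal_opp]

theorem dot_shift (k) : dot k (shift k) = -sil := by
  have := normal_norm k
  simp only [shift_eq, dot]; simp; linear_combination (-sil) * this

/-- The octagon in coordinates. -/
def InOct (z : ℂ) : Prop :=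
  (-(sil / 2) ≤ z.re ∧ z.re ≤ sil / 2) ∧ (-(sil / 2) ≤ z.im ∧ z.im ≤ sil / 2) ∧
  (-((sil + 1) / 2) ≤ z.re + z.im ∧ z.re + z.im ≤ (sil + 1) / 2) ∧
  (-((sil + 1) / 2) ≤ z.re - z.im ∧ z.re - z.im ≤ (sil + 1) / 2)

theorem inOct_iff_dot (z) : InOct z ↔ ∀ k, dot k z ≤ sil / 2 := by
  have h1 := sil_sq
  have h2 := sil_gt
  -- The two bounds agree because `(sil - 1) * (sil + 1) = 2 * sil`, a form of `sil_sq`.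
  have key : ∀ s : ℝ, (sil - 1) / 2 * s ≤ sil / 2 ↔ s ≤ (sil + 1) / 2 := by
    intro s; constructor <;> intro h <;> nlinarith
  constructor
  · rintro ⟨⟨a1, a2⟩, ⟨b1, b2⟩, ⟨c1, c2⟩, d1, d2⟩ k
    fin_cases k <;> simp [dot, normal]
    · linarith
    · have := (key (z.re + z.im)).2 c2; linarith
    · linarith
    · have := (key (z.re - z.im)).2 d2; linarith
    · linarith
    · have := (key (-(z.re + z.im))).2 (by linarith); linarith
    · linarith
    · have := (key (-(z.re - z.im))).2 (by linarith); linarith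
  · intro h
    have e0 := h 0; have e1 := h 1; have e2 := h 2; have e3 := h 3
    have e4 := h 4; have e5 := h 5; have e6 := h 6; have e7 := h 7
    simp [dot, normal] at e0 e1 e2 e3 e4 e5 e6 e7
    refine ⟨⟨by linarith, by linarith⟩, ⟨by linarith, by linarith⟩, ⟨?_, ?_⟩, ?_, ?_⟩
    · have := (key (-(z.re + z.im))).1 (by linarith); linarith
    · exact (key (z.re + z.im)).1 (by linarith)
    · have := (key (-(z.re - z.im))).1 (by linarith); linarith
    · exact (key (z.re - z.im)).1 (by linarith)

theorem vertex_inOct (k) : InOct (vertex k) := by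
  have h1 := sil_sq
  have h2 := sil_gt
  fin_cases k <;> simp only [vertex, InOct, sqrt_two_eq] <;> refine ⟨⟨?_, ?_⟩, ⟨?_, ?_⟩, ⟨?_, ?_⟩, ?_, ?_⟩ <;> simp <;> linarith

theorem convex_inOct : Convex ℝ {z | InOct z} := by
  have : {z | InOct z} = ⋂ k, {z | dot k z ≤ sil / 2} := by
    ext z; simp [inOct_iff_dot]
  rw [this]
  refine convex_iInter fun k => ?_
  intro x hx y hy a b ha hb hab
  simp only [Set.mem_ofPred_eq] at *
  have : dot k (a • x + b • y) = a * dot k x + b * dot k y := by simp [dot]; ring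
  have hs : a * (sil / 2) + b * (sil / 2) = sil / 2 := by rw [← add_mul, hab, one_mul]
  rw [this]
  linarith [mul_le_mul_of_nonneg_left hx ha, mul_le_mul_of_nonneg_left hy hb]

theorem mem_segment_of {p q z : ℂ} (s : ℝ) (h0 : 0 ≤ s) (h1 : s ≤ 1)
    (hr : z.re = (1 - s) * p.re + s * q.re) (hi : z.im = (1 - s) * p.im + s * q.im) :
    z ∈ segment ℝ p q := by
  refine ⟨1 - s, s, by linarith, h0, by ring, ?_⟩
  apply Complex.ext <;> simp [hr, hi]

theorem exists_horizontal {x l : ℝ} (hl : 0 < l) (h1 : -l ≤ x) (h2 : x ≤ l) :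
    ∃ s : ℝ, 0 ≤ s ∧ s ≤ 1 ∧ x = (1 - s) * (-l) + s * l := by
  refine ⟨(x + l) / (2 * l), by apply div_nonneg <;> linarith, ?_, ?_⟩
  · rw [div_le_one (by linarith)]; linarith
  · field_simp; ring

/-- For the converse, a point lies on the horizontal chord through it. The ends of the chord lie on
two vertical or slanted sides, so the point is a convex combination of convex combinations of
vertices. -/
theorem mem_octagon_iff (z) : z ∈ octagon ↔ InOct z := by
  have g1 := sil_sq
  have g2 := sil_gt
  constructor
  · intro h
    refine convexHull_min ?_ convex_inOct h
    rintro _ ⟨k, rfl⟩; exact vertex_inOct k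
  · intro h
    have hv : ∀ k, vertex k ∈ octagon := fun k => subset_convexHull _ _ ⟨k, rfl⟩
    have hc : Convex ℝ octagon := convex_convexHull _ _
    have base : ∀ k j i m : Fin 8, ∀ s u : ℝ, 0 ≤ s → s ≤ 1 → 0 ≤ u → u ≤ 1 →
        z.re = (1 - u) * ((1 - s) * (vertex k).re + s * (vertex j).re) +
          u * ((1 - s) * (vertex i).re + s * (vertex m).re) →
        z.im = (1 - u) * ((1 - s) * (vertex k).im + s * (vertex j).im) +
          u * ((1 - s) * (vertex i).im + s * (vertex m).im) → z ∈ octagon := by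
      intro k j i m s u hs0 hs1 hu0 hu1 hr hi
      have m1 : (⟨(1 - s) * (vertex k).re + s * (vertex j).re,
          (1 - s) * (vertex k).im + s * (vertex j).im⟩ : ℂ) ∈ octagon :=
        hc.segment_subset (hv k) (hv j) (mem_segment_of s hs0 hs1 rfl rfl)
      have m2 : (⟨(1 - s) * (vertex i).re + s * (vertex m).re,
          (1 - s) * (vertex i).im + s * (vertex m).im⟩ : ℂ) ∈ octagon :=
        hc.segment_subset (hv i) (hv m) (mem_segment_of s hs0 hs1 rfl rfl)
      exact hc.segment_subset m1 m2 (mem_segment_of u hu0 hu1 hr hi)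
    obtain ⟨⟨a1, a2⟩, ⟨b1, b2⟩, ⟨c1, c2⟩, d1, d2⟩ := h
    by_cases hy : z.im ≤ 1 / 2
    · by_cases hy' : -(1 / 2) ≤ z.im
      · obtain ⟨u, hu0, hu1, hu⟩ := exists_horizontal (l := sil / 2) (by linarith) a1 a2
        refine base 6 7 3 2 (z.im + 1 / 2) u (by linarith) (by linarith) hu0 hu1 ?_ ?_
        · simp [vertex, sqrt_two_eq]; rw [hu]; ring
        · simp [vertex]; ring
      · obtain ⟨u, hu0, hu1, hu⟩ := exists_horizontal (l := (sil + 1) / 2 + z.im) (x := z.re)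
          (by linarith) (by linarith) (by linarith)
        push Not at hy'
        -- The fraction of the slanted side passed at this height: its vertical extent is `(sil - 1)
        -- / 2`, whose inverse is `sil - 1`.
        obtain ⟨s, hs⟩ : ∃ s, s = (-1 / 2 - z.im) * (sil - 1) := ⟨_, rfl⟩
        have hs' : s * (sil - 1) = 2 * (-1 / 2 - z.im) := by
          rw [hs]; linear_combination (-1 / 2 - z.im) * g1
        refine base 6 5 3 4 s u (by nlinarith) (by nlinarith) hu0 hu1 ?_ ?_
        · simp only [vertex, sqrt_two_eq]; simp; linear_combination hu + (u - 1 / 2) * hs'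
        · simp only [vertex, sqrt_two_eq]; simp; linear_combination (1 / 2) * hs'
    · obtain ⟨u, hu0, hu1, hu⟩ := exists_horizontal (l := (sil + 1) / 2 - z.im) (x := z.re)
        (by linarith) (by linarith) (by linarith)
      push Not at hy
      obtain ⟨s, hs⟩ : ∃ s, s = (z.im - 1 / 2) * (sil - 1) := ⟨_, rfl⟩
      have hs' : s * (sil - 1) = 2 * (z.im - 1 / 2) := by
        rw [hs]; linear_combination (z.im - 1 / 2) * g1
      refine base 7 0 2 1 s u (by nlinarith) (by nlinarith) hu0 hu1 ?_ ?_
      · simp only [vertex, sqrt_two_eq]; simp; linear_combination hu + (u - 1 / 2) * hs'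
      · simp only [vertex, sqrt_two_eq]; simp; linear_combination (-1 / 2) * hs'

theorem mem_octagon_iff_dot (z) : z ∈ octagon ↔ ∀ k, dot k z ≤ sil / 2 :=
  (mem_octagon_iff z).trans (inOct_iff_dot z)

theorem normal_succ_re (k) :
    (normal (k + 1)).re = (sil - 1) / 2 * ((normal k).re + (normal k).im) := by
  have := sil_sq
  fin_cases k <;> simp [normal] <;> nlinarith

theorem normal_succ_im (k) :
    (normal (k + 1)).im = (sil - 1) / 2 * ((normal k).im - (normal k).re) := by
  have := sil_sq
  fin_cases k <;> simp [normal] <;> nlinarith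

theorem dot_succ (k z) : dot (k + 1) z = (sil - 1) / 2 * (dot k z - tang k z) := by
  simp only [dot, tang, normal_succ_re, normal_succ_im]; ring

theorem tang_succ (k z) : tang (k + 1) z = (sil - 1) / 2 * (dot k z + tang k z) := by
  simp only [dot, tang, normal_succ_re, normal_succ_im]; ring

theorem re_eq_dot_tang (k z) :
    z.re = (normal k).re * dot k z - (normal k).im * tang k z := by
  simp only [dot, tang]; linear_combination (-z.re) * normal_norm k

theorem im_eq_dot_tang (k z) :
    z.im = (normal k).im * dot k z + (normal k).re * tang k z := by
  simp only [dot, tang]; linear_combination (-z.im) * normal_norm k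

theorem dot_pred (k z) : dot (k - 1) z = (sil - 1) / 2 * (dot k z + tang k z) := by
  have h1 := dot_succ (k - 1) z
  have h2 := tang_succ (k - 1) z
  rw [sub_add_cancel] at h1 h2
  rw [h1, h2]; linear_combination (-(dot (k - 1) z) / 2) * sil_sq

theorem mem_side_iff (k z) :
    z ∈ side k ↔ dot k z = sil / 2 ∧ -(1 / 2) ≤ tang k z ∧ tang k z ≤ 1 / 2 := by
  have hn := normal_norm k
  constructor
  · rintro ⟨a, b, ha, hb, hab, rfl⟩
    have hd : dot k (a • vertex k + b • vertex (k + 1)) = sil / 2 := by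
      simp only [dot, Complex.add_re, Complex.add_im, Complex.real_smul, Complex.re_ofReal_mul,
        Complex.im_ofReal_mul]
      rw [vertex_succ_re, vertex_succ_im, vertex_re, vertex_im]
      linear_combination (sil / 2 * (a + b)) * hn + sil / 2 * hab
    have ht : tang k (a • vertex k + b • vertex (k + 1)) = (a - b) / 2 := by
      simp only [tang, Complex.add_re, Complex.add_im, Complex.real_smul, Complex.re_ofReal_mul,
        Complex.im_ofReal_mul]
      rw [vertex_succ_re, vertex_succ_im, vertex_re, vertex_im]
      linear_combination ((a - b) / 2) * hn
    rw [hd, ht]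
    exact ⟨rfl, by linarith, by linarith⟩
  · rintro ⟨hd, h1, h2⟩
    refine mem_segment_of (1 / 2 - tang k z) (by linarith) (by linarith) ?_ ?_
    · rw [re_eq_dot_tang k z, hd, vertex_succ_re, vertex_re]; ring
    · rw [im_eq_dot_tang k z, hd, vertex_succ_im, vertex_im]; ring

/-- On the line carrying the side, the inequalities of the two neighbouring sides already give
`|tang k z| ≤ 1 / 2`. -/
theorem mem_side_iff_octagon (k z) : z ∈ side k ↔ z ∈ octagon ∧ dot k z = sil / 2 := by
  constructor
  · intro h
    refine ⟨?_, ((mem_side_iff k z).1 h).1⟩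
    exact (convex_convexHull ℝ (Set.range vertex)).segment_subset
      (subset_convexHull ℝ _ (Set.mem_range_self k))
      (subset_convexHull ℝ _ (Set.mem_range_self (k + 1))) h
  · rintro ⟨ho, hd⟩
    rw [mem_octagon_iff_dot] at ho
    have g1 := sil_sq
    have g2 := sil_gt
    have h1 := ho (k + 1)
    have h2 := ho (k - 1)
    rw [dot_succ, hd] at h1
    rw [dot_pred, hd] at h2
    refine (mem_side_iff k z).2 ⟨hd, by nlinarith, by nlinarith⟩

theorem dot_le {z} (h : z ∈ octagon) (k) : dot k z ≤ sil / 2 := (mem_octagon_iff_dot z).1 h k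

/-- The squared modulus in the coordinates adapted to a side. -/
theorem normSq_eq (k z) : Complex.normSq z = dot k z * dot k z + tang k z * tang k z := by
  rw [Complex.normSq_apply]; simp only [dot, tang]
  linear_combination (-(z.re * z.re + z.im * z.im)) * normal_norm k

/-- The vertices are the points of the sides at maximal distance from the centre. -/
theorem mem_vertex_iff {k z} (h : z ∈ side k) :
    z ∈ Set.range vertex ↔ tang k z = 1 / 2 ∨ tang k z = -(1 / 2) := by
  obtain ⟨hd, -, -⟩ := (mem_side_iff k z).1 h
  constructor
  · rintro ⟨j, rfl⟩
    have h1 := normSq_eq k (vertex j)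
    have h2 := normSq_eq j (vertex j)
    have h3 : dot j (vertex j) = sil / 2 := by
      simp only [dot, vertex_re, vertex_im]; linear_combination (sil / 2) * normal_norm j
    have h4 : tang j (vertex j) = 1 / 2 := by
      simp only [tang, vertex_re, vertex_im]; linear_combination (1 / 2) * normal_norm j
    rw [h1, hd, h3, h4] at h2
    have : (tang k (vertex j) - 1 / 2) * (tang k (vertex j) + 1 / 2) = 0 := by linarith
    rcases mul_eq_zero.1 this with h | h
    · left; linarith
    · right; linarith
  · rintro (h | h)
    · refine ⟨k, Complex.ext ?_ ?_⟩
      · rw [re_eq_dot_tang k z, hd, h, vertex_re]; ring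
      · rw [im_eq_dot_tang k z, hd, h, vertex_im]; ring
    · refine ⟨k + 1, Complex.ext ?_ ?_⟩
      · rw [re_eq_dot_tang k z, hd, h, vertex_succ_re]; ring
      · rw [im_eq_dot_tang k z, hd, h, vertex_succ_im]; ring

theorem vertex_mem_octagon (k) : vertex k ∈ octagon := subset_convexHull _ _ ⟨k, rfl⟩

theorem vertex_mem_side (k) : vertex k ∈ side k := left_mem_segment _ _ _

theorem add_shift_mem_side {k z} (h : z ∈ side k) : z + shift k ∈ side (k + 4) := by
  obtain ⟨hd, h1, h2⟩ := (mem_side_iff k z).1 h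
  have ht : tang (k + 4) (z + shift k) = - tang k z := by
    simp only [tang, normal_opp, shift_eq]; simp; ring
  refine (mem_side_iff _ _).2 ⟨?_, ?_, ?_⟩
  · rw [dot_opp, dot_add, dot_shift, hd]; ring
  · rw [ht]; linarith
  · rw [ht]; linarith

theorem add_shift_mem_vertex_iff {k z} (h : z ∈ side k) :
    z + shift k ∈ Set.range vertex ↔ z ∈ Set.range vertex := by
  have ht : tang (k + 4) (z + shift k) = - tang k z := by
    simp only [tang, normal_opp, shift_eq]; simp; ring
  rw [mem_vertex_iff h, mem_vertex_iff (add_shift_mem_side h), ht]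
  constructor <;> rintro (h | h) <;> [right; left; right; left] <;> linarith

/-- A point of a side that is not a vertex lies on no other side. -/
theorem side_unique {k j z} (hk : z ∈ side k) (hv : z ∉ Set.range vertex) (hj : z ∈ side j) :
    j = k := by
  rw [mem_vertex_iff hk] at hv
  push Not at hv
  obtain ⟨hd, h1, h2⟩ := (mem_side_iff k z).1 hk
  have h1 := lt_of_le_of_ne h1 hv.2.symm
  have h2 := lt_of_le_of_ne h2 hv.1
  have g1 := sil_sq
  have g2 := sil_gt
  obtain ⟨hd', -, -⟩ := (mem_side_iff j z).1 hj
  -- All eight components `dot (k + m) z` are expressed through `tang k z`; for `m ≠ 0` the strict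
  -- bounds on it keep them below `sil / 2`.
  obtain ⟨m, rfl⟩ : ∃ m, j = k + m := ⟨j - k, by omega⟩
  have d1 := dot_succ k z
  have d2 : dot (k + 2) z = - tang k z := by
    have := dot_succ (k + 1) z
    rw [dot_succ k z, tang_succ k z] at this
    rw [show k + 2 = k + 1 + 1 by omega, this]; linear_combination (- tang k z / 2) * g1
  have t2 : tang (k + 2) z = dot k z := by
    have := tang_succ (k + 1) z
    rw [dot_succ k z, tang_succ k z] at this
    rw [show k + 2 = k + 1 + 1 by omega, this]; linear_combination (dot k z / 2) * g1
  have d3 : dot (k + 3) z = (sil - 1) / 2 * (- tang k z - dot k z) := by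
    rw [show k + 3 = k + 2 + 1 by omega, dot_succ, d2, t2]
  have d4 := dot_opp k z
  have d5 := dot_opp (k + 1) z
  have d6 := dot_opp (k + 2) z
  have d7 := dot_opp (k + 3) z
  rw [show k + 1 + 4 = k + 5 by omega] at d5
  rw [show k + 2 + 4 = k + 6 by omega] at d6
  rw [show k + 3 + 4 = k + 7 by omega] at d7
  rw [hd] at d1 d3 d4
  rw [d1] at d5
  rw [d2] at d6
  rw [d3] at d7
  have hm : m = 0 ∨ m = 1 ∨ m = 2 ∨ m = 3 ∨ m = 4 ∨ m = 5 ∨ m = 6 ∨ m = 7 := by omega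
  rcases hm with rfl | rfl | rfl | rfl | rfl | rfl | rfl | rfl
  · simp
  all_goals exfalso; nlinarith

/-! ### Points of the surface -/

/-- Identification of points of the octagon, with the vertices treated separately. -/
def Same (z z' : ℂ) : Prop :=
  z = z' ∨ (z ∈ Set.range vertex ∧ z' ∈ Set.range vertex) ∨
    ∃ k, z ∈ side k ∧ z ∉ Set.range vertex ∧ z' = z + shift k

theorem Same.symm {z z'} (h : Same z z') : Same z' z := by
  rcases h with rfl | ⟨h1, h2⟩ | ⟨k, h1, h2, rfl⟩
  · exact Or.inl rfl
  · exact Or.inr (Or.inl ⟨h2, h1⟩)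
  · refine Or.inr (Or.inr ⟨k + 4, add_shift_mem_side h1, ?_, by rw [shift_opp]; ring⟩)
    rwa [add_shift_mem_vertex_iff h1]

theorem Same.mem_vertex_iff {z z'} (h : Same z z') :
    z ∈ Set.range vertex ↔ z' ∈ Set.range vertex := by
  rcases h with rfl | ⟨h1, h2⟩ | ⟨k, h1, h2, rfl⟩
  · rfl
  · exact ⟨fun _ => h2, fun _ => h1⟩
  · rw [add_shift_mem_vertex_iff h1]

/-- A point that is not a vertex lies on only one side, so two successive gluings cancel. Thus the
explicit relation is already transitive and no longer chains of gluings need be considered. -/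
theorem Same.trans {z z' z''} (h : Same z z') (h' : Same z' z'') : Same z z'' := by
  by_cases hv : z ∈ Set.range vertex
  · exact Or.inr (Or.inl ⟨hv, h'.mem_vertex_iff.1 (h.mem_vertex_iff.1 hv)⟩)
  · rcases h with rfl | ⟨h1, h2⟩ | ⟨k, h1, h2, rfl⟩
    · exact h'
    · exact absurd h1 hv
    · rcases h' with rfl | ⟨h3, h4⟩ | ⟨j, h3, h4, rfl⟩
      · exact Or.inr (Or.inr ⟨k, h1, h2, rfl⟩)
      · exact absurd ((add_shift_mem_vertex_iff h1).1 h3) hv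
      · have := side_unique (add_shift_mem_side h1) h4 h3
        subst this
        left; rw [shift_opp]; ring

theorem Glue.same {p q : octagon} (h : Glue p q) : Same p q := by
  obtain ⟨k, h1, h2⟩ := h
  by_cases hv : (p : ℂ) ∈ Set.range vertex
  · refine Or.inr (Or.inl ⟨hv, ?_⟩)
    rw [h2]; exact (add_shift_mem_vertex_iff h1).2 hv
  · exact Or.inr (Or.inr ⟨k, h1, hv, h2⟩)

/-- The gluing carries vertex `k` to vertex `k + 5`, and `5` generates the integers modulo 8: the
surface has a single vertex. -/
theorem mk_vertex (k : Fin 8) : Quot.mk Glue ⟨vertex k, vertex_mem_octagon k⟩ =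
    Quot.mk Glue ⟨vertex 0, vertex_mem_octagon 0⟩ := by
  have step : ∀ k : Fin 8, Quot.mk Glue ⟨vertex (k + 5), vertex_mem_octagon (k + 5)⟩ =
      Quot.mk Glue ⟨vertex k, vertex_mem_octagon k⟩ := fun k =>
    (Quot.sound ⟨k, vertex_mem_side k, by simp⟩).symm
  have h5 := step 0
  have h2 := (step 5).trans h5
  have h7 := (step 2).trans h2
  have h4 := (step 7).trans h7
  have h1 := (step 4).trans h4
  have h6 := (step 1).trans h1
  have h3 := (step 6).trans h6
  fin_cases k
  exacts [rfl, h1, h2, h3, h4, h5, h6, h7]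

theorem mk_eq_iff {p q : octagon} : Quot.mk Glue p = Quot.mk Glue q ↔ Same p q := by
  constructor
  · intro h
    rw [Quot.eq] at h
    induction h with
    | rel _ _ h => exact h.same
    | refl _ => exact Or.inl rfl
    | symm _ _ _ ih => exact ih.symm
    | trans _ _ _ _ _ ih1 ih2 => exact ih1.trans ih2
  · obtain ⟨p, hp⟩ := p
    obtain ⟨q, hq⟩ := q
    rintro (h | ⟨⟨j, h1⟩, ⟨m, h2⟩⟩ | ⟨k, h1, h2, h3⟩)
    · simp only at h; subst h; rfl
    · simp only at h1 h2; subst h1; subst h2; exact (mk_vertex j).trans (mk_vertex m).symm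
    · exact Quot.sound ⟨k, h1, h3⟩

theorem Represents.mem {z x} (h : Represents z x) : z ∈ octagon := h.1

theorem Represents.same {z z' x} (h : Represents z x) (h' : Represents z' x) : Same z z' := by
  obtain ⟨h1, rfl⟩ := h
  obtain ⟨h2, h3⟩ := h'
  exact (mk_eq_iff.1 h3).symm

theorem Represents.of_same {z z' x} (h : Represents z x) (hz : z' ∈ octagon) (hs : Same z z') :
    Represents z' x := by
  obtain ⟨h1, rfl⟩ := h
  exact ⟨hz, (mk_eq_iff.2 hs).symm⟩

theorem Represents.eq {z x x'} (h : Represents z x) (h' : Represents z x') : x = x' := by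
  obtain ⟨h1, rfl⟩ := h
  obtain ⟨h2, h3⟩ := h'
  exact h3

theorem exists_represents (x : Surface) : ∃ z, Represents z x := by
  obtain ⟨⟨z, h⟩, hz⟩ := Quot.exists_rep x
  exact ⟨z, h, hz⟩

theorem side_subset {k z} (h : z ∈ side k) : z ∈ octagon := ((mem_side_iff_octagon k z).1 h).1

theorem Represents.glue {k z x} (h : Represents z x) (hk : z ∈ side k) :
    Represents (z + shift k) x := by
  have hm := side_subset (add_shift_mem_side hk)
  obtain ⟨h1, rfl⟩ := h
  exact ⟨hm, (Quot.sound (⟨k, hk, rfl⟩ : Glue ⟨z, h1⟩ ⟨z + shift k, hm⟩)).symm⟩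

/-- Two representatives of a point that is not the vertex. -/
theorem Represents.cases {z z' x} (h : Represents z x) (h' : Represents z' x)
    (hv : z ∉ Set.range vertex) : z' = z ∨ ∃ k, z ∈ side k ∧ z' = z + shift k := by
  rcases h.same h' with rfl | ⟨h1, h2⟩ | ⟨k, h1, h2, rfl⟩
  · exact Or.inl rfl
  · exact absurd h1 hv
  · exact Or.inr ⟨k, h1, rfl⟩

/-! ### Weak linear trajectories -/

/-- The path `f` starts at the point `x`, which is not the vertex, with velocity `v`, and stays in
the closed octagon for a short time. -/
def Starts (v : ℂ) (x : Surface) (f : ℝ → Surface) : Prop :=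
  ∃ q, q ∉ Set.range vertex ∧ Represents q x ∧
    ∃ ε : ℝ, 0 < ε ∧ ∀ s : ℝ, 0 < s → s < ε → Represents (q + s * v) (f s)

/-- A path which is locally a motion with velocity `v` in the closed octagon and which avoids the
vertex. -/
def WeakLinear (τ : ℝ → Surface) (v : ℂ) : Prop :=
  ∀ t, Starts v (τ t) (fun s => τ (t + s)) ∧ Starts (-v) (τ t) (fun s => τ (t - s))

theorem WeakLinear.reverse {τ v} (h : WeakLinear τ v) : WeakLinear (fun t => τ (-t)) (-v) := by
  intro t
  obtain ⟨h1, h2⟩ := h (-t)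
  refine ⟨?_, ?_⟩
  · convert h2 using 3; ring
  · convert h1 using 3
    · ring
    · ring

theorem WeakLinear.shift {τ v} (h : WeakLinear τ v) (T : ℝ) :
    WeakLinear (fun t => τ (t + T)) v := by
  intro t
  obtain ⟨h1, h2⟩ := h (t + T)
  refine ⟨?_, ?_⟩
  · convert h1 using 3; ring
  · convert h2 using 3; ring

theorem WeakLinear.not_vertex {τ v} (h : WeakLinear τ v) {t z} (hz : Represents z (τ t)) :
    z ∉ Set.range vertex := by
  obtain ⟨q, h1, h2, -⟩ := (h t).1
  rwa [(hz.same h2).mem_vertex_iff]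

/-- Induction on a real interval. -/
theorem real_induction {P : ℝ → Prop} {a b : ℝ} (ha : P a)
    (hr : ∀ t, a ≤ t → t < b → P t → ∃ ε : ℝ, 0 < ε ∧ ∀ s, 0 < s → s < ε → P (t + s))
    (hl : ∀ t, a < t → t ≤ b → (∀ u, a ≤ u → u < t → P u) → P t) :
    ∀ t, a ≤ t → t ≤ b → P t := by
  intro t0 h1 h2
  by_contra hP
  set S := {u | a ≤ u ∧ u ≤ b ∧ ¬ P u} with hS
  have hne : S.Nonempty := ⟨t0, h1, h2, hP⟩
  have hb : BddBelow S := ⟨a, fun u hu => hu.1⟩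
  set c := sInf S
  have hac : a ≤ c := le_csInf hne fun u hu => hu.1
  have hct : c ≤ t0 := csInf_le hb ⟨h1, h2, hP⟩
  have hbelow : ∀ u, a ≤ u → u < c → P u := by
    intro u hu huc
    by_contra hPu
    exact absurd (csInf_le hb (show u ∈ S from ⟨hu, by linarith, hPu⟩)) (not_le.2 huc)
  have hPc : P c := by
    rcases hac.eq_or_lt with h | h
    · rwa [← h]
    · exact hl c h (by linarith) hbelow
  have hcb : c < b := by
    rcases hct.eq_or_lt with h | h
    · exact absurd (h ▸ hPc) hP
    · linarith
  obtain ⟨ε, hε, he⟩ := hr c hac hcb hPc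
  have : c + ε ≤ c := by
    refine le_csInf hne fun u hu => ?_
    by_contra hlt
    push Not at hlt
    have hcu : c ≤ u := csInf_le hb hu
    rcases hcu.eq_or_lt with h | h
    · exact hu.2.2 (h ▸ hPc)
    · have := he (u - c) (by linarith) (by linarith)
      rw [add_sub_cancel] at this
      exact hu.2.2 this
  linarith

/-- Following a trajectory in the plane: its position at time `t` is `q₀ + t v` up to a translation
from the set `X`, provided that `X` is stable under the gluings that are met. -/
theorem WeakLinear.develop {τ : ℝ → Surface} {v q₀ : ℂ} {b : ℝ} {X : Set ℂ} (hτ : WeakLinear τ v)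
    (h0 : Represents q₀ (τ 0)) (hX : 0 ∈ X)
    (hstep : ∀ s : ℝ, 0 ≤ s → s < b → ∀ l ∈ X, ∀ j, q₀ + s * v - l ∈ side j →
      q₀ + s * v - l ∉ Set.range vertex → Represents (q₀ + s * v - l) (τ s) → 0 < dot j v →
      l - OctagonFlow.shift j ∈ X) :
    ∀ t : ℝ, 0 ≤ t → t ≤ b → ∃ l ∈ X, Represents (q₀ + t * v - l) (τ t) := by
  refine real_induction ⟨0, hX, by simpa using h0⟩ ?_ ?_
  · rintro t ht htb ⟨l, hl, hq⟩
    obtain ⟨q', hv', hq', ε, hε, he⟩ := (hτ t).1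
    have hv := hτ.not_vertex hq
    refine ⟨ε, hε, ?_⟩
    rcases hq.cases hq' hv with rfl | ⟨k, hk, rfl⟩
    · intro s hs hse
      refine ⟨l, hl, ?_⟩
      convert he s hs hse using 1
      push_cast; ring
    · have hnn : ∀ s, 0 < s → s < ε → 0 ≤ s * dot k v := by
        intro s hs hse
        have := dot_le (he s hs hse).mem (k + 4)
        simp only [dot_opp, dot_add, dot_real_mul, dot_shift, ((mem_side_iff _ _).1 hk).1] at this
        linarith
      have hk0 : 0 ≤ dot k v := by
        have := hnn (ε / 2) (by linarith) (by linarith)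
        by_contra hneg
        push Not at hneg
        nlinarith
      -- With zero normal velocity the motion runs along the side `k + 4`, so it can be glued back
      -- and the translation does not change. Only a positive normal velocity is a genuine crossing.
      rcases hk0.eq_or_lt with hz | hpos
      · intro s hs hse
        have h1 := he s hs hse
        have h2 : q₀ + t * v - l + OctagonFlow.shift k + s * v ∈ side (k + 4) := by
          refine (mem_side_iff_octagon _ _).2 ⟨h1.mem, ?_⟩
          simp only [dot_opp, dot_add, dot_real_mul, dot_shift, ← hz]
          have := ((mem_side_iff _ _).1 hk).1
          rw [this]; ring
        have h3 := h1.glue h2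
        refine ⟨l, hl, ?_⟩
        convert h3 using 1
        rw [shift_opp]; push_cast; ring
      · intro s hs hse
        refine ⟨l - OctagonFlow.shift k, hstep t ht htb l hl k hk hv hq hpos, ?_⟩
        convert he s hs hse using 1
        push_cast; ring
  · intro t ht htb hP
    obtain ⟨p, hpv, hp, ε, hε, he⟩ := (hτ t).2
    obtain ⟨s, hs, hse, hst⟩ : ∃ s, 0 < s ∧ s < ε ∧ s < t :=
      ⟨min ε t / 2, by have := lt_min hε ht; linarith,
        by have := lt_min hε ht; have := min_le_left ε t; linarith,
        by have := lt_min hε ht; have := min_le_right ε t; linarith⟩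
    -- The developed position at `t - s` and the backward germ at `t` represent the same point, so
    -- they agree or differ by one gluing.
    obtain ⟨l, hl, hq⟩ := hP (t - s) (by linarith) (by linarith)
    have h1 := he s hs hse
    rcases h1.cases hq (hτ.not_vertex h1) with h | ⟨k, hk, h⟩
    · refine ⟨l, hl, ?_⟩
      convert hp using 1
      push_cast at h
      linear_combination h
    · have hd := ((mem_side_iff _ _).1 hk).1
      have hle := dot_le hp.mem k
      simp only [dot_add, dot_real_mul, dot_neg] at hd
      have hk0 : dot k v ≤ 0 := by
        by_contra hneg
        push Not at hneg
        nlinarith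
      rcases hk0.eq_or_lt with hz | hneg
      · have h2 : p ∈ side k := (mem_side_iff_octagon _ _).2 ⟨hp.mem, by rw [hz] at hd; linarith⟩
        refine ⟨l, hl, ?_⟩
        convert hp.glue h2 using 1
        push_cast at h
        linear_combination h
      · have h3 : q₀ + (t - s : ℝ) * v - l ∈ side (k + 4) := by
          rw [h]; exact add_shift_mem_side hk
        refine ⟨l - OctagonFlow.shift (k + 4), hstep (t - s) (by linarith) (by linarith) l hl _ h3
          (hτ.not_vertex hq) hq (by rw [dot_opp]; linarith), ?_⟩
        convert hp using 1
        rw [shift_opp]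
        push_cast at h
        linear_combination h

theorem WeakLinear.unique_forward {τ τ' : ℝ → Surface} {v : ℂ} (hτ : WeakLinear τ v)
    (hτ' : WeakLinear τ' v) {a : ℝ} (h : τ a = τ' a) (b : ℝ) (hb : a ≤ b) : τ b = τ' b := by
  refine real_induction (P := fun t => τ t = τ' t) h ?_ ?_ b hb le_rfl
  · intro t _ _ ht
    obtain ⟨q, hv, hq, ε, hε, he⟩ := (hτ t).1
    obtain ⟨q', hv', hq', ε', hε', he'⟩ := (hτ' t).1
    rw [← ht] at hq'
    refine ⟨min ε ε', lt_min hε hε', fun s hs hse => ?_⟩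
    have h1 := he s hs (lt_of_lt_of_le hse (min_le_left _ _))
    have h2 := he' s hs (lt_of_lt_of_le hse (min_le_right _ _))
    rcases hq.cases hq' hv with rfl | ⟨k, hk, rfl⟩
    · exact h1.eq h2
    -- Two germs from opposite sides with one velocity can both stay in the octagon only if they run
    -- along these sides; they are then glued to each other.
    · have d := ((mem_side_iff _ _).1 hk).1
      have d1 := dot_le h1.mem k
      have d2 := dot_le h2.mem (k + 4)
      simp only [dot_opp, dot_add, dot_real_mul, dot_shift] at d1 d2
      have h3 : q + s * v ∈ side k := by
        refine (mem_side_iff_octagon _ _).2 ⟨h1.mem, ?_⟩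
        simp only [dot_add, dot_real_mul]; linarith
      have h4 := h1.glue h3
      have : q + s * v + OctagonFlow.shift k = q + OctagonFlow.shift k + s * v := by ring
      rw [this] at h4
      exact h4.eq h2
  · intro t hat _ hP
    obtain ⟨p, hv, hp, ε, hε, he⟩ := (hτ t).2
    obtain ⟨p', hv', hp', ε', hε', he'⟩ := (hτ' t).2
    have h0 : 0 < min (min ε ε') (t - a) := lt_min (lt_min hε hε') (by linarith)
    set s := min (min ε ε') (t - a) / 2 with hs
    have e1 : s < ε := by
      have := (min_le_left (min ε ε') (t - a)).trans (min_le_left _ _); linarith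
    have e2 : s < ε' := by
      have := (min_le_left (min ε ε') (t - a)).trans (min_le_right _ _); linarith
    have e3 : s < t - a := by
      have := (min_le_right (min ε ε') (t - a)); linarith
    have h1 := he s (by linarith) e1
    have h2 := he' s (by linarith) e2
    simp only at h1 h2
    rw [← hP (t - s) (by linarith) (by linarith)] at h2
    rcases h1.cases h2 (hτ.not_vertex h1) with h | ⟨k, hk, h⟩
    · have : p' = p := by linear_combination h
      rw [this] at hp'
      exact hp.eq hp'
    · have h3 : p' = p + OctagonFlow.shift k := by linear_combination h
      have d2 := dot_le hp'.mem (k + 4)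
      rw [h3] at d2
      simp only [dot_opp, dot_add, dot_shift] at d2
      have h4 : p ∈ side k := by
        refine (mem_side_iff_octagon _ _).2 ⟨hp.mem, ?_⟩
        have := dot_le hp.mem k
        linarith
      have h5 := hp.glue h4
      rw [← h3] at h5
      exact h5.eq hp'

/-- A trajectory is determined by its velocity and its position at one time. -/
theorem WeakLinear.unique {τ τ' : ℝ → Surface} {v : ℂ} (hτ : WeakLinear τ v)
    (hτ' : WeakLinear τ' v) {a : ℝ} (h : τ a = τ' a) (b : ℝ) : τ b = τ' b := by
  rcases le_total a b with hab | hab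
  · exact hτ.unique_forward hτ' h b hab
  · have := hτ.reverse.unique_forward hτ'.reverse (a := -a) (by simpa using h) (-b) (by linarith)
    simpa using this

theorem WeakLinear.periodic_of_eq {τ : ℝ → Surface} {v : ℂ} (hτ : WeakLinear τ v) {a b : ℝ}
    (hab : a < b) (h : τ a = τ b) : IsPeriodicTrajectory τ := by
  refine ⟨b - a, by linarith, fun t => ?_⟩
  refine (hτ.shift (b - a)).unique hτ (a := a) ?_ t
  simp only [add_sub_cancel]; exact h.symm

/-! ### Linear trajectories that stay in the interior between crossings -/

/-- The condition of linearity for a fixed velocity. -/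
def StrictLinear (τ : ℝ → Surface) (v : ℂ) : Prop :=
  ∀ t : ℝ, ∃ p q : ℂ,
      Represents p (τ t) ∧ Represents q (τ t) ∧
      p ∉ Set.range vertex ∧ q ∉ Set.range vertex ∧
      ∃ ε : ℝ, 0 < ε ∧ ∀ s : ℝ, 0 < s → s < ε →
        (p - s * v ∈ interior octagon ∧ Represents (p - s * v) (τ (t - s))) ∧
        (q + s * v ∈ interior octagon ∧ Represents (q + s * v) (τ (t + s)))

/-- The weak notion is local and says nothing about the interior of the octagon, so it passes
directly to images under affine maps. -/
theorem StrictLinear.weakLinear {τ v} (h : StrictLinear τ v) : WeakLinear τ v := by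
  intro t
  obtain ⟨p, q, hp, hq, hpv, hqv, ε, hε, he⟩ := h t
  refine ⟨⟨q, hqv, hq, ε, hε, fun s h1 h2 => (he s h1 h2).2.2⟩,
    ⟨p, hpv, hp, ε, hε, fun s h1 h2 => ?_⟩⟩
  have := (he s h1 h2).1.2
  rwa [sub_eq_add_neg, ← mul_neg] at this

theorem StrictLinear.reverse {τ v} (h : StrictLinear τ v) :
    StrictLinear (fun t => τ (-t)) (-v) := by
  intro t
  obtain ⟨p, q, hp, hq, hpv, hqv, ε, hε, he⟩ := h (-t)
  refine ⟨q, p, hq, hp, hqv, hpv, ε, hε, fun s h1 h2 => ?_⟩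
  obtain ⟨⟨a1, a2⟩, ⟨b1, b2⟩⟩ := he s h1 h2
  have e1 : q - s * -v = q + s * v := by ring
  have e2 : p + s * -v = p - s * v := by ring
  have e3 : -(t - s) = -t + s := by ring
  have e4 : -(t + s) = -t - s := by ring
  simp only [e1, e2, e3, e4]
  exact ⟨⟨b1, b2⟩, a1, a2⟩

theorem not_mem_side_of_mem_interior {z} (h : z ∈ interior octagon) (k) : z ∉ side k := by
  intro hk
  rw [mem_interior_iff_mem_nhds, Metric.mem_nhds_iff] at h
  obtain ⟨ε, hε, hb⟩ := h
  have hn : ‖normal k‖ = 1 := by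
    have h1 := Complex.normSq_eq_norm_sq (normal k)
    rw [Complex.normSq_apply, normal_norm] at h1
    have h2 := norm_nonneg (normal k)
    nlinarith
  have hm : z + (ε / 2 : ℝ) * normal k ∈ octagon := by
    apply hb
    rw [Metric.mem_ball, dist_eq_norm, add_sub_cancel_left, norm_mul, hn, Complex.norm_real,
      Real.norm_eq_abs, abs_of_pos (by linarith)]
    linarith
  have h1 := dot_le hm k
  rw [dot_add, dot_real_mul, ((mem_side_iff _ _).1 hk).1] at h1
  have h2 : dot k (normal k) = 1 := normal_norm k
  rw [h2] at h1
  linarith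

/-! ### Crossing times and cutting sequences. -/

/-- The trajectory is on a side at time `t`. -/
def Crosses (τ : ℝ → Surface) (t : ℝ) : Prop := ∃ k, ∃ z ∈ side k, Represents z (τ t)

theorem crosses_iff {τ t} : Crosses τ t ↔ ∃ L, CrossesAt τ t L := by
  constructor
  · rintro ⟨k, z, h1, h2⟩; exact ⟨_, k, rfl, z, h1, h2⟩
  · rintro ⟨L, k, -, z, h1, h2⟩; exact ⟨k, z, h1, h2⟩

theorem not_crosses_of_interior {τ t z} (h : z ∈ interior octagon) (hz : Represents z (τ t))
    (hv : z ∉ Set.range vertex) : ¬ Crosses τ t := by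
  rintro ⟨k, w, hk, hw⟩
  rcases hz.cases hw hv with rfl | ⟨j, hj, -⟩
  · exact not_mem_side_of_mem_interior h k hk
  · exact not_mem_side_of_mem_interior h j hj

theorem StrictLinear.isolated {τ v} (h : StrictLinear τ v) (t : ℝ) :
    ∃ ε : ℝ, 0 < ε ∧ ∀ u, u ≠ t → |u - t| < ε → ¬ Crosses τ u := by
  obtain ⟨p, q, hp, hq, hpv, hqv, ε, hε, he⟩ := h t
  refine ⟨ε, hε, fun u hu hlt => ?_⟩
  rw [abs_lt] at hlt
  rcases lt_or_gt_of_ne hu with h1 | h1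
  · obtain ⟨⟨a1, a2⟩, -⟩ := he (t - u) (by linarith) (by linarith)
    rw [sub_sub_cancel] at a2
    exact not_crosses_of_interior a1 a2 (h.weakLinear.not_vertex a2)
  · obtain ⟨-, ⟨a1, a2⟩⟩ := he (u - t) (by linarith) (by linarith)
    rw [add_sub_cancel] at a2
    exact not_crosses_of_interior a1 a2 (h.weakLinear.not_vertex a2)

/-- The trajectory leaves the octagon at time `t` through the point `p` of the side `k`. -/
def ExitsAt (τ : ℝ → Surface) (v : ℂ) (t : ℝ) (k : Fin 8) (p : ℂ) : Prop :=
  p ∈ side k ∧ p ∉ Set.range vertex ∧ Represents p (τ t) ∧ 0 < dot k v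

/-- The trajectory arrives at its representative `p` from the interior, where the component along
the normal is smaller; hence it increases along `v`. -/
theorem StrictLinear.exists_exit {τ v} (h : StrictLinear τ v) {t} (hc : Crosses τ t) :
    ∃ k p, ExitsAt τ v t k p := by
  obtain ⟨p, q, hp, hq, hpv, hqv, ε, hε, he⟩ := h t
  obtain ⟨j, z, hj, hz⟩ := hc
  obtain ⟨k, hk⟩ : ∃ k, p ∈ side k := by
    rcases hp.cases hz hpv with rfl | ⟨k, hk, -⟩
    exacts [⟨j, hj⟩, ⟨k, hk⟩]
  refine ⟨k, p, hk, hpv, hp, ?_⟩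
  obtain ⟨⟨a1, a2⟩, -⟩ := he (ε / 2) (by linarith) (by linarith)
  have h1 := dot_le a2.mem k
  have h2 : dot k (p - (ε / 2 : ℝ) * v) ≠ sil / 2 := fun h3 =>
    not_mem_side_of_mem_interior a1 k ((mem_side_iff_octagon _ _).2 ⟨a2.mem, h3⟩)
  have h3 := lt_of_le_of_ne h1 h2
  rw [dot_sub, dot_real_mul, ((mem_side_iff _ _).1 hk).1] at h3
  by_contra hneg
  push Not at hneg
  nlinarith

/-- No side is met strictly between the two times, so the development picks up no translation. At
the initial time the point is on the side `k + 4`, where the velocity points inwards. -/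
theorem ExitsAt.next {τ v t k p u j r} (h : StrictLinear τ v) (hp : ExitsAt τ v t k p)
    (hr : ExitsAt τ v u j r) (htu : t < u) (hno : ∀ s, t < s → s < u → ¬ Crosses τ s) :
    r = p + shift k + (u - t : ℝ) * v := by
  obtain ⟨hk, hpv, hpr, hd⟩ := hp
  obtain ⟨hj, hrv, hrr, hdj⟩ := hr
  have hside := add_shift_mem_side hk
  have hrep := hpr.glue hk
  obtain ⟨l, hl, hz⟩ := (h.weakLinear.shift t).develop (q₀ := p + shift k) (X := {0}) (b := u - t)
    (by simpa using hrep) rfl (by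
      intro s hs hsb l hl i hi hiv hir hdi
      exfalso
      rw [Set.mem_singleton_iff] at hl
      subst hl
      rcases hs.eq_or_lt with h0 | h0
      · subst h0
        have : p + shift k ∈ side i := by simpa using hi
        have := side_unique hside (h.weakLinear.not_vertex hrep) this
        subst this
        rw [dot_opp] at hdi
        linarith
      · exact hno (s + t) (by linarith) (by linarith) ⟨i, _, hi, hir⟩)
    (u - t) (by linarith) le_rfl
  rw [Set.mem_singleton_iff] at hl
  subst hl
  simp only [sub_zero, sub_add_cancel] at hz
  rcases hrr.cases hz hrv with h1 | ⟨i, hi, h1⟩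
  · exact h1.symm
  -- The other representative of the exit point lies on the side `j + 4`, which a motion directed
  -- away from that side cannot reach.
  · exfalso
    have := side_unique hj hrv hi
    subst this
    have h2 := ((mem_side_iff _ _).1 (add_shift_mem_side hi)).1
    have h3 := dot_le (side_subset hside) (i + 4)
    rw [← h1, dot_add (i + 4) (p + shift k), dot_real_mul, dot_opp i v] at h2
    nlinarith

theorem exists_dot_pos {v : ℂ} (hv : v ≠ 0) : ∃ k, 0 < dot k v := by
  by_contra h
  push Not at h
  apply hv
  have h0 := h 0; have h2 := h 2; have h4 := h 4; have h6 := h 6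
  simp [dot, normal] at h0 h2 h4 h6
  apply Complex.ext <;> simp <;> linarith

theorem StrictLinear.exists_crosses_gt {τ v} (h : StrictLinear τ v) (hv : v ≠ 0) (a : ℝ) :
    ∃ t, a < t ∧ Crosses τ t := by
  by_contra hno
  push Not at hno
  obtain ⟨q, hq⟩ := exists_represents (τ (a + 1))
  obtain ⟨k, hk⟩ := exists_dot_pos hv
  -- By this time an uninterrupted straight motion would have passed the side `k` by distance one.
  set b := (sil / 2 - dot k q + 1) / dot k v with hb
  have hqk := dot_le hq.mem k
  have hb0 : 0 ≤ b := by apply div_nonneg <;> linarith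
  obtain ⟨l, hl, hz⟩ := (h.weakLinear.shift (a + 1)).develop (q₀ := q) (X := {0}) (b := b)
    (by simpa using hq) rfl (by
      intro s hs hsb l hl i hi hiv hir hdi
      exact absurd ⟨i, _, hi, hir⟩ (hno (s + (a + 1)) (by linarith)))
    b hb0 le_rfl
  rw [Set.mem_singleton_iff] at hl
  subst hl
  have := dot_le hz.mem k
  rw [dot_sub, dot_add, dot_real_mul, hb, div_mul_cancel₀ _ hk.ne'] at this
  simp [dot] at this
  simp only [dot] at *
  linarith

theorem StrictLinear.exists_crosses_lt {τ v} (h : StrictLinear τ v) (hv : v ≠ 0) (a : ℝ) :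
    ∃ t, t < a ∧ Crosses τ t := by
  obtain ⟨t, ht, k, z, h1, h2⟩ := h.reverse.exists_crosses_gt (neg_ne_zero.2 hv) (-a)
  exact ⟨-t, by linarith, k, z, h1, h2⟩

theorem StrictLinear.finite_crosses {τ v} (h : StrictLinear τ v) (a b : ℝ) :
    (Set.Icc a b ∩ {t | Crosses τ t}).Finite := by
  by_contra hinf
  obtain ⟨x, -, hx⟩ := Set.Infinite.exists_accPt_of_subset_isCompact hinf isCompact_Icc
    Set.inter_subset_left
  obtain ⟨ε, hε, he⟩ := h.isolated x
  rw [accPt_iff_nhds] at hx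
  obtain ⟨y, ⟨hy1, hy2⟩, hy3⟩ := hx (Metric.ball x ε) (Metric.ball_mem_nhds _ hε)
  exact he y hy3 (by simpa [Real.dist_eq] using hy1) hy2.2

/-- The set of crossing times is locally finite and has no first or last element, hence is order
isomorphic to the integers. -/
theorem StrictLinear.exists_cuttingSequence {τ v} (h : StrictLinear τ v) (hv : v ≠ 0) :
    ∃ w, IsCuttingSequence τ w := by
  let S : Set ℝ := {t | Crosses τ t}
  haveI : Nonempty S := by
    obtain ⟨t, -, ht⟩ := h.exists_crosses_gt hv 0; exact ⟨⟨t, ht⟩⟩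
  haveI : NoMaxOrder S := ⟨fun a => by
    obtain ⟨t, h1, ht⟩ := h.exists_crosses_gt hv a; exact ⟨⟨t, ht⟩, h1⟩⟩
  haveI : NoMinOrder S := ⟨fun a => by
    obtain ⟨t, h1, ht⟩ := h.exists_crosses_lt hv a; exact ⟨⟨t, ht⟩, h1⟩⟩
  haveI : LocallyFiniteOrder S := LocallyFiniteOrder.ofFiniteIcc fun a b => by
    refine Set.Finite.of_finite_image (f := Subtype.val) ?_ Subtype.val_injective.injOn
    refine (h.finite_crosses a b).subset ?_
    rintro _ ⟨x, ⟨hx1, hx2⟩, rfl⟩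
    exact ⟨⟨hx1, hx2⟩, x.2⟩
  haveI : SuccOrder S := LinearLocallyFiniteOrder.succOrder S
  haveI : PredOrder S := LinearLocallyFiniteOrder.predOrder S
  let e : S ≃o ℤ := orderIsoIntOfLinearSuccPredArch
  have hc : ∀ n : ℤ, ∃ L, CrossesAt τ (e.symm n) L := fun n => crosses_iff.1 (e.symm n).2
  choose w hw using hc
  refine ⟨w, fun n => e.symm n, fun m n hmn => e.symm.strictMono hmn, ?_, hw⟩
  ext u
  constructor
  · rintro ⟨n, rfl⟩; exact ⟨_, hw n⟩
  · intro hu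
    exact ⟨e ⟨u, crosses_iff.2 hu⟩, by simp⟩

/-! ### Periodic trajectories and periodic words. -/

theorem label_opp (k) : label (k + 4) = label k := by fin_cases k <;> rfl

theorem label_eq_iff {k j : Fin 8} : label k = label j → k = j ∨ k = j + 4 := by
  fin_cases k <;> fin_cases j <;> simp [label]

theorem CrossesAt.eq_label {τ t L z k} (h : CrossesAt τ t L) (hz : Represents z (τ t))
    (hk : z ∈ side k) (hv : z ∉ Set.range vertex) : L = label k := by
  obtain ⟨j, rfl, y, hj, hy⟩ := h
  rcases hz.cases hy hv with rfl | ⟨i, hi, rfl⟩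
  · rw [side_unique hk hv hj]
  · have h1 := side_unique hk hv hi
    subst h1
    rw [side_unique (add_shift_mem_side hk) (by rwa [add_shift_mem_vertex_iff hk]) hj, label_opp]

theorem WeakLinear.label_unique {τ v t L M} (hτ : WeakLinear τ v) (h : CrossesAt τ t L)
    (h' : CrossesAt τ t M) : L = M := by
  obtain ⟨j, rfl, y, hj, hy⟩ := h'
  exact h.eq_label hy hj (hτ.not_vertex hy)

/-- Adding the period induces an increasing surjection `f` of the index set, so `f` is translation
by `f 0`, and this is a period of the word. -/
theorem periodicWord_of_periodic {τ v w} (hτ : WeakLinear τ v) (hw : IsCuttingSequence τ w)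
    (h : IsPeriodicTrajectory τ) : IsPeriodicWord w := by
  obtain ⟨T, hT, hper⟩ := h
  obtain ⟨t, hmono, hrange, hcross⟩ := hw
  have hC : ∀ u L, CrossesAt τ (u + T) L ↔ CrossesAt τ u L := fun u L => by
    simp only [CrossesAt, hper]
  have hex : ∀ n, ∃ m, t m = t n + T := by
    intro n
    have : t n + T ∈ Set.range t := by
      rw [hrange]; exact ⟨w n, (hC _ _).2 (hcross n)⟩
    exact this
  choose f hf using hex
  have hfm : StrictMono f := by
    intro m n hmn
    rw [← hmono.lt_iff_lt, hf, hf]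
    linarith [hmono hmn]
  have hsurj : ∀ m, ∃ n, f n = m := by
    intro m
    have : t m - T ∈ Set.range t := by
      rw [hrange]
      refine ⟨w m, (hC _ _).1 ?_⟩
      rw [sub_add_cancel]; exact hcross m
    obtain ⟨n, hn⟩ := this
    exact ⟨n, hmono.injective (by rw [hf, hn]; ring)⟩
  have hstep : ∀ n, f (n + 1) = f n + 1 := by
    intro n
    have h1 : f n < f (n + 1) := hfm (by omega)
    obtain ⟨m, hm⟩ := hsurj (f n + 1)
    have h2 : n < m := hfm.lt_iff_lt.1 (by omega)
    have h3 : f (n + 1) ≤ f m := hfm.monotone (by omega)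
    omega
  have hlin : ∀ n : ℤ, f n = n + f 0 := by
    intro n
    induction n using Int.induction_on with
    | zero => simp
    | succ n ih => rw [hstep, ih]; ring
    | pred n ih =>
      have := hstep (-(n : ℤ) - 1)
      rw [sub_add_cancel, ih] at this
      linarith
  have hpos : 0 < f 0 := by
    rw [← hmono.lt_iff_lt, hf]; linarith
  refine ⟨(f 0).toNat, by omega, fun k => ?_⟩
  rw [Int.toNat_of_nonneg hpos.le, ← hlin]
  have h1 := hcross (f k)
  rw [hf, hC] at h1
  exact hτ.label_unique h1 (hcross k)

theorem eq_zero_of_nat_mul_bounded {x C : ℝ} (h : ∀ n : ℕ, |n * x| ≤ C) : x = 0 := by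
  by_contra hx
  obtain ⟨n, hn⟩ := exists_nat_gt (C / |x|)
  have h1 := h n
  rw [abs_mul, Nat.abs_cast] at h1
  rw [div_lt_iff₀ (abs_pos.2 hx)] at hn
  linarith

/-- Over each block of `N` letters the same gluing translations occur, so the exit points at indices
`j * N` form an arithmetic progression in a bounded set, which must be constant. -/
theorem periodic_of_periodicWord {τ v w} (hτ : StrictLinear τ v)
    (hw : IsCuttingSequence τ w) (h : IsPeriodicWord w) : IsPeriodicTrajectory τ := by
  obtain ⟨N, hN, hper⟩ := h
  obtain ⟨t, hmono, hrange, hcross⟩ := hw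
  have hex : ∀ n, ∃ k p, ExitsAt τ v (t n) k p := fun n =>
    hτ.exists_exit (crosses_iff.2 ⟨_, hcross n⟩)
  choose κ p hp using hex
  have hlab : ∀ n, w n = label (κ n) := fun n =>
    (hcross n).eq_label (hp n).2.2.1 (hp n).1 (hp n).2.1
  -- A letter leaves a choice between two opposite sides; the velocity points outwards through only
  -- one of them.
  have hκ : ∀ n : ℤ, κ (n + N) = κ n := by
    intro n
    have h1 := hper n
    rw [hlab, hlab] at h1
    rcases label_eq_iff h1 with h2 | h2
    · exact h2
    · have h3 := (hp (n + N)).2.2.2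
      have h4 := (hp n).2.2.2
      rw [h2, dot_opp] at h3
      linarith
  have hnext : ∀ n : ℤ, p (n + 1) = p n + shift (κ n) + (t (n + 1) - t n : ℝ) * v := by
    intro n
    refine (hp n).next hτ (hp (n + 1)) (hmono (by omega)) fun s h1 h2 hs => ?_
    have : s ∈ Set.range t := by rw [hrange]; exact crosses_iff.1 hs
    obtain ⟨m, rfl⟩ := this
    have := hmono.lt_iff_lt.1 h1
    have := hmono.lt_iff_lt.1 h2
    omega
  -- Subtracting the motion leaves a sequence that changes only by the gluing translations.
  set g : ℤ → ℂ := fun n => p n - t n * v with hg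
  have hg1 : ∀ n, g (n + 1) = g n + shift (κ n) := by
    intro n; simp only [hg, hnext]; push_cast; ring
  have hgN : ∀ m : ℕ, g (m + N) = g m + (g N - g 0) := by
    intro m
    induction m with
    | zero => simp
    | succ m ih =>
      have e1 : ((m + 1 : ℕ) : ℤ) + N = (m + N : ℤ) + 1 := by push_cast; ring
      rw [e1, hg1, ih, hκ]; push_cast; rw [hg1]; ring
  have hgj : ∀ j : ℕ, g ((j * N : ℕ) : ℤ) = g 0 + j * (g N - g 0) := by
    intro j
    induction j with
    | zero => simp
    | succ j ih =>
      have e1 : (((j + 1) * N : ℕ) : ℤ) = ((j * N : ℕ) : ℤ) + N := by push_cast; ring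
      rw [e1, hgN, ih]; push_cast; ring
  have hκj : ∀ j : ℕ, κ ((j * N : ℕ) : ℤ) = κ 0 := by
    intro j
    induction j with
    | zero => simp
    | succ j ih =>
      have e1 : (((j + 1) * N : ℕ) : ℤ) = ((j * N : ℕ) : ℤ) + N := by push_cast; ring
      rw [e1, hκ, ih]
  have hpj : ∀ j : ℕ, p ((j * N : ℕ) : ℤ) =
      p 0 + (t ((j * N : ℕ) : ℤ) - t 0 : ℝ) * v + (j : ℝ) * (g N - g 0) := by
    intro j
    have := hgj j
    simp only [hg] at this ⊢
    push_cast at this ⊢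
    linear_combination this
  have hpos := (hp 0).2.2.2
  have hd0 : ∀ j : ℕ, dot (κ 0) (p ((j * N : ℕ) : ℤ)) = sil / 2 := by
    intro j
    have := ((mem_side_iff _ _).1 (hp ((j * N : ℕ) : ℤ)).1).1
    rwa [hκj] at this
  -- All these exit points lie on the line of one side, which is transverse to `v`; comparing normal
  -- components determines the times.
  have ht : ∀ j : ℕ, t ((j * N : ℕ) : ℤ) - t 0 = j * (t N - t 0) := by
    intro j
    have h1 := hd0 j
    have h2 := hd0 1
    have h3 := hd0 0
    rw [hpj, dot_add, dot_add, dot_real_mul, dot_real_mul] at h1 h2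
    simp only [zero_mul, one_mul, Nat.cast_zero, Nat.cast_one] at h2 h3
    have h4 : (t ((j * N : ℕ) : ℤ) - t 0 - j * (t N - t 0)) * dot (κ 0) v = 0 := by
      linear_combination h1 - j * h2 + (j - 1) * h3
    rcases mul_eq_zero.1 h4 with h5 | h5
    · linarith
    · exact absurd h5 hpos.ne'
  have hpj' : ∀ j : ℕ, p ((j * N : ℕ) : ℤ) = p 0 + (j : ℝ) * (p N - p 0) := by
    intro j
    rw [hpj, ht]
    simp only [hg]
    push_cast; ring
  have hoct : ∀ n, InOct (p n) := fun n => (mem_octagon_iff _).1 (side_subset (hp n).1)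
  have hre : (p N - p 0).re = 0 := by
    refine eq_zero_of_nat_mul_bounded (C := sil) fun j => ?_
    have h1 := hpj' j
    have h2 := (hoct ((j * N : ℕ) : ℤ)).1
    have h3 := (hoct 0).1
    rw [h1, Complex.add_re, Complex.re_ofReal_mul] at h2
    rw [abs_le]; constructor <;> linarith
  have him : (p N - p 0).im = 0 := by
    refine eq_zero_of_nat_mul_bounded (C := sil) fun j => ?_
    have h1 := hpj' j
    have h2 := (hoct ((j * N : ℕ) : ℤ)).2.1
    have h3 := (hoct 0).2.1
    rw [h1, Complex.add_im, Complex.im_ofReal_mul] at h2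
    rw [abs_le]; constructor <;> linarith
  have hpN : p N = p 0 := sub_eq_zero.1 (Complex.ext hre him)
  refine hτ.weakLinear.periodic_of_eq (a := t 0) (b := t N) (hmono (by omega)) ?_
  have h1 := (hp N).2.2.1
  rw [hpN] at h1
  exact (hp 0).2.2.1.eq h1

/-! ### Affine automorphisms of the surface -/

/-- The linear map of the plane with the given matrix. -/
def lin (A : Matrix (Fin 2) (Fin 2) ℝ) (z : ℂ) : ℂ :=
  ⟨A 0 0 * z.re + A 0 1 * z.im, A 1 0 * z.re + A 1 1 * z.im⟩

theorem lin_mul (A B : Matrix (Fin 2) (Fin 2) ℝ) (z) : lin (A * B) z = lin A (lin B z) := by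
  apply Complex.ext <;> simp [lin, Matrix.mul_apply, Fin.sum_univ_two] <;> ring

theorem lin_real_mul (A : Matrix (Fin 2) (Fin 2) ℝ) (c : ℝ) (z) : lin A (c * z) = c * lin A z := by
  apply Complex.ext <;> simp [lin] <;> ring

theorem lin_neg (A : Matrix (Fin 2) (Fin 2) ℝ) (z) : lin A (-z) = -lin A z := by
  apply Complex.ext <;> simp [lin] <;> ring

theorem lin_add (A : Matrix (Fin 2) (Fin 2) ℝ) (z w) : lin A (z + w) = lin A z + lin A w := by
  apply Complex.ext <;> simp [lin] <;> ring

/-- The matrix `A` is the linear part of an affine automorphism of the surface. -/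
def IsAffine (A : Matrix (Fin 2) (Fin 2) ℝ) : Prop :=
  ∃ Φ : Surface → Surface, Function.Injective Φ ∧ ∀ v x f, Starts v x f →
    Starts (lin A v) (Φ x) (fun s => Φ (f s))

theorem IsAffine.mul {A B} (hA : IsAffine A) (hB : IsAffine B) : IsAffine (A * B) := by
  obtain ⟨Φ, h1, h2⟩ := hA
  obtain ⟨Ψ, h3, h4⟩ := hB
  refine ⟨Φ ∘ Ψ, h1.comp h3, fun v x f h => ?_⟩
  rw [lin_mul]
  exact h2 _ _ _ (h4 _ _ _ h)

theorem IsAffine.exists_map {A} (hA : IsAffine A) : ∃ Φ : Surface → Surface,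
    Function.Injective Φ ∧ ∀ τ v, WeakLinear τ v → WeakLinear (fun t => Φ (τ t)) (lin A v) := by
  obtain ⟨Φ, h1, h2⟩ := hA
  refine ⟨Φ, h1, fun τ v h t => ⟨h2 _ _ _ (h t).1, ?_⟩⟩
  rw [← lin_neg]
  exact h2 _ _ _ (h t).2

/-- An affine automorphism from a relation between points of the octagon. -/
theorem isAffine_of_relation {A : Matrix (Fin 2) (Fin 2) ℝ} {D : ℂ → ℂ → Prop}
    (hmem : ∀ z z', D z z' → z ∈ octagon)
    (hsymm : ∀ z z', D z z' → D z' z)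
    (hvert : ∀ z z', D z z' → z ∈ Set.range vertex → z' ∈ Set.range vertex)
    (hself : ∀ z z' z'', z ∉ Set.range vertex → D z z' → D z z'' → Same z' z'')
    (hglue : ∀ k z z' z'', z ∉ Set.range vertex → z ∈ side k → D z z' → D (z + shift k) z'' →
      Same z' z'')
    (hgerm : ∀ q v, q ∈ octagon → (∀ᶠ s : ℝ in 𝓝[≥] 0, q + s * v ∈ octagon) →
      ∃ q', ∀ᶠ s : ℝ in 𝓝[≥] 0, D (q + s * v) (q' + s * lin A v)) : IsAffine A := by
  have htot : ∀ z ∈ octagon, ∃ z', D z z' := by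
    intro z hz
    obtain ⟨q', h⟩ := hgerm z 0 hz (by simp [hz])
    have := h.self_of_nhdsWithin (by simp)
    simp only [Complex.ofReal_zero, zero_mul, add_zero] at this
    exact ⟨q', this⟩
  -- The relation descends to the surface. As it is symmetric, the same compatibility read backwards
  -- gives injectivity.
  have hcompat : ∀ z w z' w', Same z w → D z z' → D w w' → Same z' w' := by
    intro z w z' w' hs hz hw
    by_cases hv : z ∈ Set.range vertex
    · exact Or.inr (Or.inl ⟨hvert _ _ hz hv, hvert _ _ hw (hs.mem_vertex_iff.1 hv)⟩)
    · rcases hs with rfl | ⟨h1, -⟩ | ⟨k, h1, h2, rfl⟩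
      · exact hself _ _ _ hv hz hw
      · exact absurd h1 hv
      · exact hglue k _ _ _ hv h1 hz hw
  have hex : ∀ x : Surface, ∃ y : Surface, ∀ z z', Represents z x → D z z' → Represents z' y := by
    intro x
    obtain ⟨z, hz⟩ := exists_represents x
    obtain ⟨z', hz'⟩ := htot z hz.mem
    have hm := hmem _ _ (hsymm _ _ hz')
    refine ⟨Quot.mk Glue ⟨z', hm⟩, fun w w' hw hD => ?_⟩
    have : Represents z' (Quot.mk Glue ⟨z', hm⟩) := ⟨hm, rfl⟩
    exact this.of_same (hmem _ _ (hsymm _ _ hD)) (hcompat _ _ _ _ (hz.same hw) hz' hD)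
  choose Φ hΦ using hex
  refine ⟨Φ, ?_, ?_⟩
  · intro x y hxy
    obtain ⟨z, hz⟩ := exists_represents x
    obtain ⟨z', hz'⟩ := htot z hz.mem
    obtain ⟨w, hw⟩ := exists_represents y
    obtain ⟨w', hw'⟩ := htot w hw.mem
    have h1 := hΦ x z z' hz hz'
    have h2 := hΦ y w w' hw hw'
    rw [← hxy] at h2
    have h3 := hcompat _ _ _ _ (h1.same h2) (hsymm _ _ hz') (hsymm _ _ hw')
    exact (hz.of_same hw.mem h3).eq hw
  · rintro v x f ⟨q, hqv, hq, ε, hε, he⟩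
    have hev : ∀ᶠ s : ℝ in 𝓝[≥] 0, q + s * v ∈ octagon := by
      filter_upwards [Ico_mem_nhdsGE hε] with s hs
      rcases hs.1.eq_or_lt with h | h
      · rw [← h]; simpa using hq.mem
      · exact (he s h hs.2).mem
    obtain ⟨q', hq'⟩ := hgerm q v hq.mem hev
    have h0 := hq'.self_of_nhdsWithin (by simp)
    simp only [Complex.ofReal_zero, zero_mul, add_zero] at h0
    refine ⟨q', fun h => hqv (hvert _ _ (hsymm _ _ h0) h), hΦ _ _ _ hq h0, ?_⟩
    have hev' : ∀ᶠ s : ℝ in 𝓝[≥] 0, 0 < s → Represents (q' + s * lin A v) (Φ (f s)) := by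
      filter_upwards [Ico_mem_nhdsGE hε, hq'] with s hs hD hpos
      exact hΦ _ _ _ (he s hpos hs.2) hD
    obtain ⟨δ, hδ, hd⟩ := mem_nhdsGE_iff_exists_Ico_subset.1 hev'
    exact ⟨δ, hδ, fun s h1 h2 => hd ⟨h1.le, h2⟩ h1⟩

/-! ### The isometries of the octagon as affine automorphisms. -/

theorem mem_vertex_iff_normSq {k z} (h : z ∈ side k) :
    z ∈ Set.range vertex ↔ Complex.normSq z = sil / 2 * (sil / 2) + 1 / 4 := by
  rw [mem_vertex_iff h, normSq_eq k z, ((mem_side_iff k z).1 h).1]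
  constructor
  · rintro (h | h) <;> rw [h] <;> ring
  · intro h
    have : (tang k z - 1 / 2) * (tang k z + 1 / 2) = 0 := by linarith
    rcases mul_eq_zero.1 this with h | h
    · left; linarith
    · right; linarith

/-- An isometric involution that permutes the normals also permutes the sides and carries the gluing
translations to one another. Vertices are preserved because they are recognised among side points by
their modulus. -/
theorem isAffine_of_reflection {A : Matrix (Fin 2) (Fin 2) ℝ} {c : Fin 8}
    (hinv : ∀ z, lin A (lin A z) = z) (hnorm : ∀ z, Complex.normSq (lin A z) = Complex.normSq z)
    (hnormal : ∀ k, lin A (normal k) = normal (c - k))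
    (hdot : ∀ k z, dot (c - k) (lin A z) = dot k z) : IsAffine A := by
  have hoct : ∀ z, z ∈ octagon → lin A z ∈ octagon := by
    intro z hz
    rw [mem_octagon_iff_dot]
    intro k
    have := hdot (c - k) z
    rw [sub_sub_cancel] at this
    rw [this]; exact dot_le hz _
  have hside : ∀ k z, z ∈ side k → lin A z ∈ side (c - k) := by
    intro k z hz
    rw [mem_side_iff_octagon] at hz ⊢
    exact ⟨hoct z hz.1, by rw [hdot]; exact hz.2⟩
  have hvert : ∀ z, z ∈ Set.range vertex → lin A z ∈ Set.range vertex := by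
    rintro _ ⟨k, rfl⟩
    rw [mem_vertex_iff_normSq (hside k _ (vertex_mem_side k)), hnorm,
      ← mem_vertex_iff_normSq (vertex_mem_side k)]
    exact ⟨k, rfl⟩
  refine isAffine_of_relation (D := fun z z' => z ∈ octagon ∧ z' = lin A z)
    (fun z z' h => h.1) ?_ ?_ ?_ ?_ ?_
  · rintro z _ ⟨h, rfl⟩; exact ⟨hoct z h, (hinv z).symm⟩
  · rintro z _ ⟨h, rfl⟩ hv; exact hvert z hv
  · rintro z _ _ _ ⟨_, rfl⟩ ⟨_, rfl⟩; exact Or.inl rfl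
  · rintro k z _ _ hv hk ⟨_, rfl⟩ ⟨_, rfl⟩
    refine Or.inr (Or.inr ⟨c - k, hside k z hk, fun h => ?_, ?_⟩)
    · have := hvert _ h
      rw [hinv] at this
      exact hv this
    · rw [lin_add, shift_eq, shift_eq, ← hnormal, ← Complex.ofReal_neg, lin_real_mul]
  · intro q v _ hev
    refine ⟨lin A q, hev.mono fun s hs => ⟨hs, ?_⟩⟩
    rw [lin_add, lin_real_mul]

theorem isAffine_conj : IsAffine !![1, 0; 0, -1] := by
  have hn : ∀ k, lin !![1, 0; 0, -1] (normal k) = normal (4 - k) := by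
    intro k
    fin_cases k <;> apply Complex.ext <;> simp [lin, normal]
  refine isAffine_of_reflection (c := 4) ?_ ?_ hn ?_
  · intro z; apply Complex.ext <;> simp [lin]
  · intro z; simp [lin, Complex.normSq_apply]
  · intro k z; simp only [dot, ← hn]; simp [lin]

theorem ν_one : ν 1 = !![(sil - 1) / 2, (sil - 1) / 2; (sil - 1) / 2, -((sil - 1) / 2)] := by
  simp only [ν]
  rw [one_div_sqrt_two]; rfl

theorem isAffine_ν_one : IsAffine (ν 1) := by
  have g := sil_sq
  rw [ν_one]
  have hn : ∀ k, lin !![(sil - 1) / 2, (sil - 1) / 2; (sil - 1) / 2, -((sil - 1) / 2)] (normal k)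
      = normal (3 - k) := by
    intro k
    fin_cases k <;> apply Complex.ext <;> simp [lin, normal] <;> nlinarith
  refine isAffine_of_reflection (c := 3) ?_ ?_ hn ?_
  · intro z; apply Complex.ext <;> simp [lin]
    · linear_combination (z.re / 2) * g
    · linear_combination (z.im / 2) * g
  · intro z; simp [lin, Complex.normSq_apply]
    linear_combination ((z.re * z.re + z.im * z.im) / 2) * g
  · intro k z; simp only [dot, ← hn]; simp [lin]
    linear_combination (((normal k).re * z.re + (normal k).im * z.im) / 2) * g

theorem inv_sqrt_two : (√2)⁻¹ = (sil - 1) / 2 := by rw [← one_div, one_div_sqrt_two]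

/-- Passing from one sector to the next alternates between the two reflections that bound the sector
`0` and its image: each `ν i` is one of them times its predecessor. -/
theorem ν_eq_prod (i : Fin 8) :
    ν i = 1 ∨ ∃ j : Fin 8, (j < i) ∧ (ν i = !![1, 0; 0, -1] * ν j ∨ ν i = ν 1 * ν j) := by
  have g := sil_sq
  fin_cases i
  · left; ext a b; fin_cases a <;> fin_cases b <;> simp [ν]
  · right; refine ⟨0, by decide, Or.inr ?_⟩
    ext a b; fin_cases a <;> fin_cases b <;> simp [ν]
  all_goals right
  · refine ⟨1, by decide, Or.inl ?_⟩
    ext a b; fin_cases a <;> fin_cases b <;> simp [ν]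
  · refine ⟨2, by decide, Or.inr ?_⟩
    ext a b; fin_cases a <;> fin_cases b <;> simp [ν, inv_sqrt_two] <;> nlinarith
  · refine ⟨3, by decide, Or.inl ?_⟩
    ext a b; fin_cases a <;> fin_cases b <;> simp [ν]
  · refine ⟨4, by decide, Or.inr ?_⟩
    ext a b; fin_cases a <;> fin_cases b <;> simp [ν]
  · refine ⟨5, by decide, Or.inl ?_⟩
    ext a b; fin_cases a <;> fin_cases b <;> simp [ν]
  · refine ⟨6, by decide, Or.inr ?_⟩
    ext a b; fin_cases a <;> fin_cases b <;> simp [ν, inv_sqrt_two] <;> nlinarith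

theorem lin_one (z) : lin 1 z = z := by apply Complex.ext <;> simp [lin]

theorem isAffine_one : IsAffine 1 :=
  ⟨id, Function.injective_id, fun v x f h => by rw [lin_one]; exact h⟩

/-- Induction over the eight isometries, as products of two reflections. -/
theorem ν_induction {P : Matrix (Fin 2) (Fin 2) ℝ → Prop} (h1 : P 1)
    (hS : ∀ A, P A → P (!![1, 0; 0, -1] * A)) (hR : ∀ A, P A → P (ν 1 * A)) (i : Fin 8) :
    P (ν i) := by
  induction i using WellFoundedLT.induction with
  | ind i ih =>
    rcases ν_eq_prod i with h | ⟨j, hj, h | h⟩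
    · rw [h]; exact h1
    · rw [h]; exact hS _ (ih j hj)
    · rw [h]; exact hR _ (ih j hj)

theorem isAffine_ν (i) : IsAffine (ν i) :=
  ν_induction isAffine_one (fun _ h => isAffine_conj.mul h) (fun _ h => isAffine_ν_one.mul h) i

/-! ### The affine reflection with linear part `γ`: a half-turn-symmetric map twisting the middle
cylinder (circumference `sil`, height `1`) twice and the outer one (circumference `sil + 1`, height
`(sil - 1) / 2`) once. -/

theorem γ_eq : γ = !![-1, 2 * sil; 0, 1] := by simp only [γ, sil]

theorem lin_γ_re (z) : (lin γ z).re = -z.re + 2 * sil * z.im := by simp [γ_eq, lin]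

theorem lin_γ_im (z) : (lin γ z).im = z.im := by simp [γ_eq, lin]

/-- Used to determine the number of turns around a cylinder from bounds on the coordinates. -/
theorem int_le_of_mul {n m : ℤ} {K c : ℝ} (hK : 0 < K) (h : n * K ≤ c) (hc : c < (m + 1) * K) :
    n ≤ m := by
  have h1 : (n : ℝ) * K < (m + 1) * K := lt_of_le_of_lt h hc
  have h2 : (n : ℝ) < m + 1 := lt_of_mul_lt_mul_right h1 hK.le
  have h3 : n < m + 1 := by exact_mod_cast h2
  omega

theorem int_eq_of_mul {n m : ℤ} {K c : ℝ} (hK : 0 < K) (hc : n * K = c) (h1 : (m - 1) * K < c)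
    (h2 : c < (m + 1) * K) : n = m := by
  apply le_antisymm
  · exact int_le_of_mul hK hc.le h2
  · have : -n ≤ -m := int_le_of_mul (c := -c) hK (by push_cast; linarith) (by push_cast; linarith)
    omega

theorem vertex_iff_coord {z} (h : InOct z) : z ∈ Set.range vertex ↔
    (z.re = sil / 2 ∨ z.re = -(sil / 2)) ∧ (z.im = 1 / 2 ∨ z.im = -(1 / 2)) ∨
    (z.im = sil / 2 ∨ z.im = -(sil / 2)) ∧ (z.re = 1 / 2 ∨ z.re = -(1 / 2)) := by
  constructor
  · rintro ⟨k, rfl⟩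
    fin_cases k <;> simp [vertex, sil] <;> ring_nf <;> simp
  · have key : ∀ k : Fin 8, (vertex k).re = z.re → (vertex k).im = z.im →
        z ∈ Set.range vertex := fun k h1 h2 => ⟨k, Complex.ext h1 h2⟩
    rintro (⟨h1 | h1, h2 | h2⟩ | ⟨h1 | h1, h2 | h2⟩)
    · exact key 2 (by rw [h1]; simp [vertex, sil]; try ring) (by rw [h2]; simp [vertex]; try ring)
    · exact key 3 (by rw [h1]; simp [vertex, sil]; try ring) (by rw [h2]; simp [vertex]; try ring)
    · exact key 7 (by rw [h1]; simp [vertex, sil]; try ring) (by rw [h2]; simp [vertex]; try ring)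
    · exact key 6 (by rw [h1]; simp [vertex, sil]; try ring) (by rw [h2]; simp [vertex]; try ring)
    · exact key 1 (by rw [h2]; simp [vertex]; try ring) (by rw [h1]; simp [vertex, sil]; try ring)
    · exact key 0 (by rw [h2]; simp [vertex]; try ring) (by rw [h1]; simp [vertex, sil]; try ring)
    · exact key 4 (by rw [h2]; simp [vertex]; try ring) (by rw [h1]; simp [vertex, sil]; try ring)
    · exact key 5 (by rw [h2]; simp [vertex]; try ring) (by rw [h1]; simp [vertex, sil]; try ring)

theorem InOct.neg {z} (h : InOct z) : InOct (-z) := by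
  obtain ⟨⟨a1, a2⟩, ⟨b1, b2⟩, ⟨c1, c2⟩, d1, d2⟩ := h
  simp only [InOct, Complex.neg_re, Complex.neg_im]
  refine ⟨⟨?_, ?_⟩, ⟨?_, ?_⟩, ⟨?_, ?_⟩, ?_, ?_⟩ <;> linarith

/-- The affine reflection with linear part `γ`, in the cylinder `|Im z| ≤ 1 / 2`. -/
def MidRel (z z' : ℂ) : Prop :=
  -(1 / 2) ≤ z.im ∧ z.im ≤ 1 / 2 ∧ z'.im = z.im ∧
    ∃ n : ℤ, z'.re = -z.re + 2 * sil * z.im + n * sil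

/-- The affine reflection with linear part `γ`, on the upper half of the other cylinder. -/
def TopRel (z z' : ℂ) : Prop :=
  1 / 2 ≤ z.im ∧ ((z'.im = z.im ∧
      ∃ n : ℤ, z'.re = -z.re + 2 * sil * z.im - sil + n * (sil + 1)) ∨
    (z'.im = z.im - (sil + 1) / 2 ∧
      ∃ n : ℤ, z'.re = -z.re + 2 * sil * z.im - sil - (sil + 1) / 2 + n * (sil + 1)))

/-- The affine reflection of the surface with linear part `γ`, on points of the octagon. -/
def Reflects (z z' : ℂ) : Prop :=
  InOct z ∧ InOct z' ∧ (MidRel z z' ∨ TopRel z z' ∨ TopRel (-z) (-z'))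

theorem Reflects.neg {z z'} (h : Reflects z z') : Reflects (-z) (-z') := by
  obtain ⟨h1, h2, h⟩ := h
  refine ⟨h1.neg, h2.neg, ?_⟩
  rcases h with ⟨a, b, c, n, hn⟩ | h | h
  · refine Or.inl ⟨?_, ?_, ?_, -n, ?_⟩ <;> simp only [Complex.neg_re, Complex.neg_im] <;>
      push_cast <;> linarith
  · right; right; simpa using h
  · right; left; exact h

theorem TopRel.symm {z z'} (ho : InOct z) (h : TopRel z z') :
    TopRel z' z ∨ TopRel (-z') (-z) := by
  have g := sil_sq
  obtain ⟨h1, ⟨h2, n, h3⟩ | ⟨h2, n, h3⟩⟩ := h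
  · left
    refine ⟨by linarith, Or.inl ⟨h2.symm, n, ?_⟩⟩
    rw [h3, h2]; ring
  · right
    have := ho.2.1.2
    refine ⟨by rw [Complex.neg_im]; linarith, Or.inr ⟨?_, -n, ?_⟩⟩
    · simp only [Complex.neg_im]; linarith
    · simp only [Complex.neg_re, Complex.neg_im]; rw [h3, h2]; push_cast
      linear_combination -g

theorem Reflects.symm {z z'} (h : Reflects z z') : Reflects z' z := by
  obtain ⟨h1, h2, h⟩ := h
  refine ⟨h2, h1, ?_⟩
  rcases h with ⟨a, b, c, n, hn⟩ | h | h
  · refine Or.inl ⟨by linarith, by linarith, c.symm, n, ?_⟩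
    rw [hn, c]; ring
  · exact Or.inr (h.symm h1)
  · right
    have := h.symm h1.neg
    simp only [neg_neg] at this
    exact this.symm

theorem MidRel.map_vertex {z z'} (h1 : InOct z) (h2 : InOct z') (h : MidRel z z')
    (hv : z ∈ Set.range vertex) : z' ∈ Set.range vertex := by
  have g1 := sil_sq
  have g2 := sil_gt
  rw [vertex_iff_coord h1] at hv
  rw [vertex_iff_coord h2]
  obtain ⟨a, b, c, n, hn⟩ := h
  obtain ⟨⟨a1, a2⟩, -⟩ := h2
  left
  rcases hv with ⟨h3, h4⟩ | ⟨h3 | h3, -⟩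
  · refine ⟨?_, by rw [c]; exact h4⟩
    -- At height `±1 / 2` the shear term is `±sil`, so the abscissa stays an odd multiple of `sil /
    -- 2`; the octagon allows only `±sil / 2`.
    obtain ⟨m, hm⟩ : ∃ m : ℤ, z'.re = sil / 2 + m * sil := by
      rcases h3 with h3 | h3 <;> rcases h4 with h4 | h4 <;> rw [h3, h4] at hn
      · exact ⟨n, by linarith⟩
      · exact ⟨n - 2, by push_cast; linarith⟩
      · exact ⟨n + 1, by push_cast; linarith⟩
      · exact ⟨n - 1, by push_cast; linarith⟩
    have hm0 : m ≤ 0 := int_le_of_mul (K := sil) (c := 0) (by linarith) (by linarith)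
      (by push_cast; linarith)
    have hm1 : -m ≤ 1 := int_le_of_mul (K := sil) (c := sil) (by linarith)
      (by push_cast; linarith) (by push_cast; linarith)
    have : m = 0 ∨ m = -1 := by omega
    rcases this with rfl | rfl
    · left; rw [hm]; simp
    · right; rw [hm]; push_cast; ring
  · linarith
  · linarith

theorem TopRel.map_vertex {z z'} (h1 : InOct z) (h2 : InOct z') (h : TopRel z z')
    (hv : z ∈ Set.range vertex) : z' ∈ Set.range vertex := by
  have g1 := sil_sq
  have g2 := sil_gt
  rw [vertex_iff_coord h1] at hv
  rw [vertex_iff_coord h2]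
  obtain ⟨a, h⟩ := h
  obtain ⟨⟨a1, a2⟩, ⟨b1, b2⟩, ⟨c1, c2⟩, d1, d2⟩ := h2
  rcases hv with ⟨h3, h4 | h4⟩ | ⟨h3 | h3, h4⟩
  · rcases h with ⟨h5, n, hn⟩ | ⟨h5, n, hn⟩
    · left
      refine ⟨?_, by left; rw [h5, h4]⟩
      rcases h3 with h3 | h3 <;> rw [h3, h4] at hn
      · have : n = 0 := int_eq_of_mul (K := sil + 1) (m := 0) (by linarith)
          (show n * (sil + 1) = z'.re + sil / 2 by linarith) (by push_cast; linarith)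
          (by push_cast; linarith)
        subst this; right; rw [hn]; push_cast; ring
      · have : n = 0 := int_eq_of_mul (K := sil + 1) (m := 0) (by linarith)
          (show n * (sil + 1) = z'.re - sil / 2 by linarith) (by push_cast; linarith)
          (by push_cast; linarith)
        subst this; left; rw [hn]; push_cast; ring
    · right
      refine ⟨by right; rw [h5, h4]; ring, ?_⟩
      rcases h3 with h3 | h3 <;> rw [h3, h4] at hn
      · have : n = 1 := int_eq_of_mul (K := sil + 1) (m := 1) (by linarith)
          (show n * (sil + 1) = z'.re + sil / 2 + (sil + 1) / 2 by linarith)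
          (by push_cast; linarith) (by push_cast; linarith)
        subst this; left; rw [hn]; push_cast; ring
      · have : n = 0 := int_eq_of_mul (K := sil + 1) (m := 0) (by linarith)
          (show n * (sil + 1) = z'.re - sil / 2 + (sil + 1) / 2 by linarith)
          (by push_cast; linarith) (by push_cast; linarith)
        subst this; right; rw [hn]; push_cast; ring
  · linarith
  · rcases h with ⟨h5, n, hn⟩ | ⟨h5, n, hn⟩
    · right
      refine ⟨by left; rw [h5, h3], ?_⟩
      rcases h4 with h4 | h4 <;> rw [h3, h4] at hn
      · have : n = -1 := int_eq_of_mul (K := sil + 1) (m := -1) (by linarith)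
          (show n * (sil + 1) = z'.re + 1 / 2 - sil - 1 by linarith)
          (by push_cast; linarith) (by push_cast; linarith)
        subst this; right; rw [hn]; push_cast; linarith
      · have : n = -1 := int_eq_of_mul (K := sil + 1) (m := -1) (by linarith)
          (show n * (sil + 1) = z'.re - 1 / 2 - sil - 1 by linarith)
          (by push_cast; linarith) (by push_cast; linarith)
        subst this; left; rw [hn]; push_cast; linarith
    · left
      refine ⟨?_, by right; rw [h5, h3]; ring⟩
      rcases h4 with h4 | h4 <;> rw [h3, h4] at hn
      · have : n = 0 := int_eq_of_mul (K := sil + 1) (m := 0) (by linarith)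
          (show n * (sil + 1) = z'.re + 1 / 2 - sil - 1 + (sil + 1) / 2 by linarith)
          (by push_cast; linarith) (by push_cast; linarith)
        subst this; left; rw [hn]; push_cast; linarith
      · have : n = -1 := int_eq_of_mul (K := sil + 1) (m := -1) (by linarith)
          (show n * (sil + 1) = z'.re - 1 / 2 - sil - 1 + (sil + 1) / 2 by linarith)
          (by push_cast; linarith) (by push_cast; linarith)
        subst this; right; rw [hn]; push_cast; linarith
  · linarith

theorem neg_mem_vertex {z} : -z ∈ Set.range vertex ↔ z ∈ Set.range vertex := by
  have key : ∀ w, w ∈ Set.range vertex → -w ∈ Set.range vertex := by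
    rintro _ ⟨k, rfl⟩
    refine ⟨k + 4, Complex.ext ?_ ?_⟩
    · rw [vertex_re, Complex.neg_re, vertex_re, normal_opp, Complex.neg_re, Complex.neg_im]; ring
    · rw [vertex_im, Complex.neg_im, vertex_im, normal_opp, Complex.neg_re, Complex.neg_im]; ring
  exact ⟨fun h => by simpa using key _ h, key z⟩

theorem Reflects.map_vertex {z z'} (h : Reflects z z') (hv : z ∈ Set.range vertex) :
    z' ∈ Set.range vertex := by
  obtain ⟨h1, h2, h | h | h⟩ := h
  · exact h.map_vertex h1 h2 hv
  · exact h.map_vertex h1 h2 hv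
  · exact neg_mem_vertex.1 (h.map_vertex h1.neg h2.neg (neg_mem_vertex.2 hv))

theorem neg_mem_side {k z} : -z ∈ side (k + 4) ↔ z ∈ side k := by
  have ht : tang (k + 4) (-z) = tang k z := by simp only [tang, normal_opp]; simp
  rw [mem_side_iff, mem_side_iff, ht, dot_opp, dot_neg, neg_neg]

theorem Same.neg {z z'} (h : Same z z') : Same (-z) (-z') := by
  rcases h with rfl | ⟨h1, h2⟩ | ⟨k, h1, h2, rfl⟩
  · exact Or.inl rfl
  · exact Or.inr (Or.inl ⟨neg_mem_vertex.2 h1, neg_mem_vertex.2 h2⟩)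
  · refine Or.inr (Or.inr ⟨k + 4, neg_mem_side.2 h1, ?_, by rw [shift_opp]; ring⟩)
    rwa [neg_mem_vertex]

theorem same_of_neg {z z'} (h : Same (-z) (-z')) : Same z z' := by simpa using h.neg

/-- Points of the same side up to its translation are identified. -/
theorem same_of_side {k z z'} (h : z ∈ side k) (h' : z' = z + shift k) : Same z z' := by
  by_cases hv : z ∈ Set.range vertex
  · exact Or.inr (Or.inl ⟨hv, by rw [h']; exact (add_shift_mem_vertex_iff h).2 hv⟩)
  · exact Or.inr (Or.inr ⟨k, h, hv, h'⟩)

theorem mem_side_of_coord {z} (k) (h : InOct z) (hd : dot k z = sil / 2) : z ∈ side k :=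
  (mem_side_iff_octagon k z).2 ⟨(mem_octagon_iff z).2 h, hd⟩

theorem shift_zero : shift 0 = ⟨0, -sil⟩ := by
  rw [shift_eq]; apply Complex.ext <;> simp [normal]

theorem shift_two : shift 2 = ⟨-sil, 0⟩ := by
  rw [shift_eq]; apply Complex.ext <;> simp [normal]

theorem shift_one : shift 1 = ⟨-((sil + 1) / 2), -((sil + 1) / 2)⟩ := by
  have g := sil_sq
  rw [shift_eq]; apply Complex.ext <;> simp [normal] <;> linarith

theorem shift_three : shift 3 = ⟨-((sil + 1) / 2), (sil + 1) / 2⟩ := by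
  have g := sil_sq
  rw [shift_eq]; apply Complex.ext <;> simp [normal] <;> linarith

theorem shift_seven : shift 7 = ⟨(sil + 1) / 2, -((sil + 1) / 2)⟩ := by
  rw [show (7 : Fin 8) = 3 + 4 from rfl, shift_opp, shift_three]
  apply Complex.ext <;> simp

theorem dot_zero (z) : dot 0 z = z.im := by simp [dot, normal]
theorem dot_two (z) : dot 2 z = z.re := by simp [dot, normal]
theorem dot_one (z) : dot 1 z = (sil - 1) / 2 * (z.re + z.im) := by simp [dot, normal]; ring
theorem dot_three (z) : dot 3 z = (sil - 1) / 2 * (z.re - z.im) := by simp [dot, normal]; ring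
theorem dot_seven (z) : dot 7 z = (sil - 1) / 2 * (z.im - z.re) := by simp [dot, normal]; ring

/-- Two images at one height differ by a multiple of the circumference `sil`. This is also the width
of the octagon, so distinct images lie on the two vertical sides and are glued. -/
theorem MidRel.same {z z' z''} (h1 : InOct z') (h2 : InOct z'') (h : MidRel z z')
    (h' : MidRel z z'') : Same z' z'' := by
  have g1 := sil_sq
  have g2 := sil_gt
  obtain ⟨a, b, c, n, hn⟩ := h
  obtain ⟨-, -, c', m, hm⟩ := h'
  have key : ∀ {w w' : ℂ} {n m : ℤ}, InOct w → InOct w' → w.im = z.im → w'.im = z.im →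
      w.re = -z.re + 2 * sil * z.im + n * sil → w'.re = -z.re + 2 * sil * z.im + m * sil →
      m < n → Same w w' := by
    intro w w' n m h1 h2 c c' hn hm hlt
    have e1 := h1.1
    have e2 := h2.1
    have : n - m = 1 := by
      have : n - m ≤ 1 := int_le_of_mul (K := sil) (c := w.re - w'.re) (by linarith)
        (by push_cast; linarith) (by push_cast; linarith)
      omega
    have hn' : (n : ℝ) = m + 1 := by
      have : n = m + 1 := by omega
      rw [this]; push_cast; ring
    rw [hn'] at hn
    have hr : w.re = sil / 2 := by linarith
    refine same_of_side (k := 2) (mem_side_of_coord 2 h1 (by rw [dot_two, hr])) ?_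
    rw [shift_two]
    apply Complex.ext
    · simp; linarith
    · simp; linarith
  rcases lt_trichotomy n m with hnm | hnm | hnm
  · exact (key h2 h1 c' c hm hn hnm).symm
  · left; subst hnm; apply Complex.ext <;> linarith
  · exact key h1 h2 c c' hn hm hnm

theorem TopRel.same {z z' z''} (h1 : InOct z') (h2 : InOct z'') (h : TopRel z z')
    (h' : TopRel z z'') : Same z' z'' := by
  have g1 := sil_sq
  have g2 := sil_gt
  -- An image in the upper trapezoid and one in the lower trapezoid can coexist only on a slanted
  -- side, `1` or `7`, whose gluing identifies them.
  have mixed : ∀ {w w' : ℂ} {n m : ℤ}, InOct w → InOct w' → 1 / 2 ≤ z.im → w.im = z.im →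
      w'.im = z.im - (sil + 1) / 2 →
      w.re = -z.re + 2 * sil * z.im - sil + n * (sil + 1) →
      w'.re = -z.re + 2 * sil * z.im - sil - (sil + 1) / 2 + m * (sil + 1) → Same w w' := by
    intro w w' n m hw hw' hz hi hi' hr hr'
    obtain ⟨-, ⟨b1, b2⟩, ⟨c1, c2⟩, d1, d2⟩ := id hw
    obtain ⟨-, ⟨b3, b4⟩, ⟨c3, c4⟩, d3, d4⟩ := hw'
    have e1 : m - n ≤ 1 := int_le_of_mul (K := sil + 1) (c := sil + 1) (by linarith)
      (by push_cast; linarith) (by push_cast; linarith)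
    have e2 : n - m ≤ 0 := int_le_of_mul (K := sil + 1) (c := 0) (by linarith)
      (by push_cast; linarith) (by push_cast; linarith)
    have : m = n ∨ m = n + 1 := by omega
    rcases this with rfl | rfl
    · refine same_of_side (k := 1) (mem_side_of_coord 1 hw ?_) ?_
      · rw [dot_one, show w.re + w.im = (sil + 1) / 2 by linarith]; linear_combination g1 / 4
      · rw [shift_one]; apply Complex.ext <;> simp <;> linarith
    · push_cast at hr'
      refine same_of_side (k := 7) (mem_side_of_coord 7 hw ?_) ?_
      · rw [dot_seven, show w.im - w.re = (sil + 1) / 2 by linarith]; linear_combination g1 / 4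
      · rw [shift_seven]; apply Complex.ext <;> simp <;> linarith
  obtain ⟨a, ⟨c, n, hn⟩ | ⟨c, n, hn⟩⟩ := h <;> obtain ⟨-, ⟨c', m, hm⟩ | ⟨c', m, hm⟩⟩ := h'
  · have e1 := h1.1
    have e2 := h2.1
    have : n - m = 0 := int_eq_of_mul (K := sil + 1) (m := 0) (by linarith)
      (show ((n - m : ℤ) : ℝ) * (sil + 1) = z'.re - z''.re by push_cast; linarith)
      (by push_cast; linarith) (by push_cast; linarith)
    have : n = m := by omega
    subst this
    left; apply Complex.ext <;> linarith
  · exact mixed h1 h2 a c c' hn hm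
  · exact (mixed h2 h1 a c' c hm hn).symm
  · have e1 := h1.1
    have e2 := h2.1
    have : n - m = 0 := int_eq_of_mul (K := sil + 1) (m := 0) (by linarith)
      (show ((n - m : ℤ) : ℝ) * (sil + 1) = z'.re - z''.re by push_cast; linarith)
      (by push_cast; linarith) (by push_cast; linarith)
    have : n = m := by omega
    subst this
    left; apply Complex.ext <;> linarith

/-- On the common boundary `Im z = 1 / 2` of the two cylinders both formulas reduce to `x ↦ -x`. A
representative in the lower trapezoid is excluded because `z` is not a vertex. -/
theorem MidRel.same_top {z z' z''} (hv : z ∉ Set.range vertex) (h0 : InOct z) (h1 : InOct z')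
    (h2 : InOct z'') (h : MidRel z z') (h' : TopRel z z'') : Same z' z'' := by
  have g1 := sil_sq
  have g2 := sil_gt
  obtain ⟨a, b, c, n, hn⟩ := h
  obtain ⟨a', h'⟩ := h'
  have hy : z.im = 1 / 2 := le_antisymm b a'
  rw [vertex_iff_coord h0] at hv
  push Not at hv
  have hv1 : z.re < sil / 2 := lt_of_le_of_ne h0.1.2 fun h => (hv.1 (Or.inl h)).1 hy
  have hv2 : -(sil / 2) < z.re := lt_of_le_of_ne h0.1.1 fun h => (hv.1 (Or.inr h.symm)).1 hy
  rw [hy] at hn c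
  have e1 := h1.1
  obtain rfl : n = -1 := int_eq_of_mul (K := sil) (m := -1) (by linarith)
    (show n * sil = z'.re + z.re - sil by linarith) (by push_cast; linarith)
    (by push_cast; linarith)
  push_cast at hn
  obtain ⟨e2, -, ⟨c1, c2⟩, d1, d2⟩ := h2
  rcases h' with ⟨c', m, hm⟩ | ⟨c', m, hm⟩ <;> rw [hy] at hm c'
  · obtain rfl : m = 0 := int_eq_of_mul (K := sil + 1) (m := 0) (by linarith)
      (show m * (sil + 1) = z''.re + z.re by linarith) (by push_cast; linarith)
      (by push_cast; linarith)
    push_cast at hm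
    left; apply Complex.ext <;> linarith
  · exfalso
    have e3 : m ≤ 0 := int_le_of_mul (K := sil + 1) (c := z''.re + z.re + (sil + 1) / 2)
      (by linarith) (by linarith) (by push_cast; linarith)
    have e4 : -m ≤ -1 := int_le_of_mul (K := sil + 1) (c := -(z''.re + z.re + (sil + 1) / 2))
      (by linarith) (by push_cast; linarith) (by push_cast; linarith)
    omega

theorem MidRel.neg {z z'} (h : MidRel z z') : MidRel (-z) (-z') := by
  obtain ⟨a, b, c, n, hn⟩ := h
  refine ⟨?_, ?_, ?_, -n, ?_⟩ <;> simp only [Complex.neg_re, Complex.neg_im] <;>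
      push_cast <;> linarith

theorem Reflects.same {z z' z''} (hv : z ∉ Set.range vertex) (h : Reflects z z')
    (h' : Reflects z z'') : Same z' z'' := by
  obtain ⟨h0, h1, h⟩ := h
  obtain ⟨-, h2, h'⟩ := h'
  have hv' : -z ∉ Set.range vertex := by rwa [neg_mem_vertex]
  rcases h with h | h | h <;> rcases h' with h' | h' | h'
  · exact h.same h1 h2 h'
  · exact h.same_top hv h0 h1 h2 h'
  · exact same_of_neg (h.neg.same_top hv' h0.neg h1.neg h2.neg h')
  · exact (h'.same_top hv h0 h2 h1 h).symm
  · exact h.same h1 h2 h'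
  · have := h.1; have := h'.1; rw [Complex.neg_im] at this; linarith
  · exact (same_of_neg (h'.neg.same_top hv' h0.neg h2.neg h1.neg h)).symm
  · have := h.1; have := h'.1; rw [Complex.neg_im] at *; linarith
  · exact same_of_neg (h.same h1.neg h2.neg h')

/-- The reflection acts by `x ↦ -x` on the horizontal sides. -/
theorem Reflects.of_top {z z'} (hv : z ∉ Set.range vertex) (hz : z.im = sil / 2)
    (h : Reflects z z') : z'.re = -z.re ∧ z'.im = z.im := by
  have g1 := sil_sq
  have g2 := sil_gt
  obtain ⟨h0, h1, h⟩ := h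
  rw [vertex_iff_coord h0] at hv
  push Not at hv
  have hv0 := hv.2 (Or.inl hz)
  have hv1 : z.re < 1 / 2 := lt_of_le_of_ne (by have := h0.2.2.1.2; linarith) hv0.1
  have hv2 : -(1 / 2) < z.re := lt_of_le_of_ne (by have := h0.2.2.2.1; linarith) hv0.2.symm
  rcases h with h | h | h
  · have := h.2.1; linarith
  · obtain ⟨e2, -, ⟨c1, c2⟩, d1, d2⟩ := h1
    rcases h.2 with ⟨c', m, hm⟩ | ⟨c', m, hm⟩ <;> rw [hz] at hm c'
    · obtain rfl : m = -1 := int_eq_of_mul (K := sil + 1) (m := -1) (by linarith)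
        (show m * (sil + 1) = z'.re + z.re - sil - 1 by linarith)
        (by push_cast; linarith) (by push_cast; linarith)
      push_cast at hm
      constructor <;> linarith
    · exfalso
      have e3 : m ≤ -1 := int_le_of_mul (K := sil + 1)
        (c := z'.re + z.re - (sil + 1) / 2)
        (by linarith) (by linarith) (by push_cast; linarith)
      have e4 : -m ≤ 0 := int_le_of_mul (K := sil + 1)
        (c := -(z'.re + z.re - (sil + 1) / 2))
        (by linarith) (by push_cast; linarith) (by push_cast; linarith)
      omega
  · have := h.1; rw [Complex.neg_im] at this; linarith

/-- On the side `0` both relations are `x ↦ -x`. On the other three sides any image of the glued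
point is also an image of `z` itself, so `Reflects.same` applies. -/
theorem Reflects.glue_low {k : Fin 8} (hk : k = 0 ∨ k = 1 ∨ k = 2 ∨ k = 3) {z z' z''}
    (hv : z ∉ Set.range vertex) (hs : z ∈ side k) (h : Reflects z z')
    (h' : Reflects (z + shift k) z'') : Same z' z'' := by
  have g1 := sil_sq
  have g2 := sil_gt
  have h0 := h.1
  have hd := ((mem_side_iff _ _).1 hs).1
  have hv' : z + shift k ∉ Set.range vertex := by rwa [add_shift_mem_vertex_iff hs]
  have hvc := hv
  have hvc' := hv'
  rw [vertex_iff_coord h0] at hvc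
  rw [vertex_iff_coord h'.1] at hvc'
  push Not at hvc hvc'
  rcases hk with rfl | rfl | rfl | rfl
  · rw [dot_zero] at hd
    obtain ⟨e1, e2⟩ := h.of_top hv hd
    have hn := h'.neg
    obtain ⟨e3, e4⟩ := hn.of_top (by rwa [neg_mem_vertex]) (by rw [shift_zero]; simp [hd]; ring)
    rw [shift_zero] at e3 e4
    simp at e3 e4
    refine same_of_side (k := 0) (mem_side_of_coord 0 h.2.1 (by rw [dot_zero, e2, hd])) ?_
    rw [shift_zero]
    apply Complex.ext
    · simp; linarith
    · simp; linarith
  · have hd' : z.re + z.im = (sil + 1) / 2 := by rw [dot_one] at hd; nlinarith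
    have hr : (z + shift 1).re = z.re - (sil + 1) / 2 := by rw [shift_one]; simp; ring
    have hi : (z + shift 1).im = z.im - (sil + 1) / 2 := by rw [shift_one]; simp; ring
    have hz1 : 1 / 2 < z.im := by
      refine lt_of_le_of_ne (by have := h0.1.2; linarith) fun hh => ?_
      exact (hvc.1 (Or.inl (by linarith))).1 hh.symm
    have hz2 : z.im < sil / 2 := by
      refine lt_of_le_of_ne h0.2.1.2 fun hh => ?_
      exact (hvc.2 (Or.inl hh)).1 (by linarith)
    refine h.same hv ⟨h0, h'.2.1, Or.inr (Or.inl ?_)⟩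
    rcases h'.2.2 with h3 | h3 | h3
    · have := h3.1; rw [hi] at this; linarith
    · have := h3.1; rw [hi] at this; linarith
    · refine ⟨hz1.le, ?_⟩
      rcases h3.2 with ⟨c, n, hn⟩ | ⟨c, n, hn⟩ <;>
        simp only [Complex.neg_re, Complex.neg_im, hi, hr] at c hn
      · refine Or.inr ⟨by linarith, -n, ?_⟩
        push_cast; linear_combination -hn - g1
      · refine Or.inl ⟨by linarith, -n, ?_⟩
        push_cast; linear_combination -hn - g1
  · rw [dot_two] at hd
    have hr : (z + shift 2).re = z.re - sil := by rw [shift_two]; simp; ring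
    have hi : (z + shift 2).im = z.im := by rw [shift_two]; simp
    obtain ⟨-, -, ⟨q1, q2⟩, q3, q4⟩ := h0
    have hz1 : z.im < 1 / 2 :=
      lt_of_le_of_ne (by linarith) fun hh => (hvc.1 (Or.inl hd)).1 hh
    have hz2 : -(1 / 2) < z.im :=
      lt_of_le_of_ne (by linarith) fun hh => (hvc.1 (Or.inl hd)).2 hh.symm
    refine h.same hv ⟨h.1, h'.2.1, Or.inl ?_⟩
    rcases h'.2.2 with h3 | h3 | h3
    · obtain ⟨a, b, c, n, hn⟩ := h3
      rw [hi, hr] at hn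
      rw [hi] at c
      exact ⟨hz2.le, hz1.le, c, n + 1, by push_cast; linarith⟩
    · have := h3.1; rw [hi] at this; linarith
    · have := h3.1; rw [Complex.neg_im, hi] at this; linarith
  · have hd' : z.re - z.im = (sil + 1) / 2 := by rw [dot_three] at hd; nlinarith
    have hr : (z + shift 3).re = z.re - (sil + 1) / 2 := by rw [shift_three]; simp; ring
    have hi : (z + shift 3).im = z.im + (sil + 1) / 2 := by rw [shift_three]; simp
    have hz1 : z.im < -(1 / 2) := by
      refine lt_of_le_of_ne (by have := h0.1.2; linarith) fun hh => ?_
      exact (hvc.1 (Or.inl (by linarith))).2 hh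
    have hz2 : -(sil / 2) < z.im := by
      refine lt_of_le_of_ne h0.2.1.1 fun hh => ?_
      exact (hvc.2 (Or.inr hh.symm)).1 (by linarith)
    refine h.same hv ⟨h0, h'.2.1, Or.inr (Or.inr ?_)⟩
    rcases h'.2.2 with h3 | h3 | h3
    · have := h3.2.1; rw [hi] at this; linarith
    · refine ⟨by rw [Complex.neg_im]; linarith, ?_⟩
      rcases h3.2 with ⟨c, n, hn⟩ | ⟨c, n, hn⟩ <;>
        simp only [hi, hr] at c hn <;> simp only [Complex.neg_re, Complex.neg_im]
      · refine Or.inr ⟨by linarith, -(n + 1) + 1 - 1, ?_⟩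
        push_cast; linear_combination -hn - g1
      · refine Or.inl ⟨by linarith, -(n + 1), ?_⟩
        push_cast; linear_combination -hn - g1
    · have := h3.1; rw [Complex.neg_im, hi] at this; linarith

theorem Reflects.glue {k : Fin 8} {z z' z''} (hv : z ∉ Set.range vertex) (hs : z ∈ side k)
    (h : Reflects z z') (h' : Reflects (z + shift k) z'') : Same z' z'' := by
  by_cases hk : k = 0 ∨ k = 1 ∨ k = 2 ∨ k = 3
  · exact h.glue_low hk hv hs h'
  · have hk' : k + 4 = 0 ∨ k + 4 = 1 ∨ k + 4 = 2 ∨ k + 4 = 3 := by omega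
    refine (h'.glue_low hk' ?_ (add_shift_mem_side hs) ?_).symm
    · rwa [add_shift_mem_vertex_iff hs]
    · rw [shift_opp]; simpa using h

/-! Germs of affine functions -/

theorem eventually_affine_lt {a : ℝ} (b : ℝ) {c : ℝ} (h : a < c) :
    ∀ᶠ s : ℝ in 𝓝[≥] 0, a + s * b < c := by
  have : Tendsto (fun s : ℝ => a + s * b) (𝓝[≥] 0) (𝓝 (a + 0 * b)) :=
    (Continuous.tendsto (by fun_prop) 0).mono_left nhdsWithin_le_nhds
  simp only [zero_mul, add_zero] at this
  exact this.eventually_lt_const h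

theorem eventually_affine_gt {a : ℝ} (b : ℝ) {c : ℝ} (h : c < a) :
    ∀ᶠ s : ℝ in 𝓝[≥] 0, c < a + s * b := by
  have := eventually_affine_lt (-b) (neg_lt_neg h)
  filter_upwards [this] with s hs; linarith

theorem eventually_affine_sign (a b c : ℝ) :
    (∀ᶠ s : ℝ in 𝓝[≥] 0, a + s * b ≤ c) ∨ (∀ᶠ s : ℝ in 𝓝[≥] 0, c ≤ a + s * b) := by
  rcases lt_trichotomy a c with h | rfl | h
  · left; exact (eventually_affine_lt b h).mono fun s hs => hs.le
  · rcases le_total b 0 with hb | hb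
    · left; filter_upwards [self_mem_nhdsWithin] with s hs
      rw [Set.mem_Ici] at hs; nlinarith
    · right; filter_upwards [self_mem_nhdsWithin] with s hs
      rw [Set.mem_Ici] at hs; nlinarith
  · right; exact (eventually_affine_gt b h).mono fun s hs => hs.le

/-- The ordinary floor of the initial value works, except when that value is a multiple of `K` and
the function decreases; then the interval below is taken. -/
theorem eventually_affine_floor (a b : ℝ) {K : ℝ} (hK : 0 < K) :
    ∃ l : ℤ, ∀ᶠ s : ℝ in 𝓝[≥] 0, l * K ≤ a + s * b ∧ a + s * b ≤ (l + 1) * K := by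
  have h1 : (⌊a / K⌋ : ℝ) * K ≤ a := by
    have := Int.floor_le (a / K); rwa [le_div_iff₀ hK] at this
  have h2 : a < (⌊a / K⌋ + 1) * K := by
    have := Int.lt_floor_add_one (a / K); rwa [div_lt_iff₀ hK] at this
  rcases eventually_affine_sign a b (⌊a / K⌋ * K) with h | h
  · refine ⟨⌊a / K⌋ - 1, ?_⟩
    have h3 : ((⌊a / K⌋ : ℝ) - 1) * K < a := by nlinarith
    filter_upwards [h, eventually_affine_gt b h3] with s hs hs'
    push_cast
    exact ⟨hs'.le, by linarith⟩
  · refine ⟨⌊a / K⌋, ?_⟩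
    filter_upwards [h, eventually_affine_lt b h2] with s hs hs'
    exact ⟨hs, hs'.le⟩

theorem germ_re (q v : ℂ) (s : ℝ) : (q + s * v).re = q.re + s * v.re := by simp
theorem germ_im (q v : ℂ) (s : ℝ) : (q + s * v).im = q.im + s * v.im := by simp

/-- The integers `l` and `m` locate the sheared germ relative to the slanted sides, through the two
coordinates `x - y` and `x + y`. If `l = m + 1` the image fits in the upper trapezoid, and if `l =
m` in the lower one. -/
theorem germ_top {q v : ℂ} (hoct : ∀ᶠ s : ℝ in 𝓝[≥] 0, InOct (q + s * v))
    (htop : ∀ᶠ s : ℝ in 𝓝[≥] 0, 1 / 2 ≤ (q + s * v).im) :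
    ∃ q', ∀ᶠ s : ℝ in 𝓝[≥] 0, Reflects (q + s * v) (q' + s * lin γ v) := by
  have g1 := sil_sq
  have g2 := sil_gt
  set A := -q.re + 2 * sil * q.im - sil with hA
  set B := -v.re + 2 * sil * v.im with hB
  obtain ⟨m, hm⟩ := eventually_affine_floor (A + q.im - (sil + 1) / 2) (B + v.im)
    (show 0 < sil + 1 by linarith)
  obtain ⟨l, hl⟩ := eventually_affine_floor (A - q.im + (sil + 1) / 2) (B - v.im)
    (show 0 < sil + 1 by linarith)
  have hlm : l = m ∨ l = m + 1 := by
    have e1 := hm.self_of_nhdsWithin (by simp)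
    have e2 := hl.self_of_nhdsWithin (by simp)
    have e3 := (hoct.self_of_nhdsWithin (by simp)).2.1.2
    have e4 := htop.self_of_nhdsWithin (by simp)
    simp only [Complex.ofReal_zero, zero_mul, add_zero] at e1 e2 e3 e4
    have e5 : m - l ≤ 0 := int_le_of_mul (K := sil + 1) (c := sil) (by linarith)
      (by push_cast; linarith) (by push_cast; linarith)
    have e6 : l - m ≤ 1 := int_le_of_mul (K := sil + 1) (c := sil + sil + 1) (by linarith)
      (by push_cast; linarith) (by push_cast; linarith)
    omega
  rcases hlm with rfl | rfl
  · refine ⟨⟨A - (sil + 1) / 2 - l * (sil + 1), q.im - (sil + 1) / 2⟩, ?_⟩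
    filter_upwards [hoct, htop, hl, hm] with s h1 h2 h3 h4
    have h5 := h1.2.1
    rw [germ_im] at h2 h5
    refine ⟨h1, ?_, Or.inr (Or.inl ⟨by rw [germ_im]; exact h2, Or.inr ⟨?_, -l, ?_⟩⟩)⟩
    · simp only [InOct, germ_im, germ_re, lin_γ_re, lin_γ_im, ← hB]
      refine ⟨⟨?_, ?_⟩, ⟨?_, ?_⟩, ⟨?_, ?_⟩, ?_, ?_⟩ <;> linarith
    · simp only [germ_im, lin_γ_im]; ring
    · simp only [germ_im, germ_re, lin_γ_re, hA]; push_cast; ring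
  · refine ⟨⟨A - (m + 1) * (sil + 1), q.im⟩, ?_⟩
    filter_upwards [hoct, htop, hl, hm] with s h1 h2 h3 h4
    have h5 := h1.2.1
    push_cast at h3
    rw [germ_im] at h2 h5
    refine ⟨h1, ?_, Or.inr (Or.inl ⟨by rw [germ_im]; exact h2, Or.inl ⟨?_, -(m + 1), ?_⟩⟩)⟩
    · simp only [InOct, germ_im, germ_re, lin_γ_re, lin_γ_im, ← hB]
      refine ⟨⟨?_, ?_⟩, ⟨?_, ?_⟩, ⟨?_, ?_⟩, ?_, ?_⟩ <;> linarith
    · simp only [germ_im, lin_γ_im]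
    · simp only [germ_im, germ_re, lin_γ_re, hA]; push_cast; ring

theorem germ_mid {q v : ℂ} (hoct : ∀ᶠ s : ℝ in 𝓝[≥] 0, InOct (q + s * v))
    (htop : ∀ᶠ s : ℝ in 𝓝[≥] 0, (q + s * v).im ≤ 1 / 2)
    (hbot : ∀ᶠ s : ℝ in 𝓝[≥] 0, -(1 / 2) ≤ (q + s * v).im) :
    ∃ q', ∀ᶠ s : ℝ in 𝓝[≥] 0, Reflects (q + s * v) (q' + s * lin γ v) := by
  have g1 := sil_sq
  have g2 := sil_gt
  set A := -q.re + 2 * sil * q.im with hA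
  set B := -v.re + 2 * sil * v.im with hB
  obtain ⟨l, hl⟩ := eventually_affine_floor (A + sil / 2) B (show 0 < sil by linarith)
  refine ⟨⟨A - l * sil, q.im⟩, ?_⟩
  filter_upwards [hoct, htop, hbot, hl] with s h1 h2 h3 h4
  refine ⟨h1, ?_, Or.inl ⟨h3, h2, ?_, -l, ?_⟩⟩
  · rw [germ_im] at h2 h3
    simp only [InOct, germ_im, germ_re, lin_γ_re, lin_γ_im, ← hB]
    refine ⟨⟨?_, ?_⟩, ⟨?_, ?_⟩, ⟨?_, ?_⟩, ?_, ?_⟩ <;> linarith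
  · simp only [germ_im, lin_γ_im]
  · simp only [germ_im, germ_re, lin_γ_re, hA]; push_cast; ring

/-- For a short time a germ stays in one of the three horizontal bands; the lower band reduces to
the upper one by the central symmetry. -/
theorem isAffine_γ : IsAffine γ := by
  refine isAffine_of_relation (D := Reflects) (fun z z' h => (mem_octagon_iff z).2 h.1)
    (fun z z' h => h.symm) (fun z z' h hv => h.map_vertex hv) (fun z z' z'' hv h h' => h.same hv h')
    (fun k z z' z'' hv hs h h' => h.glue hv hs h') ?_
  intro q v _ hev
  have hoct : ∀ᶠ s : ℝ in 𝓝[≥] 0, InOct (q + s * v) :=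
    hev.mono fun s hs => (mem_octagon_iff _).1 hs
  rcases eventually_affine_sign q.im v.im (1 / 2) with h1 | h1
  · rcases eventually_affine_sign q.im v.im (-(1 / 2)) with h2 | h2
    · obtain ⟨q', hq'⟩ := germ_top (q := -q) (v := -v)
        (hoct.mono fun s hs => by have := hs.neg; rwa [neg_add, ← mul_neg] at this)
        (h2.mono fun s hs => by rw [germ_im, Complex.neg_im, Complex.neg_im]; linarith)
      refine ⟨-q', hq'.mono fun s hs => ?_⟩
      have := hs.neg
      rw [lin_neg] at this
      convert this using 1 <;> ring
    · exact germ_mid hoct (h1.mono fun s hs => by rw [germ_im]; exact hs)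
        (h2.mono fun s hs => by rw [germ_im]; exact hs)
  · exact germ_top hoct (h1.mono fun s hs => by rw [germ_im]; exact hs)

/-! ### Completely periodic directions -/

/-- All trajectories with velocity `v` are periodic. -/
def CompletelyPeriodic (v : ℂ) : Prop := ∀ τ, WeakLinear τ v → IsPeriodicTrajectory τ

theorem IsAffine.completelyPeriodic {A v} (hA : IsAffine A) (h : CompletelyPeriodic (lin A v)) :
    CompletelyPeriodic v := by
  obtain ⟨Φ, hinj, hΦ⟩ := hA.exists_map
  intro τ hτ
  obtain ⟨T, hT, hper⟩ := h _ (hΦ τ v hτ)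
  exact ⟨T, hT, fun t => hinj (hper t)⟩

theorem finite_int_mul_bounded {a : ℝ} (ha : a ≠ 0) (b C : ℝ) :
    {n : ℤ | |b - n * a| ≤ C}.Finite := by
  have h1 : 0 < |a| := abs_pos.2 ha
  obtain ⟨N, hN⟩ := exists_nat_gt ((|b| + C) / |a|)
  rw [div_lt_iff₀ h1] at hN
  refine (Set.finite_Icc (-(N : ℤ)) N).subset fun n hn => ?_
  have h2 : |(n : ℝ) * a| ≤ |b| + C := by
    have := abs_sub_abs_le_abs_sub ((n : ℝ) * a) b
    rw [abs_sub_comm] at this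
    have : |b - n * a| ≤ C := hn
    linarith
  rw [abs_mul] at h2
  have h3 : |(n : ℝ)| < N := lt_of_mul_lt_mul_right (lt_of_le_of_lt h2 hN) h1.le
  rw [abs_lt] at h3
  constructor
  · have : -(N : ℤ) < n := by exact_mod_cast h3.1
    exact this.le
  · have : n < (N : ℤ) := by exact_mod_cast h3.2
    exact this.le

theorem finite_translates {κ : ℂ} (hκ : κ ≠ 0) (w : ℂ) :
    {z : ℂ | z ∈ octagon ∧ ∃ n : ℤ, z = w - n * κ}.Finite := by
  have hfin : {n : ℤ | w - n * κ ∈ octagon}.Finite := by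
    by_cases hr : κ.re = 0
    · have hi : κ.im ≠ 0 := fun h => hκ (Complex.ext hr h)
      refine (finite_int_mul_bounded hi w.im (sil / 2)).subset fun n hn => ?_
      have := ((mem_octagon_iff _).1 hn).2.1
      simp only [Complex.sub_im, Complex.mul_im, Complex.intCast_re, Complex.intCast_im,
        zero_mul, add_zero] at this
      exact abs_le.2 this
    · refine (finite_int_mul_bounded hr w.re (sil / 2)).subset fun n hn => ?_
      have := ((mem_octagon_iff _).1 hn).1
      simp only [Complex.sub_re, Complex.mul_re, Complex.intCast_re, Complex.intCast_im,
        zero_mul, sub_zero] at this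
      exact abs_le.2 this
  refine (hfin.image fun n : ℤ => w - n * κ).subset ?_
  rintro _ ⟨h, n, rfl⟩
  exact ⟨n, h, rfl⟩

/-- A trajectory is periodic if it only meets sides whose translations are `-d`, `κ - d` at the
height of the starting point, and `d`, `d - κ` at the height of its translate by `-d`. -/
theorem periodic_of_cylinder {τ : ℝ → Surface} {v q₀ κ d : ℂ} {r : ℝ} {f : ℂ → ℝ}
    (hτ : WeakLinear τ v) (h0 : Represents q₀ (τ 0)) (hv : v ≠ 0) (hr : r ≠ 0) (hκ : κ = r * v)
    (hf : ∀ s : ℝ, ∀ w l, f (w + s * v - l) = f w - f l) (hf0 : f 0 = 0)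
    (H1 : ∀ j q, q ∈ side j → q ∉ Set.range vertex → f q = f q₀ →
      shift j = -d ∨ shift j = κ - d)
    (H2 : ∀ j q, q ∈ side j → q ∉ Set.range vertex → f q = f q₀ - f d →
      shift j = d ∨ shift j = d - κ) : IsPeriodicTrajectory τ := by
  have hκ0 : κ ≠ 0 := by rw [hκ]; exact mul_ne_zero (by exact_mod_cast hr) hv
  have hfm : ∀ w, f (-w) = - f w := by
    intro w; have := hf 0 0 w; simpa [hf0] using this
  have hfs : ∀ s : ℝ, f (s * v) = 0 := by
    intro s; have := hf s 0 0; simpa [hf0] using this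
  have hfn : ∀ n : ℤ, f (n * κ) = 0 := by
    intro n
    rw [hκ, ← mul_assoc, ← Complex.ofReal_intCast, ← Complex.ofReal_mul]; exact hfs _
  have hfdn : ∀ n : ℤ, f (d + n * κ) = f d := by
    intro n
    have := hf (n * r) d 0
    rw [hf0, sub_zero, sub_zero] at this
    rw [← this, hκ]; push_cast; rw [mul_assoc]
  -- The two families of translations correspond to the two heights of the cylinder in the octagon;
  -- each gluing passes from one family to the other.
  have key : ∀ t : ℝ, 0 ≤ t → ∃ l ∈ {l : ℂ | ∃ n : ℤ, l = n * κ ∨ l = d + n * κ},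
      Represents (q₀ + t * v - l) (τ t) := by
    intro t ht
    refine hτ.develop (X := {l : ℂ | ∃ n : ℤ, l = n * κ ∨ l = d + n * κ}) h0
      ⟨0, Or.inl (by simp)⟩ ?_ t ht le_rfl
    rintro s - - l ⟨n, rfl | rfl⟩ j hj hjv - -
    · rcases H1 j _ hj hjv (by rw [hf, hfn, sub_zero]) with h | h
      · exact ⟨n, Or.inr (by rw [h]; ring)⟩
      · exact ⟨n - 1, Or.inr (by rw [h]; push_cast; ring)⟩
    · rcases H2 j _ hj hjv (by rw [hf, hfdn]) with h | h
      · exact ⟨n, Or.inl (by rw [h]; ring)⟩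
      · exact ⟨n + 1, Or.inl (by rw [h]; push_cast; ring)⟩
  -- At multiples of the time `|r|` the displacement is an integral multiple of `κ`. The positions
  -- then range over finitely many translates, and two of them coincide by the pigeonhole principle.
  obtain ⟨e, he⟩ : ∃ e : ℤ, (|r| : ℝ) * v = e * κ := by
    rcases abs_choice r with h | h
    · exact ⟨1, by rw [h, hκ]; simp⟩
    · exact ⟨-1, by rw [h, hκ]; push_cast; ring⟩
  have key' : ∀ i : ℕ, ∃ z, z ∈ ({z : ℂ | z ∈ octagon ∧ ∃ n : ℤ, z = q₀ - n * κ} ∪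
      {z : ℂ | z ∈ octagon ∧ ∃ n : ℤ, z = q₀ - d - n * κ}) ∧ Represents z (τ (i * |r|)) := by
    intro i
    have hi : ((i * |r| : ℝ) : ℂ) * v = (i * e : ℤ) * κ := by
      push_cast; rw [mul_assoc, he]; ring
    obtain ⟨l, ⟨n, rfl | rfl⟩, hz⟩ := key (i * |r|) (by positivity)
    · refine ⟨_, Or.inl ⟨hz.mem, n - i * e, ?_⟩, hz⟩
      rw [hi]; push_cast; ring
    · refine ⟨_, Or.inr ⟨hz.mem, n - i * e, ?_⟩, hz⟩
      rw [hi]; push_cast; ring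
  choose z hz hzr using key'
  obtain ⟨i, -, j, -, hij, hzz⟩ := Set.infinite_univ.exists_ne_map_eq_of_mapsTo
    (f := z) (fun i _ => hz i) ((finite_translates hκ0 q₀).union (finite_translates hκ0 (q₀ - d)))
  have hτe : τ (i * |r|) = τ (j * |r|) := by
    have h1 := hzr i
    rw [hzz] at h1
    exact h1.eq (hzr j)
  have hrpos : 0 < |r| := abs_pos.2 hr
  rcases lt_or_gt_of_ne hij with h | h
  · refine hτ.periodic_of_eq ?_ hτe
    have : (i : ℝ) < j := by exact_mod_cast h
    nlinarith
  · refine hτ.periodic_of_eq ?_ hτe.symm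
    have : (j : ℝ) < i := by exact_mod_cast h
    nlinarith

theorem side_coord {j q} (h : q ∈ side j) (hv : q ∉ Set.range vertex) :
    (shift j = ⟨0, -sil⟩ ∧ q.im = sil / 2 ∧ -(1 / 2) < q.re ∧ q.re < 1 / 2) ∨
    (shift j = ⟨-((sil + 1) / 2), -((sil + 1) / 2)⟩ ∧ q.re = (sil + 1) / 2 - q.im ∧
      1 / 2 < q.im ∧ q.im < sil / 2) ∨
    (shift j = ⟨-sil, 0⟩ ∧ q.re = sil / 2 ∧ -(1 / 2) < q.im ∧ q.im < 1 / 2) ∨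
    (shift j = ⟨-((sil + 1) / 2), (sil + 1) / 2⟩ ∧ q.re = (sil + 1) / 2 + q.im ∧
      -(sil / 2) < q.im ∧ q.im < -(1 / 2)) ∨
    (shift j = ⟨0, sil⟩ ∧ q.im = -(sil / 2) ∧ -(1 / 2) < q.re ∧ q.re < 1 / 2) ∨
    (shift j = ⟨(sil + 1) / 2, (sil + 1) / 2⟩ ∧ q.re = -((sil + 1) / 2) - q.im ∧
      -(sil / 2) < q.im ∧ q.im < -(1 / 2)) ∨
    (shift j = ⟨sil, 0⟩ ∧ q.re = -(sil / 2) ∧ -(1 / 2) < q.im ∧ q.im < 1 / 2) ∨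
    (shift j = ⟨(sil + 1) / 2, -((sil + 1) / 2)⟩ ∧ q.re = -((sil + 1) / 2) + q.im ∧
      1 / 2 < q.im ∧ q.im < sil / 2) := by
  have g1 := sil_sq
  have g2 := sil_gt
  have low : ∀ {j : Fin 8} {q : ℂ}, j = 0 ∨ j = 1 ∨ j = 2 ∨ j = 3 → q ∈ side j →
      q ∉ Set.range vertex →
      (shift j = ⟨0, -sil⟩ ∧ q.im = sil / 2 ∧ -(1 / 2) < q.re ∧ q.re < 1 / 2) ∨
      (shift j = ⟨-((sil + 1) / 2), -((sil + 1) / 2)⟩ ∧ q.re = (sil + 1) / 2 - q.im ∧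
        1 / 2 < q.im ∧ q.im < sil / 2) ∨
      (shift j = ⟨-sil, 0⟩ ∧ q.re = sil / 2 ∧ -(1 / 2) < q.im ∧ q.im < 1 / 2) ∨
      (shift j = ⟨-((sil + 1) / 2), (sil + 1) / 2⟩ ∧ q.re = (sil + 1) / 2 + q.im ∧
        -(sil / 2) < q.im ∧ q.im < -(1 / 2)) := by
    intro j q hj h hv
    have ho := (mem_octagon_iff _).1 (side_subset h)
    have hd := ((mem_side_iff _ _).1 h).1
    rw [vertex_iff_coord ho] at hv
    push Not at hv
    obtain ⟨⟨a1, a2⟩, ⟨b1, b2⟩, ⟨c1, c2⟩, d1, d2⟩ := ho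
    rcases hj with rfl | rfl | rfl | rfl
    · rw [dot_zero] at hd
      have h1 := hv.2 (Or.inl hd)
      refine Or.inl ⟨shift_zero, hd, lt_of_le_of_ne (by linarith) h1.2.symm,
        lt_of_le_of_ne (by linarith) h1.1⟩
    · have hd' : q.re = (sil + 1) / 2 - q.im := by rw [dot_one] at hd; nlinarith
      refine Or.inr (Or.inl ⟨shift_one, hd', lt_of_le_of_ne (by linarith) fun h => ?_,
        lt_of_le_of_ne (by linarith) fun h => ?_⟩)
      · exact (hv.1 (Or.inl (by linarith))).1 h.symm
      · exact (hv.2 (Or.inl h)).1 (by linarith)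
    · rw [dot_two] at hd
      have h1 := hv.1 (Or.inl hd)
      refine Or.inr (Or.inr (Or.inl ⟨shift_two, hd, lt_of_le_of_ne (by linarith) h1.2.symm,
        lt_of_le_of_ne (by linarith) h1.1⟩))
    · have hd' : q.re = (sil + 1) / 2 + q.im := by rw [dot_three] at hd; nlinarith
      refine Or.inr (Or.inr (Or.inr ⟨shift_three, hd', lt_of_le_of_ne (by linarith) fun h => ?_,
        lt_of_le_of_ne (by linarith) fun h => ?_⟩))
      · exact (hv.2 (Or.inr h.symm)).1 (by linarith)
      · exact (hv.1 (Or.inl (by linarith))).2 h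
  by_cases hj : j = 0 ∨ j = 1 ∨ j = 2 ∨ j = 3
  · rcases low hj h hv with h | h | h | h
    · exact Or.inl h
    · exact Or.inr (Or.inl h)
    · exact Or.inr (Or.inr (Or.inl h))
    · exact Or.inr (Or.inr (Or.inr (Or.inl h)))
  · have hj' : j + 4 = 0 ∨ j + 4 = 1 ∨ j + 4 = 2 ∨ j + 4 = 3 := by omega
    have := low hj' (neg_mem_side.2 h) (by rwa [neg_mem_vertex])
    simp only [shift_opp, Complex.neg_re, Complex.neg_im, neg_eq_iff_eq_neg] at this
    have hneg : ∀ a b : ℝ, -(⟨a, b⟩ : ℂ) = ⟨-a, -b⟩ := fun a b => rfl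
    simp only [hneg, neg_neg, neg_zero] at this
    rcases this with ⟨a, b, c, d⟩ | ⟨a, b, c, d⟩ | ⟨a, b, c, d⟩ | ⟨a, b, c, d⟩
    · exact Or.inr (Or.inr (Or.inr (Or.inr (Or.inl ⟨a, by linarith, by linarith, by linarith⟩))))
    · exact Or.inr (Or.inr (Or.inr (Or.inr (Or.inr (Or.inl
        ⟨a, by linarith, by linarith, by linarith⟩)))))
    · exact Or.inr (Or.inr (Or.inr (Or.inr (Or.inr (Or.inr (Or.inl
        ⟨a, by linarith, by linarith, by linarith⟩))))))
    · exact Or.inr (Or.inr (Or.inr (Or.inr (Or.inr (Or.inr (Or.inr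
        ⟨a, by linarith, by linarith, by linarith⟩))))))

theorem complex_mk_congr {a b c d : ℝ} (h1 : a = c) (h2 : b = d) : (⟨a, b⟩ : ℂ) = ⟨c, d⟩ := by
  rw [h1, h2]

theorem completelyPeriodic_horizontal {v : ℂ} (hv : v ≠ 0) (hi : v.im = 0) :
    CompletelyPeriodic v := by
  have g1 := sil_sq
  have g2 := sil_gt
  intro τ hτ
  obtain ⟨q₀, h0⟩ := exists_represents (τ 0)
  have hre : v.re ≠ 0 := fun h => hv (Complex.ext h hi)
  have cyl : ∀ (x d1 d2 : ℝ), x ≠ 0 →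
      (∀ j q, q ∈ side j → q ∉ Set.range vertex → q.im = q₀.im →
        shift j = ⟨-d1, -d2⟩ ∨ shift j = ⟨x - d1, -d2⟩) →
      (∀ j q, q ∈ side j → q ∉ Set.range vertex → q.im = q₀.im - d2 →
        shift j = ⟨d1, d2⟩ ∨ shift j = ⟨d1 - x, d2⟩) → IsPeriodicTrajectory τ := by
    intro x d1 d2 hx H1 H2
    refine periodic_of_cylinder (κ := ⟨x, 0⟩) (d := ⟨d1, d2⟩) (r := x / v.re) (f := Complex.im)
      hτ h0 hv (div_ne_zero hx hre) ?_ ?_ rfl ?_ ?_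
    · apply Complex.ext
      · simp [hi, hre]
      · simp [hi]
    · intro s w l; simp [hi]
    · intro j q h1 h2 h3
      rcases H1 j q h1 h2 h3 with h | h
      · left; rw [h]; rfl
      · right; rw [h]; apply Complex.ext <;> simp
    · intro j q h1 h2 h3
      rcases H2 j q h1 h2 h3 with h | h
      · left; rw [h]
      · right; rw [h]; apply Complex.ext <;> simp
  have ho := ((mem_octagon_iff _).1 h0.mem).2.1
  rcases lt_trichotomy q₀.im (1 / 2) with h1 | h1 | h1
  · rcases lt_trichotomy q₀.im (-(1 / 2)) with h2 | h2 | h2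
    · rcases ho.1.eq_or_lt with h3 | h3
      -- At the height of the bottom side only the gluing of the horizontal sides can occur; `κ` is
      -- then an arbitrary horizontal vector.
      · refine cyl 1 0 (-sil) one_ne_zero ?_ ?_ <;> intro j q hq hqv hf <;>
          rcases side_coord hq hqv with h | h | h | h | h | h | h | h <;>
          obtain ⟨hs, e1, e2, e3⟩ := h <;> first
          | (exfalso; linarith)
          | exact Or.inl (hs.trans (complex_mk_congr (by linarith) (by linarith)))
      · refine cyl (-(sil + 1)) (-((sil + 1) / 2)) (-((sil + 1) / 2)) (by linarith) ?_ ?_ <;>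
          intro j q hq hqv hf <;>
          rcases side_coord hq hqv with h | h | h | h | h | h | h | h <;>
          obtain ⟨hs, e1, e2, e3⟩ := h <;>
          first
          | (exfalso; linarith)
          | exact Or.inl (hs.trans (complex_mk_congr (by linarith) (by linarith)))
          | exact Or.inr (hs.trans (complex_mk_congr (by linarith) (by linarith)))
    · refine cyl 1 0 0 one_ne_zero ?_ ?_ <;> intro j q hq hqv hf <;>
          rcases side_coord hq hqv with h | h | h | h | h | h | h | h <;>
          obtain ⟨hs, e1, e2, e3⟩ := h <;> exfalso <;> linarith
    -- The choice `d = sil`, `κ = 2 * sil` covers the translations by `sil` and by `-sil`, whichever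
    -- the sense of travel.
    · refine cyl (2 * sil) sil 0 (by linarith) ?_ ?_ <;>
          intro j q hq hqv hf <;>
          rcases side_coord hq hqv with h | h | h | h | h | h | h | h <;>
          obtain ⟨hs, e1, e2, e3⟩ := h <;>
          first
          | (exfalso; linarith)
          | exact Or.inl (hs.trans (complex_mk_congr (by linarith) (by linarith)))
          | exact Or.inr (hs.trans (complex_mk_congr (by linarith) (by linarith)))
  · refine cyl 1 0 0 one_ne_zero ?_ ?_ <;> intro j q hq hqv hf <;>
          rcases side_coord hq hqv with h | h | h | h | h | h | h | h <;>
          obtain ⟨hs, e1, e2, e3⟩ := h <;> exfalso <;> linarith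
  · rcases ho.2.eq_or_lt with h3 | h3
    · refine cyl 1 0 sil one_ne_zero ?_ ?_ <;> intro j q hq hqv hf <;>
          rcases side_coord hq hqv with h | h | h | h | h | h | h | h <;>
          obtain ⟨hs, e1, e2, e3⟩ := h <;> first
          | (exfalso; linarith)
          | exact Or.inl (hs.trans (complex_mk_congr (by linarith) (by linarith)))
    · refine cyl (sil + 1) ((sil + 1) / 2) ((sil + 1) / 2) (by linarith) ?_ ?_ <;>
          intro j q hq hqv hf <;>
          rcases side_coord hq hqv with h | h | h | h | h | h | h | h <;>
          obtain ⟨hs, e1, e2, e3⟩ := h <;>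
          first
          | (exfalso; linarith)
          | exact Or.inl (hs.trans (complex_mk_congr (by linarith) (by linarith)))
          | exact Or.inr (hs.trans (complex_mk_congr (by linarith) (by linarith)))

/-- The sides that are met at a given height above the direction `π / 8`. -/
theorem side_height {j q} (h : q ∈ side j) (hv : q ∉ Set.range vertex) :
    (sil < sil * q.im - q.re ∧ sil * q.im - q.re < sil + 1 ∧
      (shift j = ⟨0, -sil⟩ ∨ shift j = ⟨(sil + 1) / 2, -((sil + 1) / 2)⟩)) ∨
    (0 < sil * q.im - q.re ∧ sil * q.im - q.re < sil ∧
      (shift j = ⟨-((sil + 1) / 2), -((sil + 1) / 2)⟩ ∨ shift j = ⟨sil, 0⟩)) ∨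
    (-sil < sil * q.im - q.re ∧ sil * q.im - q.re < 0 ∧
      (shift j = ⟨(sil + 1) / 2, (sil + 1) / 2⟩ ∨ shift j = ⟨-sil, 0⟩)) ∨
    (-(sil + 1) < sil * q.im - q.re ∧ sil * q.im - q.re < -sil ∧
      (shift j = ⟨0, sil⟩ ∨ shift j = ⟨-((sil + 1) / 2), (sil + 1) / 2⟩)) := by
  have g1 := sil_sq
  have g2 := sil_gt
  rcases side_coord h hv with h | h | h | h | h | h | h | h <;> obtain ⟨hs, e1, e2, e3⟩ := h
  · exact Or.inl ⟨by rw [e1]; nlinarith, by rw [e1]; nlinarith, Or.inl hs⟩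
  · exact Or.inr (Or.inl ⟨by rw [e1]; nlinarith, by rw [e1]; nlinarith, Or.inl hs⟩)
  · exact Or.inr (Or.inr (Or.inl ⟨by rw [e1]; nlinarith, by rw [e1]; nlinarith, Or.inr hs⟩))
  · exact Or.inr (Or.inr (Or.inr ⟨by rw [e1]; nlinarith, by rw [e1]; nlinarith, Or.inr hs⟩))
  · exact Or.inr (Or.inr (Or.inr ⟨by rw [e1]; nlinarith, by rw [e1]; nlinarith, Or.inl hs⟩))
  · exact Or.inr (Or.inr (Or.inl ⟨by rw [e1]; nlinarith, by rw [e1]; nlinarith, Or.inl hs⟩))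
  · exact Or.inr (Or.inl ⟨by rw [e1]; nlinarith, by rw [e1]; nlinarith, Or.inr hs⟩)
  · exact Or.inl ⟨by rw [e1]; nlinarith, by rw [e1]; nlinarith, Or.inr hs⟩

/-- The height `sil * y - x` is constant along `v`. The four bands of heights are paired by the
gluings into two cylinders, the outer bands by `d = ±(0, sil)` and the inner ones by multiples of
`(1, 1)`. -/
theorem completelyPeriodic_diagonal {v : ℂ} (hv : v ≠ 0) (hi : v.re = sil * v.im) :
    CompletelyPeriodic v := by
  have g1 := sil_sq
  have g2 := sil_gt
  intro τ hτ
  obtain ⟨q₀, h0⟩ := exists_represents (τ 0)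
  have him : v.im ≠ 0 := fun h => hv (Complex.ext (by rw [hi, h]; simp) h)
  have cyl : ∀ (x d1 d2 : ℝ), x ≠ 0 →
      (∀ j q, q ∈ side j → q ∉ Set.range vertex → sil * q.im - q.re = sil * q₀.im - q₀.re →
        shift j = ⟨-d1, -d2⟩ ∨ shift j = ⟨sil * x - d1, x - d2⟩) →
      (∀ j q, q ∈ side j → q ∉ Set.range vertex →
        sil * q.im - q.re = sil * q₀.im - q₀.re - (sil * d2 - d1) →
        shift j = ⟨d1, d2⟩ ∨ shift j = ⟨d1 - sil * x, d2 - x⟩) → IsPeriodicTrajectory τ := by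
    intro x d1 d2 hx H1 H2
    refine periodic_of_cylinder (κ := ⟨sil * x, x⟩) (d := ⟨d1, d2⟩) (r := x / v.im)
      (f := fun z => sil * z.im - z.re) hτ h0 hv (div_ne_zero hx him) ?_ ?_ (by simp) ?_ ?_
    · apply Complex.ext
      · simp [hi]; field_simp
      · simp [him]
    · intro s w l; simp [hi]; ring
    · intro j q h1 h2 h3
      rcases H1 j q h1 h2 h3 with h | h
      · left; rw [h]; rfl
      · right; rw [h]; apply Complex.ext <;> simp
    · intro j q h1 h2 h3
      rcases H2 j q h1 h2 h3 with h | h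
      · left; rw [h]
      · right; rw [h]; apply Complex.ext <;> simp
  obtain ⟨y, hy⟩ : ∃ y, y = sil * q₀.im - q₀.re := ⟨_, rfl⟩
  rw [← hy] at cyl
  have i1 : sil * (sil / 2) - ((sil + 1) / 2 + (sil + 1) / 2) + 1 / 2 = 0 := by linarith
  have triv : (∀ j q, q ∈ side j → q ∉ Set.range vertex → sil * q.im - q.re ≠ y) →
      IsPeriodicTrajectory τ := by
    intro h
    refine cyl 1 0 0 one_ne_zero ?_ ?_ <;> intro j q hq hqv hf
    · exact absurd hf (h j q hq hqv)
    · exact absurd (by linarith) (h j q hq hqv)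
  by_cases hy1 : sil < y ∧ y < sil + 1
  · refine cyl ((sil - 1) / 2) 0 sil (by linarith) ?_ ?_ <;> intro j q hq hqv hf <;>
      rcases side_height hq hqv with ⟨e1, e2, h⟩ | ⟨e1, e2, h⟩ | ⟨e1, e2, h⟩ | ⟨e1, e2, h⟩ <;>
      first
      | (exfalso; linarith)
      | (rcases h with h | h <;> rw [h]
         · left; apply complex_mk_congr <;> linarith
         · right; apply complex_mk_congr <;> linarith)
  by_cases hy2 : 0 < y ∧ y < sil
  · refine cyl ((sil + 1) / 2) ((sil + 1) / 2) ((sil + 1) / 2) (by linarith) ?_ ?_ <;>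
      intro j q hq hqv hf <;>
      rcases side_height hq hqv with ⟨e1, e2, h⟩ | ⟨e1, e2, h⟩ | ⟨e1, e2, h⟩ | ⟨e1, e2, h⟩ <;>
      first
      | (exfalso; linarith)
      | (rcases h with h | h <;> rw [h]
         · left; apply complex_mk_congr <;> linarith
         · right; apply complex_mk_congr <;> linarith)
  by_cases hy3 : -sil < y ∧ y < 0
  · refine cyl (-((sil + 1) / 2)) (-((sil + 1) / 2)) (-((sil + 1) / 2)) (by linarith) ?_ ?_ <;>
      intro j q hq hqv hf <;>
      rcases side_height hq hqv with ⟨e1, e2, h⟩ | ⟨e1, e2, h⟩ | ⟨e1, e2, h⟩ | ⟨e1, e2, h⟩ <;>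
      first
      | (exfalso; linarith)
      | (rcases h with h | h <;> rw [h]
         · left; apply complex_mk_congr <;> linarith
         · right; apply complex_mk_congr <;> linarith)
  by_cases hy4 : -(sil + 1) < y ∧ y < -sil
  · refine cyl (-((sil - 1) / 2)) 0 (-sil) (by linarith) ?_ ?_ <;> intro j q hq hqv hf <;>
      rcases side_height hq hqv with ⟨e1, e2, h⟩ | ⟨e1, e2, h⟩ | ⟨e1, e2, h⟩ | ⟨e1, e2, h⟩ <;>
      first
      | (exfalso; linarith)
      | (rcases h with h | h <;> rw [h]
         · left; apply complex_mk_congr <;> linarith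
         · right; apply complex_mk_congr <;> linarith)
  refine triv fun j q hq hqv hf => ?_
  rcases side_height hq hqv with ⟨e1, e2, h⟩ | ⟨e1, e2, h⟩ | ⟨e1, e2, h⟩ | ⟨e1, e2, h⟩
  · exact hy1 ⟨by linarith, by linarith⟩
  · exact hy2 ⟨by linarith, by linarith⟩
  · exact hy3 ⟨by linarith, by linarith⟩
  · exact hy4 ⟨by linarith, by linarith⟩

/-! ### Holonomy vectors of periodic trajectories -/

/-- The vector `h ≠ 0` is the holonomy of a closed trajectory. -/
def IsHolonomy (h : ℂ) : Prop :=
  h ≠ 0 ∧ ∃ τ, WeakLinear τ h ∧ ∀ t : ℝ, τ (t + 1) = τ t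

theorem IsHolonomy.map {A h} (hA : IsAffine A) (hh : IsHolonomy h) (h0 : lin A h ≠ 0) :
    IsHolonomy (lin A h) := by
  obtain ⟨Φ, -, hΦ⟩ := hA.exists_map
  obtain ⟨-, τ, hτ, hper⟩ := hh
  exact ⟨h0, _, hΦ τ h hτ, fun t => by simp only [hper]⟩

theorem IsHolonomy.neg {h} (hh : IsHolonomy h) : IsHolonomy (-h) := by
  obtain ⟨h0, τ, hτ, hper⟩ := hh
  refine ⟨neg_ne_zero.2 h0, _, hτ.reverse, fun t => ?_⟩
  have := hper (-(t + 1))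
  rw [← this]; congr 1; ring

/-- Each crossing contributes the translation of a side that `h` crosses outwards. If the starting
point lies on a side, one period may end at its other representative, so the loop is followed twice.
-/
theorem IsHolonomy.two_mul_mem {h} (hh : IsHolonomy h) :
    2 * h ∈ AddSubmonoid.closure {w | ∃ k, 0 < dot k h ∧ w = -shift k} := by
  obtain ⟨-, τ, hτ, hper⟩ := hh
  set X := AddSubmonoid.closure {w | ∃ k, 0 < dot k h ∧ w = -shift k} with hX
  have dev : ∀ q, Represents q (τ 0) → ∃ l ∈ X, Represents (q + h - l) (τ 0) := by
    intro q hq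
    obtain ⟨l, hl, hr⟩ := hτ.develop (X := {l | l ∈ X}) (b := 1) hq X.zero_mem (by
      rintro s - - l hl j - - - hd
      have : -shift j ∈ X := AddSubmonoid.subset_closure ⟨j, hd, rfl⟩
      have := X.add_mem hl this
      rwa [← sub_eq_add_neg] at this) 1 zero_le_one le_rfl
    refine ⟨l, hl, ?_⟩
    have h1 := hper 0
    rw [zero_add] at h1
    rw [h1] at hr
    simpa using hr
  obtain ⟨q, hq⟩ := exists_represents (τ 0)
  have hv := hτ.not_vertex hq
  obtain ⟨l, hl, h1⟩ := dev q hq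
  rcases hq.cases h1 hv with h2 | ⟨k, hk, h2⟩
  · have : 2 * h = l + l := by linear_combination 2 * h2
    rw [this]; exact X.add_mem hl hl
  · obtain ⟨m, hm, h3⟩ := dev _ h1
    rcases hq.cases h3 hv with h4 | ⟨j, hj, h4⟩
    · have : 2 * h = l + m := by linear_combination h4
      rw [this]; exact X.add_mem hl hm
    · have := side_unique hk hv hj
      subst this
      have : 2 * h = m + m := by linear_combination 2 * h4 - 2 * h2
      rw [this]; exact X.add_mem hm hm

/-- The closed cone of directions between `0` and `π / 8`. -/
def InCone (h : ℂ) : Prop := 0 ≤ h.im ∧ sil * h.im ≤ h.re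

theorem InCone.re_pos {h} (hc : InCone h) (h0 : h ≠ 0) : 0 < h.re := by
  have g2 := sil_gt
  obtain ⟨h1, h2⟩ := hc
  have h3 : 0 ≤ sil * h.im := mul_nonneg (by linarith) h1
  rcases (h3.trans h2).eq_or_lt with h4 | h4
  · exfalso
    apply h0
    have : sil * h.im = 0 := by linarith
    rcases mul_eq_zero.1 this with h5 | h5
    · linarith
    · exact Complex.ext h4.symm h5
  · exact h4

theorem lin_conj_re (z) : (lin !![1, 0; 0, -1] z).re = z.re := by simp [lin]
theorem lin_conj_im (z) : (lin !![1, 0; 0, -1] z).im = -z.im := by simp [lin]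
theorem lin_ν_one_re (z) : (lin (ν 1) z).re = (sil - 1) / 2 * (z.re + z.im) := by
  rw [ν_one]; simp [lin]; ring
theorem lin_ν_one_im (z) : (lin (ν 1) z).im = (sil - 1) / 2 * (z.re - z.im) := by
  rw [ν_one]; simp [lin]; ring
theorem lin_ν_seven_re (z) : (lin (ν 7) z).re = -z.re := by simp [ν, lin]
theorem lin_ν_seven_im (z) : (lin (ν 7) z).im = z.im := by simp [ν, lin]

/-- Integer coordinates in the basis `1, ω, ω², ω³` with `ω = exp (iπ / 4)`, up to the factor
`sil / 2`. -/
def Coord (h : ℂ) (a b c d : ℤ) : Prop :=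
  h.re = sil / 2 * (a + (b - d) * ((sil - 1) / 2)) ∧
  h.im = sil / 2 * (c + (b + d) * ((sil - 1) / 2))

theorem int_add_mul_sil {p q : ℤ} (h : (p : ℝ) + q * sil = 0) : p = 0 ∧ q = 0 := by
  have hq : q = 0 := by
    by_contra hq
    have hq' : (q : ℝ) ≠ 0 := by exact_mod_cast hq
    refine irrational_sqrt_two ⟨(-p - q : ℚ) / q, ?_⟩
    push_cast
    rw [div_eq_iff hq', sqrt_two_eq]; linarith
  subst hq
  simp at h
  exact ⟨h, rfl⟩

/-- The irrationality of `√2` separates the coefficients of `1` and `sil`; hence the signs found for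
one set of coordinates hold for any. -/
theorem Coord.unique {h a b c d a' b' c' d'} (H : Coord h a b c d) (H' : Coord h a' b' c' d') :
    a = a' ∧ b = b' ∧ c = c' ∧ d = d' := by
  have g2 := sil_gt
  obtain ⟨h1, h2⟩ := H
  obtain ⟨h3, h4⟩ := H'
  rw [h1] at h3
  rw [h2] at h4
  have hs : sil / 2 ≠ 0 := by linarith
  have e1 := mul_left_cancel₀ hs h3
  have e2 := mul_left_cancel₀ hs h4
  have f1 : ((2 * (a - a') - (b - d - (b' - d')) : ℤ) : ℝ) +
    ((b - d - (b' - d') : ℤ) : ℝ) * sil = 0 := by push_cast; linarith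
  have f2 : ((2 * (c - c') - (b + d - (b' + d')) : ℤ) : ℝ) +
    ((b + d - (b' + d') : ℤ) : ℝ) * sil = 0 := by push_cast; linarith
  have f3 := int_add_mul_sil f1
  have f4 := int_add_mul_sil f2
  omega

theorem Coord.neg {h a b c d} (H : Coord h a b c d) : Coord (-h) (-a) (-b) (-c) (-d) := by
  constructor
  · rw [Complex.neg_re, H.1]; push_cast; ring
  · rw [Complex.neg_im, H.2]; push_cast; ring

theorem Coord.map_γ {h a b c d} (H : Coord h a b c d) :
    Coord (lin γ h) (-a + 2 * b + 2 * c + 2 * d) (b + 2 * c + 2 * d) c (-2 * c - d) := by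
  have g := sil_sq
  constructor
  · rw [lin_γ_re, H.1, H.2]; push_cast; linear_combination (sil / 2 * (b + d)) * g
  · rw [lin_γ_im, H.2]; push_cast; ring

theorem Coord.map_ν_one {h a b c d} (H : Coord h a b c d) :
    Coord (lin (ν 1) h) b a (-d) (-c) := by
  have g := sil_sq
  rw [ν_one]
  constructor
  · simp only [lin, H.1, H.2]; simp; linear_combination (sil / 4 * b) * g
  · simp only [lin, H.1, H.2]; simp; linear_combination (-sil / 4 * d) * g

theorem Coord.map_conj {h a b c d} (H : Coord h a b c d) :
    Coord (lin !![1, 0; 0, -1] h) a (-d) (-c) (-b) := by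
  constructor
  · rw [lin_conj_re, H.1]; push_cast; ring
  · rw [lin_conj_im, H.2]; push_cast; ring

theorem Coord.map_ν_seven {h a b c d} (H : Coord h a b c d) :
    Coord (lin (ν 7) h) (-a) d c b := by
  constructor
  · rw [lin_ν_seven_re, H.1]; push_cast; ring
  · rw [lin_ν_seven_im, H.2]; push_cast; ring

/-- A vector of the cone has positive component only along the normals `0, 1, 2, 3`, whose angles
are `π / 2`, `π / 4`, `0` and `-π / 4`. The coefficients count the crossings of these sides. -/
theorem exists_nat_coord {h w : ℂ} (hc : InCone h) (h0 : h ≠ 0)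
    (hw : w ∈ AddSubmonoid.closure {w | ∃ k, 0 < dot k h ∧ w = -shift k}) :
    ∃ a b c e : ℤ, 0 ≤ a ∧ 0 ≤ b ∧ 0 ≤ c ∧ 0 ≤ e ∧
      w.re = sil * (a + (b + e) * ((sil - 1) / 2)) ∧
      w.im = sil * (c + (b - e) * ((sil - 1) / 2)) := by
  have g1 := sil_sq
  have g2 := sil_gt
  have hre := hc.re_pos h0
  induction hw using AddSubmonoid.closure_induction with
  | mem w hw =>
    obtain ⟨k, hk, rfl⟩ := hw
    have hk' : k = 0 ∨ k = 1 ∨ k = 2 ∨ k = 3 := by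
      by_contra hno
      obtain ⟨j, rfl⟩ : ∃ j, k = j + 4 := ⟨k + 4, by omega⟩
      rw [dot_opp] at hk
      have hj : j = 0 ∨ j = 1 ∨ j = 2 ∨ j = 3 := by omega
      obtain ⟨h1, h2⟩ := hc
      rcases hj with rfl | rfl | rfl | rfl
      · rw [dot_zero] at hk; linarith
      · rw [dot_one] at hk; nlinarith
      · rw [dot_two] at hk; linarith
      · rw [dot_three] at hk; nlinarith
    rcases hk' with rfl | rfl | rfl | rfl
    · exact ⟨0, 0, 1, 0, by simp [shift_zero]⟩
    · refine ⟨0, 1, 0, 0, by simp, by simp, by simp, by simp, ?_, ?_⟩ <;> simp [shift_one] <;>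
        linarith
    · exact ⟨1, 0, 0, 0, by simp [shift_two]⟩
    · refine ⟨0, 0, 0, 1, by simp, by simp, by simp, by simp, ?_, ?_⟩ <;> simp [shift_three] <;>
        linarith
  | zero => exact ⟨0, 0, 0, 0, by simp⟩
  | add x y _ _ hx hy =>
    obtain ⟨a, b, c, e, p1, p2, p3, p4, p5, p6⟩ := hx
    obtain ⟨a', b', c', e', q1, q2, q3, q4, q5, q6⟩ := hy
    refine ⟨a + a', b + b', c + c', e + e', by omega, by omega, by omega, by omega, ?_, ?_⟩
    · rw [Complex.add_re, p5, q5]; push_cast; ring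
    · rw [Complex.add_im, p6, q6]; push_cast; ring

theorem IsHolonomy.exists_coord {h} (hh : IsHolonomy h) (hc : InCone h) :
    ∃ a b c e : ℤ, 0 ≤ a ∧ 0 ≤ b ∧ 0 ≤ c ∧ 0 ≤ e ∧ Coord h a b c (-e) := by
  obtain ⟨a, b, c, e, h1, h2, h3, h4, h5, h6⟩ := exists_nat_coord hc hh.1 hh.two_mul_mem
  refine ⟨a, b, c, e, h1, h2, h3, h4, ?_, ?_⟩
  · have : (2 * h).re = 2 * h.re := by simp
    rw [this] at h5
    push_cast; linarith
  · have : (2 * h).im = 2 * h.im := by simp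
    rw [this] at h6
    push_cast; linarith

theorem IsHolonomy.nonneg {h a b c e} (hh : IsHolonomy h) (hc : InCone h)
    (H : Coord h a b c (-e)) : 0 ≤ a ∧ 0 ≤ b ∧ 0 ≤ c ∧ 0 ≤ e := by
  obtain ⟨a', b', c', e', h1, h2, h3, h4, H'⟩ := hh.exists_coord hc
  have := H.unique H'
  omega

theorem lin_γ_eq_zero {z} (h : lin γ z = 0) : z = 0 := by
  have h1 := lin_γ_im z
  have h2 := lin_γ_re z
  rw [h] at h1 h2
  simp at h1 h2
  rw [← h1] at h2
  apply Complex.ext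
  · simp at h2 ⊢; exact h2
  · simp [← h1]

theorem normSq_lin_ν (i : Fin 8) : ∀ z, Complex.normSq (lin (ν i) z) = Complex.normSq z := by
  have g := sil_sq
  refine ν_induction (P := fun A => ∀ z, Complex.normSq (lin A z) = Complex.normSq z) ?_ ?_ ?_ i
  · intro z; rw [lin_one]
  · intro A hA z
    rw [lin_mul, ← hA z]; simp [lin, Complex.normSq_apply]; ring
  · intro A hA z
    rw [lin_mul, ← hA z, ν_one]
    generalize lin A z = w
    simp [lin, Complex.normSq_apply]
    linear_combination ((w.re * w.re + w.im * w.im) / 2) * g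

theorem lin_ν_eq_zero {i z} (h : lin (ν i) z = 0) : z = 0 := by
  have := normSq_lin_ν i z
  rw [h, map_zero] at this
  exact Complex.normSq_eq_zero.1 this.symm

theorem IsHolonomy.map_γ {h} (hh : IsHolonomy h) : IsHolonomy (lin γ h) :=
  hh.map isAffine_γ fun h0 => hh.1 (lin_γ_eq_zero h0)

theorem IsHolonomy.map_ν {h} (hh : IsHolonomy h) (i) : IsHolonomy (lin (ν i) h) :=
  hh.map (isAffine_ν i) fun h0 => hh.1 (lin_ν_eq_zero h0)

/-- The parabolic map that fixes the direction `π / 8`. -/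
theorem InCone.map_ν_one {h} (hc : InCone h) : InCone (lin γ (lin (ν 1) h)) := by
  have g1 := sil_sq
  have g2 := sil_gt
  obtain ⟨h1, h2⟩ := hc
  constructor
  · rw [lin_γ_im, lin_ν_one_im]; nlinarith
  · rw [lin_γ_re, lin_γ_im, lin_ν_one_re, lin_ν_one_im]
    have e : -((sil - 1) / 2 * (h.re + h.im)) + 2 * sil * ((sil - 1) / 2 * (h.re - h.im)) -
      sil * ((sil - 1) / 2 * (h.re - h.im)) = h.re - sil * h.im := by
      linear_combination (h.re / 2 - h.im / 2) * g1
    linarith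

/-- The parabolic map that fixes the horizontal direction. -/
theorem InCone.map_ν_seven {h} (hc : InCone h) : InCone (lin γ (lin (ν 7) h)) := by
  have g2 := sil_gt
  obtain ⟨h1, h2⟩ := hc
  constructor
  · rwa [lin_γ_im, lin_ν_seven_im]
  · rw [lin_γ_re, lin_γ_im, lin_ν_seven_re, lin_ν_seven_im]; nlinarith

/-- The parabolic map leaves `e - c` and `a - b + 2 * (e - c)` invariant and adds them to `c` and
`a` respectively. After `n` steps the vector is still a holonomy in the cone, so these coordinates
are nonnegative. -/
theorem IsHolonomy.iterate_ν_one (n : ℕ) : ∀ {h a b c e}, IsHolonomy h → InCone h →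
    Coord h a b c (-e) → 0 ≤ c + n * (e - c) ∧ 0 ≤ a + n * (a - b + 2 * (e - c)) := by
  induction n with
  | zero =>
    intro h a b c e hh hc H
    have := hh.nonneg hc H
    simp; omega
  | succ n ih =>
    intro h a b c e hh hc H
    have H' := H.map_ν_one.map_γ
    have := ih (a := 2 * a - b + 2 * e - 2 * c) (b := a + 2 * e - 2 * c) (c := e)
      (e := 2 * e - c) (hh.map_ν 1).map_γ hc.map_ν_one (by convert H' using 1 <;> ring)
    push_cast
    constructor
    · linarith [this.1]
    · linarith [this.2]

/-- Here the invariant is `b + c - e`, and each step adds twice its value to `a`. -/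
theorem IsHolonomy.iterate_ν_seven (n : ℕ) : ∀ {h a b c e}, IsHolonomy h → InCone h →
    Coord h a b c (-e) → 0 ≤ a + n * (2 * (b + c - e)) := by
  induction n with
  | zero =>
    intro h a b c e hh hc H
    have := hh.nonneg hc H
    simp; omega
  | succ n ih =>
    intro h a b c e hh hc H
    have H' := H.map_ν_seven.map_γ
    have := ih (a := a + 2 * b + 2 * c - 2 * e) (b := 2 * b + 2 * c - e) (c := c)
      (e := 2 * c + b) (hh.map_ν 7).map_γ hc.map_ν_seven (by convert H' using 1 <;> ring)
    push_cast
    linarith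

theorem nonneg_of_forall_nat {x y : ℤ} (h : ∀ n : ℕ, 0 ≤ x + n * y) : 0 ≤ y := by
  by_contra hy
  push Not at hy
  have h0 := h 0
  simp at h0
  have h1 := h (x + 1).toNat
  rw [Int.toNat_of_nonneg (by omega)] at h1
  nlinarith

/-- A coordinate that stays nonnegative along an arithmetic progression has a nonnegative increment.
-/
theorem IsHolonomy.constraints {h a b c e} (hh : IsHolonomy h) (hc : InCone h)
    (H : Coord h a b c (-e)) : c ≤ e ∧ e ≤ b + c ∧ b ≤ a + 2 * (e - c) := by
  have h1 : 0 ≤ e - c := nonneg_of_forall_nat fun n => (hh.iterate_ν_one n hc H).1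
  have h2 : 0 ≤ a - b + 2 * (e - c) := nonneg_of_forall_nat fun n => (hh.iterate_ν_one n hc H).2
  have h3 : 0 ≤ 2 * (b + c - e) := nonneg_of_forall_nat fun n => hh.iterate_ν_seven n hc H
  omega

/-- The vector has integer coordinates with sum of absolute values at most `N`. -/
def Bounded (N : ℕ) (h : ℂ) : Prop :=
  ∃ a b c d : ℤ, Coord h a b c d ∧ a.natAbs + b.natAbs + c.natAbs + d.natAbs ≤ N

theorem Bounded.neg {N h} (hb : Bounded N h) : Bounded N (-h) := by
  obtain ⟨a, b, c, d, H, hN⟩ := hb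
  exact ⟨_, _, _, _, H.neg, by omega⟩

theorem Bounded.map_ν {N h} (hb : Bounded N h) (i) : Bounded N (lin (ν i) h) := by
  refine ν_induction (P := fun A => ∀ h, Bounded N h → Bounded N (lin A h)) ?_ ?_ ?_ i h hb
  · intro h hb; rwa [lin_one]
  · intro A hA h hb
    obtain ⟨a, b, c, d, H, hN⟩ := hA h hb
    rw [lin_mul]
    exact ⟨_, _, _, _, H.map_conj, by omega⟩
  · intro A hA h hb
    obtain ⟨a, b, c, d, H, hN⟩ := hA h hb
    rw [lin_mul]
    exact ⟨_, _, _, _, H.map_ν_one, by omega⟩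

/-- In the new coordinates `-a + 2 * (b + c - e)`, `b + 2 * (c - e)`, `c`, `e - 2 * c`, the
inequalities of `IsHolonomy.constraints` keep the sum of absolute values at most `a + b + c + e`. -/
theorem Bounded.map_γ {N h} (hb : Bounded N h) (hh : IsHolonomy h) (hc : InCone h) :
    Bounded N (lin γ h) := by
  obtain ⟨a, b, c, d, H, hN⟩ := hb
  obtain ⟨e, rfl⟩ : ∃ e, d = -e := ⟨-d, by ring⟩
  have h1 := hh.nonneg hc H
  have h2 := hh.constraints hc H
  exact ⟨_, _, _, _, H.map_γ, by omega⟩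

theorem finite_bounded (N : ℕ) : {h | Bounded N h}.Finite := by
  have hI : (Set.Icc (-(N : ℤ)) N).Finite := Set.finite_Icc _ _
  refine (((hI.prod hI).prod (hI.prod hI)).image fun p : (ℤ × ℤ) × (ℤ × ℤ) =>
    (⟨sil / 2 * (p.1.1 + (p.1.2 - p.2.2) * ((sil - 1) / 2)),
      sil / 2 * (p.2.1 + (p.1.2 + p.2.2) * ((sil - 1) / 2))⟩ : ℂ)).subset ?_
  rintro h ⟨a, b, c, d, H, hN⟩
  refine ⟨((a, b), (c, d)), ?_, Complex.ext H.1.symm H.2.symm⟩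
  simp only [Set.mem_prod, Set.mem_Icc]
  omega

/-- For `h = (x, y)` the squared length drops by `4 * sil * y * (x - sil * y)`, which is positive
inside the cone. -/
theorem normSq_γ_lt {h} (hc : InCone h) (h0 : h.im ≠ 0) (h1 : sil * h.im ≠ h.re) :
    Complex.normSq (lin γ h) < Complex.normSq h := by
  have g2 := sil_gt
  obtain ⟨h2, h3⟩ := hc
  have h4 := lt_of_le_of_ne h2 h0.symm
  have h5 := lt_of_le_of_ne h3 h1
  rw [Complex.normSq_apply, Complex.normSq_apply, lin_γ_re, lin_γ_im]
  have : 0 < sil * h.im * (h.re - sil * h.im) :=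
    mul_pos (mul_pos (by linarith) h4) (by linarith)
  nlinarith

/-! ### Directions -/

/-- The unit vector in direction `θ`. -/
noncomputable def dir (θ : ℝ) : ℂ := ⟨Real.cos θ, Real.sin θ⟩

@[simp] theorem dir_re (θ) : (dir θ).re = Real.cos θ := rfl
@[simp] theorem dir_im (θ) : (dir θ).im = Real.sin θ := rfl

theorem dir_ne_zero (θ) : dir θ ≠ 0 := by
  intro h
  have h1 := congrArg Complex.re h
  have h2 := congrArg Complex.im h
  simp at h1 h2
  have := Real.sin_sq_add_cos_sq θ
  rw [h1, h2] at this; norm_num at this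

theorem eq_of_parallel {φ ψ c : ℝ} (h1 : -Real.pi < φ - ψ) (h2 : φ - ψ < Real.pi)
    (h : dir φ = c * dir ψ) : φ = ψ := by
  have hr := congrArg Complex.re h
  have hi := congrArg Complex.im h
  rw [Complex.re_ofReal_mul] at hr
  rw [Complex.im_ofReal_mul] at hi
  simp only [dir_re, dir_im] at hr hi
  have : Real.sin (φ - ψ) = 0 := by rw [Real.sin_sub, hr, hi]; ring
  have := (Real.sin_eq_zero_iff_of_lt_of_lt h1 h2).1 this
  linarith

theorem lineAngle_spec {w : ℂ} (hw : w ≠ 0) : 0 < lineAngle ![w.re, w.im] ∧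
    lineAngle ![w.re, w.im] ≤ Real.pi ∧ ∃ c : ℝ, c ≠ 0 ∧ w = c * dir (lineAngle ![w.re, w.im]) := by
  have hn : ‖w‖ ≠ 0 := norm_ne_zero_iff.2 hw
  have hc := Complex.norm_mul_cos_arg w
  have hs := Complex.norm_mul_sin_arg w
  have e : (⟨![w.re, w.im] 0, ![w.re, w.im] 1⟩ : ℂ) = w := rfl
  unfold lineAngle
  rw [e]
  split_ifs with h
  · refine ⟨h, Complex.arg_le_pi w, ‖w‖, hn, ?_⟩
    apply Complex.ext
    · rw [Complex.re_ofReal_mul]; exact hc.symm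
    · rw [Complex.im_ofReal_mul]; exact hs.symm
  · push Not at h
    refine ⟨by linarith [Complex.neg_pi_lt_arg w], by linarith, -‖w‖, neg_ne_zero.2 hn, ?_⟩
    apply Complex.ext
    · rw [Complex.re_ofReal_mul, dir_re, Real.cos_add_pi, neg_mul_neg, hc]
    · rw [Complex.im_ofReal_mul, dir_im, Real.sin_add_pi, neg_mul_neg, hs]

theorem lin_map_ne_zero (i θ) : lin γ (lin (ν i) (dir θ)) ≠ 0 := fun h =>
  dir_ne_zero θ (lin_ν_eq_zero (lin_γ_eq_zero h))

theorem branch_eq (i θ) : branch i θ =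
    lineAngle ![(lin γ (lin (ν i) (dir θ))).re, (lin γ (lin (ν i) (dir θ))).im] := by
  rw [← lin_mul]
  unfold branch
  congr 1
  ext j
  fin_cases j <;> simp [lin, Matrix.mulVec, dotProduct, Fin.sum_univ_two]

theorem branch_pos (i θ) : 0 < branch i θ := by
  rw [branch_eq]; exact (lineAngle_spec (lin_map_ne_zero i θ)).1

theorem branch_le_pi (i θ) : branch i θ ≤ Real.pi := by
  rw [branch_eq]; exact (lineAngle_spec (lin_map_ne_zero i θ)).2.1

theorem branch_spec (i θ) :
    ∃ c : ℝ, c ≠ 0 ∧ lin γ (lin (ν i) (dir θ)) = c * dir (branch i θ) := by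
  rw [branch_eq]; exact (lineAngle_spec (lin_map_ne_zero i θ)).2.2

theorem branch_eq_of {i θ φ} {c : ℝ} (h0 : 0 < φ) (h1 : φ ≤ Real.pi)
    (h : lin γ (lin (ν i) (dir θ)) = c * dir φ) : branch i θ = φ := by
  obtain ⟨c', hc', h'⟩ := branch_spec i θ
  have hb0 := branch_pos i θ
  have hb1 := branch_le_pi i θ
  refine eq_of_parallel (c := c / c') (by linarith) (by linarith) ?_
  rw [h] at h'
  have : (c' : ℂ) ≠ 0 := by exact_mod_cast hc'
  push_cast
  field_simp
  linear_combination -h'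

theorem cos_eq_sil_mul_sin : Real.cos (Real.pi / 8) = sil * Real.sin (Real.pi / 8) := by
  have g1 := sil_sq
  have g2 := sil_gt
  have h1 : Real.cos (2 * (Real.pi / 8)) = Real.sin (2 * (Real.pi / 8)) := by
    rw [show 2 * (Real.pi / 8) = Real.pi / 4 by ring, Real.cos_pi_div_four, Real.sin_pi_div_four]
  rw [Real.cos_two_mul', Real.sin_two_mul] at h1
  have hp := Real.pi_pos
  have hs : 0 < Real.sin (Real.pi / 8) := Real.sin_pos_of_pos_of_lt_pi (by linarith) (by linarith)
  have hc : 0 < Real.cos (Real.pi / 8) :=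
    Real.cos_pos_of_mem_Ioo ⟨by linarith, by linarith⟩
  -- The quadratic relation given by equal sine and cosine at `π / 4` factors, the roots for the
  -- cotangent being `sil` and `2 - sil < 0`.
  have h2 : (Real.cos (Real.pi / 8) - sil * Real.sin (Real.pi / 8)) *
      (Real.cos (Real.pi / 8) + (sil - 2) * Real.sin (Real.pi / 8)) = 0 := by
    linear_combination h1 - (Real.sin (Real.pi / 8)) ^ 2 * g1
  rcases mul_eq_zero.1 h2 with h | h
  · linarith
  · exfalso; nlinarith

theorem sin_pi_div_eight_pos : 0 < Real.sin (Real.pi / 8) := by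
  have hp := Real.pi_pos
  exact Real.sin_pos_of_pos_of_lt_pi (by linarith) (by linarith)

theorem sin_sub_pi_div_eight (α : ℝ) : Real.sin (α - Real.pi / 8) =
    Real.sin (Real.pi / 8) * (sil * Real.sin α - Real.cos α) := by
  rw [Real.sin_sub, cos_eq_sil_mul_sin]; ring

theorem inCone_dir {α : ℝ} (h0 : 0 ≤ α) (h1 : α ≤ Real.pi / 8) : InCone (dir α) := by
  have hp := Real.pi_pos
  refine ⟨Real.sin_nonneg_of_nonneg_of_le_pi h0 (by linarith), ?_⟩
  have h2 := sin_sub_pi_div_eight α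
  have h3 : Real.sin (α - Real.pi / 8) ≤ 0 :=
    Real.sin_nonpos_of_nonpos_of_neg_pi_le (by linarith) (by linarith)
  have h4 := sin_pi_div_eight_pos
  simp only [dir_re, dir_im]
  by_contra hlt
  push Not at hlt
  nlinarith

/-- The angle in `[0, π / 8]` to which `ν i` maps the angle `θ` of the sector `i`. -/
theorem exists_lin_ν_dir {i : Fin 8} {θ : ℝ} (h : θ ∈ closedSector i) :
    ∃ α, 0 ≤ α ∧ α ≤ Real.pi / 8 ∧ lin (ν i) (dir θ) = dir α := by
  obtain ⟨h1, h2⟩ := h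
  have c4 : Real.cos (Real.pi / 4) = 1 / √2 := by
    rw [Real.cos_pi_div_four]; exact Real.sqrt_div_self'
  have s4 : Real.sin (Real.pi / 4) = 1 / √2 := by
    rw [Real.sin_pi_div_four]; exact Real.sqrt_div_self'
  have c34 : Real.cos (Real.pi - Real.pi / 4) = -(1 / √2) := by rw [Real.cos_pi_sub, c4]
  have s34 : Real.sin (Real.pi - Real.pi / 4) = 1 / √2 := by rw [Real.sin_pi_sub, s4]
  fin_cases i <;> simp only [Nat.cast_zero, Nat.cast_one, zero_mul, zero_div, zero_add,
    one_mul, Nat.cast_ofNat] at h1 h2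
  · exact ⟨θ, by linarith, by linarith, by apply Complex.ext <;> simp [lin, ν]⟩
  · refine ⟨Real.pi / 4 - θ, by linarith, by linarith, ?_⟩
    apply Complex.ext <;> simp only [dir_re, dir_im, Real.cos_sub, Real.sin_sub, c4, s4] <;>
      simp [lin, ν] <;> ring
  · refine ⟨θ - Real.pi / 4, by linarith, by linarith, ?_⟩
    apply Complex.ext <;> simp only [dir_re, dir_im, Real.cos_sub, Real.sin_sub, c4, s4] <;>
      simp [lin, ν] <;> ring
  · refine ⟨Real.pi / 2 - θ, by linarith, by linarith, ?_⟩
    apply Complex.ext <;> simp [lin, ν, Real.cos_sub, Real.sin_sub]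
  · refine ⟨θ - Real.pi / 2, by linarith, by linarith, ?_⟩
    apply Complex.ext <;> simp [lin, ν, Real.cos_sub, Real.sin_sub]
  · refine ⟨(Real.pi - Real.pi / 4) - θ, by linarith, by linarith, ?_⟩
    apply Complex.ext <;> simp only [dir_re, dir_im, Real.cos_sub _ θ, Real.sin_sub _ θ, c34, s34]
      <;> simp [lin, ν]
  · refine ⟨θ - (Real.pi - Real.pi / 4), by linarith, by linarith, ?_⟩
    apply Complex.ext <;> simp only [dir_re, dir_im, Real.cos_sub θ, Real.sin_sub θ, c34, s34] <;>
      simp [lin, ν] <;> ring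
  · refine ⟨Real.pi - θ, by linarith, by linarith, ?_⟩
    apply Complex.ext <;> simp [lin, ν]

theorem inCone_lin_ν {i : Fin 8} {θ : ℝ} (h : θ ∈ closedSector i) :
    InCone (lin (ν i) (dir θ)) := by
  obtain ⟨α, h0, h1, h2⟩ := exists_lin_ν_dir h
  rw [h2]; exact inCone_dir h0 h1

/-- The image of the sector `0` under `γ` is the complementary sector. -/
theorem pi_div_eight_le_of_γ {g : ℂ} (hg : InCone g) (h0 : g ≠ 0) {φ c : ℝ} (hφ : 0 < φ)
    (h : lin γ g = c * dir φ) : Real.pi / 8 ≤ φ := by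
  by_contra hlt
  push Not at hlt
  have hp := Real.pi_pos
  have hs : 0 < Real.sin φ := Real.sin_pos_of_pos_of_lt_pi hφ (by linarith)
  have h2 := sin_sub_pi_div_eight φ
  have h3 : Real.sin (φ - Real.pi / 8) < 0 :=
    Real.sin_neg_of_neg_of_neg_pi_lt (by linarith) (by linarith)
  have h4 := sin_pi_div_eight_pos
  have h5 : sil * Real.sin φ < Real.cos φ := by
    by_contra hge
    push Not at hge
    nlinarith
  have hi := lin_γ_im g
  have hr := lin_γ_re g
  rw [h, Complex.re_ofReal_mul, dir_re] at hr
  rw [h, Complex.im_ofReal_mul, dir_im] at hi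
  have hpos := hg.re_pos h0
  obtain ⟨q1, q2⟩ := hg
  have hc : 0 ≤ c := by
    by_contra hneg
    push Not at hneg
    nlinarith
  rcases hc.eq_or_lt with hc | hc
  · rw [← hc, zero_mul] at hi hr
    rw [← hi] at hr; linarith
  · have := mul_lt_mul_of_pos_left h5 hc
    have e : c * (sil * Real.sin φ) = sil * g.im := by rw [← hi]; ring
    linarith

theorem closedSector_subset (i : Fin 8) : closedSector i ⊆ Set.Icc 0 Real.pi := by
  rintro θ ⟨h1, h2⟩
  have hp := Real.pi_pos
  have hi : ((i : ℕ) : ℝ) ≤ 7 := by exact_mod_cast (by omega : (i : ℕ) ≤ 7)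
  have hi0 : (0 : ℝ) ≤ ((i : ℕ) : ℝ) := Nat.cast_nonneg _
  constructor
  · exact le_trans (by positivity) h1
  · refine h2.trans ?_
    rw [div_le_iff₀ (by norm_num)]; nlinarith

/-- The second clause makes `π / 8` choose the sector `1`, so that values of the Farey map never
require the entry `0`. -/
theorem exists_closedSector {θ : ℝ} (h0 : 0 ≤ θ) (h1 : θ ≤ Real.pi) :
    ∃ i, θ ∈ closedSector i ∧ (Real.pi / 8 ≤ θ → i ≠ 0) := by
  have hp := Real.pi_pos
  rcases h1.eq_or_lt with rfl | h1
  · refine ⟨7, ⟨?_, ?_⟩, fun _ => by decide⟩ <;> norm_num <;> linarith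
  · have hlt : ⌊θ / (Real.pi / 8)⌋₊ < 8 := by
      rw [Nat.floor_lt (by positivity), div_lt_iff₀ (by positivity)]; push_cast; linarith
    refine ⟨⟨⌊θ / (Real.pi / 8)⌋₊, hlt⟩, ⟨?_, ?_⟩, fun hθ hi => ?_⟩
    · have := Nat.floor_le (show 0 ≤ θ / (Real.pi / 8) by positivity)
      rw [le_div_iff₀ (by positivity)] at this
      simp only; linarith
    · have := Nat.lt_floor_add_one (θ / (Real.pi / 8))
      rw [div_lt_iff₀ (by positivity)] at this
      simp only; linarith
    · have h2 : ⌊θ / (Real.pi / 8)⌋₊ = 0 := congrArg Fin.val hi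
      rw [Nat.floor_eq_zero, div_lt_one (by positivity)] at h2
      linarith

/-! ### Expansions with constant tail -/

theorem mem_Icc_of_sectorCF {θ s n} (h : θ ∈ sectorCF n s) : θ ∈ Set.Icc 0 Real.pi := by
  cases n with
  | zero => exact h
  | succ n => exact closedSector_subset _ h.1

/-- The map `γ ν₇` is the shear `x ↦ x + 2 * sil * y`. Every further entry `7` therefore raises the
lower bound for minus the cotangent by `2 * sil`. -/
theorem sector_seven_estimate (n : ℕ) : ∀ θ, θ ∈ sectorCF (n + 1) (fun _ => 7) →
    (sil + 2 * sil * n) * Real.sin θ ≤ -Real.cos θ := by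
  induction n with
  | zero =>
    rintro θ ⟨h1, -⟩
    have := (inCone_lin_ν h1).2
    rw [lin_ν_seven_re, lin_ν_seven_im] at this
    simpa using this
  | succ n ih =>
    rintro θ ⟨h1, h2⟩
    have h3 : (sil + 2 * sil * n) * Real.sin (branch 7 θ) ≤ -Real.cos (branch 7 θ) := ih _ h2
    have hc1 := (inCone_lin_ν h1)
    obtain ⟨c, hc, h4⟩ := branch_spec 7 θ
    have hr := lin_γ_re (lin (ν 7) (dir θ))
    have hi := lin_γ_im (lin (ν 7) (dir θ))
    have hc2 := hc1.2
    rw [lin_ν_seven_re, lin_ν_seven_im] at hr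
    rw [lin_ν_seven_im] at hi
    rw [lin_ν_seven_re, lin_ν_seven_im] at hc2
    rw [h4, Complex.re_ofReal_mul] at hr
    rw [h4, Complex.im_ofReal_mul] at hi
    simp only [dir_re, dir_im] at hr hi hc2
    have hm := closedSector_subset _ h1
    have hs0 : 0 ≤ Real.sin θ := Real.sin_nonneg_of_nonneg_of_le_pi hm.1 hm.2
    rcases hs0.eq_or_lt with hs | hs
    · rw [← hs] at hc2 ⊢; linarith
    · have hs' : 0 ≤ Real.sin (branch 7 θ) :=
        Real.sin_nonneg_of_nonneg_of_le_pi (branch_pos 7 θ).le (branch_le_pi 7 θ)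
      have hcpos : 0 < c := by
        by_contra hneg
        push Not at hneg
        nlinarith
      have := mul_le_mul_of_nonneg_left h3 hcpos.le
      have e : c * ((sil + 2 * sil * n) * Real.sin (branch 7 θ)) =
        (sil + 2 * sil * n) * Real.sin θ := by rw [← hi]; ring
      push_cast
      linarith

theorem eq_pi_of_const_seven {θ} (h : ∀ n, θ ∈ sectorCF n (fun _ => 7)) : θ = Real.pi := by
  have g2 := sil_gt
  have hp := Real.pi_pos
  have h7 := (h 1).1
  have hm := closedSector_subset _ h7
  have hs0 : 0 ≤ Real.sin θ := Real.sin_nonneg_of_nonneg_of_le_pi hm.1 hm.2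
  by_contra hne
  have hge := h7.1
  norm_num at hge
  have hs : 0 < Real.sin θ :=
    Real.sin_pos_of_pos_of_lt_pi (by linarith) (lt_of_le_of_ne hm.2 hne)
  obtain ⟨n, hn⟩ := exists_nat_gt (1 / Real.sin θ)
  rw [div_lt_iff₀ hs] at hn
  have h1 := sector_seven_estimate n θ (h _)
  have h2 := Real.neg_one_le_cos θ
  have h3 : 0 ≤ sil * Real.sin θ := by positivity
  have h4 : (0 : ℝ) ≤ n * Real.sin θ := by positivity
  nlinarith

/-- The parabolic map `γ ν₁` preserves `sil * y - x` and lowers `y` by `(sil - 1) / 2` times this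
quantity. Since `y` must remain large enough after every step, the quantity is at most of order `1 /
n`. -/
theorem sector_one_estimate (n : ℕ) : ∀ θ, θ ∈ sectorCF (n + 1) (fun _ => 1) →
    0 ≤ sil * Real.sin θ - Real.cos θ ∧
    (n + 1) * ((sil - 1) / 2) * (sil * Real.sin θ - Real.cos θ) ≤ Real.sin θ := by
  have g1 := sil_sq
  have g2 := sil_gt
  have first : ∀ θ, θ ∈ closedSector 1 → 0 ≤ sil * Real.sin θ - Real.cos θ ∧
      (sil - 1) / 2 * (sil * Real.sin θ - Real.cos θ) ≤ Real.sin θ := by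
    intro θ h1
    have hc := inCone_lin_ν h1
    obtain ⟨q1, q2⟩ := hc
    rw [lin_ν_one_im] at q1
    rw [lin_ν_one_re, lin_ν_one_im] at q2
    simp only [dir_re, dir_im] at q1 q2
    constructor
    · nlinarith
    · have e : Real.sin θ - (sil - 1) / 2 * (sil * Real.sin θ - Real.cos θ) =
          (sil - 1) / 2 * (Real.cos θ - Real.sin θ) := by
        linear_combination -(Real.sin θ / 2) * g1
      linarith
  induction n with
  | zero =>
    rintro θ ⟨h1, -⟩
    simpa using first θ h1
  | succ n ih =>
    rintro θ ⟨h1, h2⟩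
    obtain ⟨p1, p2⟩ := first θ h1
    refine ⟨p1, ?_⟩
    obtain ⟨-, h3⟩ := ih _ h2
    obtain ⟨c, hc, h4⟩ := branch_spec 1 θ
    have hr := lin_γ_re (lin (ν 1) (dir θ))
    have hi := lin_γ_im (lin (ν 1) (dir θ))
    rw [lin_ν_one_re, lin_ν_one_im] at hr
    rw [lin_ν_one_im] at hi
    rw [h4, Complex.re_ofReal_mul] at hr
    rw [h4, Complex.im_ofReal_mul] at hi
    simp only [dir_re, dir_im] at hr hi
    set φ := branch 1 θ with hφ
    have hs' : 0 ≤ Real.sin φ :=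
      Real.sin_nonneg_of_nonneg_of_le_pi (branch_pos 1 θ).le (branch_le_pi 1 θ)
    have hA : c * (sil * Real.sin φ - Real.cos φ) = sil * Real.sin θ - Real.cos θ := by
      linear_combination sil * hi - hr + (Real.sin θ / 2 - Real.cos θ / 2) * g1
    have hy : c * Real.sin φ = Real.sin θ -
        (sil - 1) / 2 * (sil * Real.sin θ - Real.cos θ) := by
      linear_combination hi + (Real.sin θ / 2) * g1
    -- A negative factor would force `sin φ = 0`, so `φ = π`; the invariant would then equal `c`,
    -- against its sign.
    have hcpos : 0 < c := by
      by_contra hneg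
      push Not at hneg
      have hneg' : c < 0 := lt_of_le_of_ne hneg hc
      have h5 : Real.sin φ = 0 := by
        have : 0 ≤ c * Real.sin φ := by rw [hy]; linarith
        nlinarith
      have h6 : φ = Real.pi := by
        by_contra hne
        have := Real.sin_pos_of_pos_of_lt_pi (branch_pos 1 θ)
          (lt_of_le_of_ne (branch_le_pi 1 θ) hne)
        rw [← hφ] at this
        linarith
      rw [h6] at hA
      simp at hA
      linarith
    have := mul_le_mul_of_nonneg_left h3 hcpos.le
    rw [hy] at this
    have e : c * ((n + 1) * ((sil - 1) / 2) * (sil * Real.sin φ - Real.cos φ)) =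
      (n + 1) * ((sil - 1) / 2) * (sil * Real.sin θ - Real.cos θ) := by
      rw [← hA]; ring
    rw [e] at this
    push_cast
    linarith

theorem eq_of_sin_sub_eq_zero {θ φ : ℝ} (h1 : -Real.pi < θ - φ) (h2 : θ - φ < Real.pi)
    (h : Real.sin (θ - φ) = 0) : θ = φ := by
  have := (Real.sin_eq_zero_iff_of_lt_of_lt h1 h2).1 h
  linarith

theorem eq_of_const_one {θ} (h : ∀ n, θ ∈ sectorCF n (fun _ => 1)) : θ = Real.pi / 8 := by
  have g2 := sil_gt
  have hp := Real.pi_pos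
  have hm := mem_Icc_of_sectorCF (h 0)
  refine eq_of_sin_sub_eq_zero (by linarith [hm.1]) (by linarith [hm.2]) ?_
  rw [sin_sub_pi_div_eight]
  have h0 := (sector_one_estimate 0 θ (h _)).1
  rcases h0.eq_or_lt with h0 | h0
  · rw [← h0, mul_zero]
  · exfalso
    obtain ⟨n, hn⟩ := exists_nat_gt (2 / (sil * Real.sin θ - Real.cos θ))
    rw [div_lt_iff₀ h0] at hn
    have h1 := (sector_one_estimate n θ (h _)).2
    have h2 := Real.sin_le_one θ
    have h3 : (0.7 : ℝ) * ((n + 1) * (sil * Real.sin θ - Real.cos θ)) ≤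
        (sil - 1) / 2 * ((n + 1) * (sil * Real.sin θ - Real.cos θ)) := by
      apply mul_le_mul_of_nonneg_right (by linarith); positivity
    nlinarith

/-- The entries of the sequence are eventually all `1` or eventually all `7`. -/
def ConstTail (s : ℕ → Fin 8) : Prop :=
  (∃ N, ∀ k ≥ N, s k = 1) ∨ (∃ N, ∀ k ≥ N, s k = 7)

theorem ConstTail.induction {P : (ℕ → Fin 8) → Prop} (h1 : P fun _ => 1) (h7 : P fun _ => 7)
    (hs : ∀ s, P (fun k => s (k + 1)) → P s) {s} (h : ConstTail s) : P s := by
  have key : ∀ i : Fin 8, P (fun _ => i) → ∀ N s, (∀ k ≥ N, s k = i) → P s := by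
    intro i hi N
    induction N with
    | zero =>
      intro s h
      have : s = fun _ => i := funext fun k => h k (Nat.zero_le k)
      rwa [this]
    | succ N ih => exact fun s h => hs s (ih _ fun k hk => h (k + 1) (by omega))
  rcases h with ⟨N, h⟩ | ⟨N, h⟩
  · exact key 1 h1 N s h
  · exact key 7 h7 N s h

theorem branch_injOn {i : Fin 8} {θ φ : ℝ} (hθ : θ ∈ closedSector i) (hφ : φ ∈ closedSector i)
    (h : branch i θ = branch i φ) : θ = φ := by
  obtain ⟨c, hc, h1⟩ := branch_spec i θ
  obtain ⟨c', hc', h2⟩ := branch_spec i φ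
  rw [← h] at h2
  have hc0 : (c' : ℂ) ≠ 0 := by exact_mod_cast hc'
  have hp := Real.pi_pos
  obtain ⟨a1, a2⟩ := hθ
  obtain ⟨b1, b2⟩ := hφ
  rw [add_mul, add_div, one_mul] at a2 b2
  refine eq_of_parallel (c := c / c') (by linarith) (by linarith) (sub_eq_zero.1 ?_)
  apply lin_ν_eq_zero (i := i)
  apply lin_γ_eq_zero
  rw [sub_eq_add_neg, lin_add, lin_add, lin_neg, lin_neg, lin_real_mul, lin_real_mul, h1, h2]
  push_cast
  field_simp
  ring

/-- Constant tails determine the direction, and each branch is injective on its sector; this makes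
the nested intersection a single point. -/
theorem ConstTail.eq {s} (hs : ConstTail s) : ∀ θ φ, (∀ n, θ ∈ sectorCF n s) →
    (∀ n, φ ∈ sectorCF n s) → θ = φ := by
  refine hs.induction (P := fun s => ∀ θ φ, (∀ n, θ ∈ sectorCF n s) →
    (∀ n, φ ∈ sectorCF n s) → θ = φ) ?_ ?_ ?_
  · intro θ φ h1 h2; rw [eq_of_const_one h1, eq_of_const_one h2]
  · intro θ φ h1 h2; rw [eq_pi_of_const_seven h1, eq_pi_of_const_seven h2]
  · intro s ih θ φ h1 h2
    exact branch_injOn (h1 1).1 (h2 1).1 (ih _ _ (fun n => (h1 (n + 1)).2) fun n => (h2 (n + 1)).2)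

theorem ConstTail.isExpansion {s θ} (hs : ConstTail s) (h0 : ∀ k, s k = 0 → k = 0)
    (h : ∀ n, θ ∈ sectorCF n s) : IsExpansion s θ := by
  refine ⟨h0, Set.eq_singleton_iff_unique_mem.2 ⟨Set.mem_iInter.2 h, fun φ hφ => ?_⟩⟩
  exact hs.eq _ _ (Set.mem_iInter.1 hφ) h

/-- The tail directions `π / 8` and `π` are settled by cylinders; each earlier entry pulls the
property back along the affine map with linear part `γ ν_i`. -/
theorem ConstTail.completelyPeriodic {s} (hs : ConstTail s) : ∀ θ, (∀ n, θ ∈ sectorCF n s) →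
    ∀ c : ℝ, c ≠ 0 → CompletelyPeriodic (c * dir θ) := by
  refine hs.induction (P := fun s => ∀ θ, (∀ n, θ ∈ sectorCF n s) →
    ∀ c : ℝ, c ≠ 0 → CompletelyPeriodic (c * dir θ)) ?_ ?_ ?_
  · intro θ h c hc
    rw [eq_of_const_one h]
    refine completelyPeriodic_diagonal (mul_ne_zero (by exact_mod_cast hc) (dir_ne_zero _)) ?_
    rw [Complex.re_ofReal_mul, Complex.im_ofReal_mul, dir_re, dir_im, cos_eq_sil_mul_sin]; ring
  · intro θ h c hc
    rw [eq_pi_of_const_seven h]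
    refine completelyPeriodic_horizontal (mul_ne_zero (by exact_mod_cast hc) (dir_ne_zero _)) ?_
    rw [Complex.im_ofReal_mul, dir_im, Real.sin_pi, mul_zero]
  · intro s ih θ h c hc
    obtain ⟨c', hc', h'⟩ := branch_spec (s 0) θ
    refine (isAffine_γ.mul (isAffine_ν (s 0))).completelyPeriodic ?_
    have := ih (branch (s 0) θ) (fun n => (h (n + 1)).2) (c * c') (mul_ne_zero hc hc')
    rw [lin_mul, lin_real_mul, lin_real_mul, h']
    convert this using 1
    push_cast; ring

/-! ### Descent from holonomy vectors to expansions. -/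

/-- The direction has an expansion with constant tail and without zero entries. -/
def HasExpansion (θ : ℝ) : Prop :=
  ∃ s, (∀ k, s k ≠ 0) ∧ ConstTail s ∧ ∀ n, θ ∈ sectorCF n s

/-- Adding an entry in front of an expansion. -/
theorem HasExpansion.cons {θ : ℝ} {i : Fin 8} (hθ : θ ∈ closedSector i)
    (h : HasExpansion (branch i θ)) : ∃ s, s 0 = i ∧ (∀ k, s (k + 1) ≠ 0) ∧ ConstTail s ∧
      ∀ n, θ ∈ sectorCF n s := by
  obtain ⟨s, h0, ht, hs⟩ := h
  refine ⟨fun k => Nat.casesOn k i s, rfl, h0, ?_, ?_⟩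
  · rcases ht with ⟨N, h⟩ | ⟨N, h⟩
    · refine Or.inl ⟨N + 1, fun k hk => ?_⟩
      obtain ⟨m, rfl⟩ : ∃ m, k = m + 1 := ⟨k - 1, by omega⟩
      exact h m (by omega)
    · refine Or.inr ⟨N + 1, fun k hk => ?_⟩
      obtain ⟨m, rfl⟩ : ∃ m, k = m + 1 := ⟨k - 1, by omega⟩
      exact h m (by omega)
  · intro n
    cases n with
    | zero => exact closedSector_subset _ hθ
    | succ n => exact ⟨hθ, hs n⟩

theorem hasExpansion_const {i : Fin 8} (hi : i = 1 ∨ i = 7) {θ : ℝ} (hθ : θ ∈ closedSector i)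
    (h : branch i θ = θ) : HasExpansion θ := by
  refine ⟨fun _ => i, fun _ => by rcases hi with rfl | rfl <;> simp, ?_, fun n => ?_⟩
  · rcases hi with rfl | rfl
    · exact Or.inl ⟨0, fun _ _ => rfl⟩
    · exact Or.inr ⟨0, fun _ _ => rfl⟩
  · induction n with
    | zero => exact closedSector_subset _ hθ
    | succ n ih => exact ⟨hθ, by rw [h]; exact ih⟩

theorem hasExpansion_pi : HasExpansion Real.pi := by
  have hp := Real.pi_pos
  refine hasExpansion_const (i := 7) (Or.inr rfl) ?_ ?_
  · constructor <;> norm_num <;> linarith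
  · refine branch_eq_of (c := 1) hp le_rfl ?_
    apply Complex.ext
    · rw [lin_γ_re, lin_ν_seven_re, lin_ν_seven_im]; simp
    · rw [lin_γ_im, lin_ν_seven_im]; simp

theorem hasExpansion_pi_div_eight : HasExpansion (Real.pi / 8) := by
  have g1 := sil_sq
  have hp := Real.pi_pos
  refine hasExpansion_const (i := 1) (Or.inl rfl) ?_ ?_
  · constructor <;> norm_num <;> linarith
  · refine branch_eq_of (c := 1) (by linarith) (by linarith) ?_
    apply Complex.ext
    · rw [lin_γ_re, lin_ν_one_re, lin_ν_one_im, Complex.re_ofReal_mul, dir_re, dir_im,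
        cos_eq_sil_mul_sin]
      linear_combination (sil * Real.sin (Real.pi / 8) - 1 / 2 * Real.sin (Real.pi / 8)) * g1
    · rw [lin_γ_im, lin_ν_one_im, Complex.im_ofReal_mul, dir_re, dir_im, cos_eq_sil_mul_sin]
      linear_combination (Real.sin (Real.pi / 8) / 2) * g1

/-- A vector with direction in the sector `i` is mapped by `±ν i` into the sector `0`. -/
theorem exists_normalized {h : ℂ} {θ c : ℝ} {i : Fin 8} (hc : c ≠ 0) (hθ : θ ∈ closedSector i)
    (h1 : h = c * dir θ) : ∃ g, (g = lin (ν i) h ∨ g = -lin (ν i) h) ∧ InCone g ∧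
      ∃ b : ℝ, lin γ g = b * dir (branch i θ) ∧ b ≠ 0 := by
  obtain ⟨e, he, h2⟩ := branch_spec i θ
  have hcone := inCone_lin_ν hθ
  have h3 : lin (ν i) h = c * lin (ν i) (dir θ) := by rw [h1, lin_real_mul]
  have h4 : lin γ (lin (ν i) h) = (c * e : ℝ) * dir (branch i θ) := by
    rw [h3, lin_real_mul, h2]; push_cast; ring
  rcases lt_or_gt_of_ne hc with hneg | hpos
  · refine ⟨-lin (ν i) h, Or.inr rfl, ?_, -(c * e), ?_, neg_ne_zero.2 (mul_ne_zero hc he)⟩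
    · have : -lin (ν i) h = ((-c : ℝ) : ℂ) * lin (ν i) (dir θ) := by rw [h3]; push_cast; ring
      rw [this]
      refine ⟨?_, ?_⟩
      · rw [Complex.im_ofReal_mul]; exact mul_nonneg (by linarith) hcone.1
      · rw [Complex.im_ofReal_mul, Complex.re_ofReal_mul]
        have := mul_le_mul_of_nonneg_left hcone.2 (show 0 ≤ -c by linarith)
        linarith
    · rw [lin_neg, h4]; push_cast; ring
  · refine ⟨lin (ν i) h, Or.inl rfl, ?_, c * e, h4, mul_ne_zero hc he⟩
    rw [h3]
    refine ⟨?_, ?_⟩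
    · rw [Complex.im_ofReal_mul]; exact mul_nonneg hpos.le hcone.1
    · rw [Complex.im_ofReal_mul, Complex.re_ofReal_mul]
      have := mul_le_mul_of_nonneg_left hcone.2 hpos.le
      linarith

/-- Induction on the number of vectors with the same bound `N` that are shorter than `g`. Inside the
cone the next vector is again a bounded holonomy and strictly shorter; on the boundary the direction
is one of the two fixed ones. -/
theorem hasExpansion_of_holonomy (N m : ℕ) : ∀ g φ (b : ℝ), IsHolonomy g → Bounded N g →
    InCone g → {x | Bounded N x ∧ Complex.normSq x < Complex.normSq g}.ncard < m →
    0 < φ → φ ≤ Real.pi → b ≠ 0 → lin γ g = b * dir φ → HasExpansion φ := by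
  have hp := Real.pi_pos
  induction m with
  | zero => intro g φ b _ _ _ hm; exact absurd hm (Nat.not_lt_zero _)
  | succ m ih =>
    intro g φ b hg hN hcone hm h0 h1 hb h
    have hge := pi_div_eight_le_of_γ hcone hg.1 h0 h
    have hsin := sin_pi_div_eight_pos
    by_cases e1 : g.im = 0
    · have hi := lin_γ_im g
      rw [h, Complex.im_ofReal_mul, dir_im, e1] at hi
      have hs := (mul_eq_zero.1 hi).resolve_left hb
      have : φ = Real.pi := by
        by_contra hne
        exact (Real.sin_pos_of_pos_of_lt_pi h0 (lt_of_le_of_ne h1 hne)).ne' hs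
      rw [this]; exact hasExpansion_pi
    by_cases e2 : sil * g.im = g.re
    · have hi := lin_γ_im g
      have hr := lin_γ_re g
      rw [h, Complex.im_ofReal_mul, dir_im] at hi
      rw [h, Complex.re_ofReal_mul, dir_re, ← e2, ← hi] at hr
      have hs : Real.sin (φ - Real.pi / 8) = 0 := by
        rw [sin_sub_pi_div_eight]
        have : b * (sil * Real.sin φ - Real.cos φ) = 0 := by linear_combination -hr
        rw [(mul_eq_zero.1 this).resolve_left hb, mul_zero]
      have := (Real.sin_eq_zero_iff_of_lt_of_lt (by linarith) (by linarith)).1 hs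
      rw [show φ = Real.pi / 8 by linarith]; exact hasExpansion_pi_div_eight
    obtain ⟨j, hj, hj0⟩ := exists_closedSector h0.le h1
    obtain ⟨g', hg', hcone', b', h', hb'⟩ := exists_normalized hb hj h
    have hlt := normSq_γ_lt hcone e1 e2
    have hprop : IsHolonomy g' ∧ Bounded N g' ∧
        Complex.normSq g' = Complex.normSq (lin γ g) := by
      have hγ := hN.map_γ hg hcone
      rcases hg' with rfl | rfl
      · exact ⟨hg.map_γ.map_ν j, hγ.map_ν j, normSq_lin_ν j _⟩
      · exact ⟨(hg.map_γ.map_ν j).neg, (hγ.map_ν j).neg, by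
          rw [Complex.normSq_neg, normSq_lin_ν]⟩
    obtain ⟨p1, p2, p3⟩ := hprop
    rw [← p3] at hlt
    -- The inclusion is strict because `g'` itself belongs only to the larger set.
    have hcard : {x | Bounded N x ∧ Complex.normSq x < Complex.normSq g'}.ncard <
        {x | Bounded N x ∧ Complex.normSq x < Complex.normSq g}.ncard := by
      refine Set.ncard_lt_ncard ?_ ((finite_bounded N).subset fun x hx => hx.1)
      refine ⟨fun x hx => ⟨hx.1, hx.2.trans hlt⟩, fun hsub => ?_⟩
      exact lt_irrefl _ (hsub ⟨p2, hlt⟩ : g' ∈ {x | _ ∧ _}).2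
    have hrec := ih g' (branch j φ) b' p1 p2 hcone' (by omega) (branch_pos j φ)
      (branch_le_pi j φ) hb' h'
    obtain ⟨s, hs0, hs, ht, hs'⟩ := hrec.cons hj
    refine ⟨s, fun k => ?_, ht, hs'⟩
    cases k with
    | zero => rw [hs0]; exact hj0 hge
    | succ k => exact hs k

theorem WeakLinear.rescale {τ v} (h : WeakLinear τ v) {T : ℝ} (hT : 0 < T) :
    WeakLinear (fun t => τ (T * t)) (T * v) := by
  have key : ∀ {u x f}, Starts u x f → Starts (T * u) x fun s => f (T * s) := by
    rintro u x f ⟨q, hq, hx, ε, hε, h⟩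
    refine ⟨q, hq, hx, ε / T, div_pos hε hT, fun s h0 h1 => ?_⟩
    have := h (T * s) (mul_pos hT h0) (by rwa [lt_div_iff₀ hT, mul_comm] at h1)
    convert this using 1
    push_cast; ring
  intro t
  obtain ⟨h1, h2⟩ := h (T * t)
  refine ⟨?_, ?_⟩
  · convert key h1 using 3; ring
  · convert key h2 using 3
    · ring
    · ring

/-- The direction of a periodic trajectory is terminating. -/
theorem isTerminating_of_holonomy {h : ℂ} {θ c : ℝ} (hh : IsHolonomy h) (hc : c ≠ 0)
    (hθ : θ ∈ Set.Icc 0 Real.pi) (h1 : h = c * dir θ) : IsTerminating θ := by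
  obtain ⟨i, hi, -⟩ := exists_closedSector hθ.1 hθ.2
  obtain ⟨g, hg, hcone, b, h2, hb⟩ := exists_normalized hc hi h1
  have hg' : IsHolonomy g := by
    rcases hg with rfl | rfl
    · exact hh.map_ν i
    · exact (hh.map_ν i).neg
  obtain ⟨x, y, z, w, -, -, -, -, H⟩ := hg'.exists_coord hcone
  -- The bound is the sum of the absolute values of the coordinates of `g` itself.
  have he := hasExpansion_of_holonomy _ _ g (branch i θ) b hg' ⟨_, _, _, _, H, le_rfl⟩ hcone
    (Nat.lt_succ_self _) (branch_pos i θ) (branch_le_pi i θ) hb h2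
  obtain ⟨s, -, hs, ht, hs'⟩ := he.cons hi
  refine ⟨s, ht.isExpansion (fun k hk => ?_) hs', ht⟩
  cases k with
  | zero => rfl
  | succ k => exact absurd hk (hs k)

end OctagonFlow

/-! ### The equivalence. -/

theorem proposition2p8 (θ : ℝ) (hθ : θ ∈ Set.Icc 0 Real.pi) (τ : ℝ → OctagonFlow.Surface)
    (hτ : OctagonFlow.IsLinearTrajectory θ τ) :
    (∃ w : ℤ → OctagonFlow.Letter, OctagonFlow.IsCuttingSequence τ w) ∧
    ∀ w : ℤ → OctagonFlow.Letter, OctagonFlow.IsCuttingSequence τ w →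
      List.TFAE [OctagonFlow.IsPeriodicTrajectory τ, OctagonFlow.IsPeriodicWord w,
        OctagonFlow.IsTerminating θ] := by
  obtain ⟨c, hc, v, hv, hs⟩ := hτ
  have hτ : OctagonFlow.StrictLinear τ v := hs
  have hc' : (c : ℂ) ≠ 0 := by exact_mod_cast hc
  have hv' : v = c * OctagonFlow.dir θ := hv
  have hv0 : v ≠ 0 := by rw [hv']; exact mul_ne_zero hc' (OctagonFlow.dir_ne_zero θ)
  refine ⟨hτ.exists_cuttingSequence hv0, fun w hw => ?_⟩
  tfae_have 1 → 2 := OctagonFlow.periodicWord_of_periodic hτ.weakLinear hw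
  tfae_have 2 → 1 := OctagonFlow.periodic_of_periodicWord hτ hw
  tfae_have 3 → 1 := by
    rintro ⟨s, ⟨-, h⟩, ht⟩
    have hmem : θ ∈ ⋂ n : ℕ, OctagonFlow.sectorCF n s := by rw [h]; rfl
    have hcp := OctagonFlow.ConstTail.completelyPeriodic ht θ (Set.mem_iInter.1 hmem) c hc
    rw [← hv'] at hcp
    exact hcp τ hτ.weakLinear
  tfae_have 1 → 3 := by
    rintro ⟨T, hT, hper⟩
    have hT' : (T : ℂ) ≠ 0 := by exact_mod_cast hT.ne'
    -- Rescaling time by `T` makes the period one, so the new velocity `T * v` is the holonomy.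
    refine OctagonFlow.isTerminating_of_holonomy (h := T * v) (c := T * c)
      ⟨mul_ne_zero hT' hv0, _, hτ.weakLinear.rescale hT, fun t => ?_⟩ (mul_ne_zero hT.ne' hc) hθ ?_
    · rw [mul_add, mul_one, hper]
    · rw [hv']; push_cast; ring
  tfae_finish
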